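/- **Generalized Morawetz estimate for the electromagnetic field with non-vanishing charge.** Work on Minkowski space $\mathbb R^{1+3}$ with metric $g=\mathrm{diag}(-1,1,1,1)$, coordinates $(t,x)$, $r=|x|$, $\omega=x/r$, $L=\partial_t+\partial_r$, $\underline L=\partial_t-\partial_r$, and $\{e_A\}_{A=1,2}$ an orthonormal frame tangent to the spheres $r=\mathrm{const}$ in each time slice. Fix a non-decreasing $\chi^+\in C^\infty(\mathbb R)$ with $\chi^+=0$ on $(-\infty,0]$ and $\chi^+=1$ on $[1,\infty)$. Put $\tau_\pm=(1+(t\pm r)^2)^{1/2}$, $\tau_0=\tau_- /\tau_+$ and, with $\chi^+=\chi^+(r-t)$, $$w_\gamma=\chi^+\tau_-^{2\gamma}+(1-\chi^+),\quad w_{\gamma,\epsilon}=\chi^+\tau_-^{2\gamma}+(1-\chi^+)\tau_-^{2\epsilon},\quad w'_{\gamma,\epsilon}=\chi^+\tau_-^{2\gamma-1}+(1-\chi^+)\tau_-^{-2\epsilon-1}.$$ Let $t_0\ge 0$, let $F$ be a real two-form which is $C^1$ near every point of the slab $\{0\le t\le t_0\}$, and let $J$ be a one-form such that on the slab $$\nabla^\beta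 F_{\alpha\beta}=J_\alpha,\qquad \nabla^\beta\,{}^\star F_{\alpha\beta}=0 .$$ Let $E_i=F_{0i}$ and $H_i={}^\star F_{0i}$ be the electric and magnetic fields at $t=0$, let $q=\int_{\mathbb R^3}J_0(0,x)\,dx$ be the charge, and let $E=E^{df}+E^{cf}$ be the Hodge decomposition into divergence-free and curl-free parts, i.e. $E^{cf}=\nabla\varphi$ with $\varphi(x)=-\frac1{4\pi}\int_{\mathbb R^3}\frac{J_0(0,y)}{|x-y|}\,dy$. Let $\overline F$ be the pure-charge two-form with electric part $\overline E_i=\frac{q\,\omega_i}{4\pi r^2}\chi^+(r-t-2)$ and zero magnetic part, let $\widetilde F=F-\overline F$, and let $$\alpha_A=\widetilde F_{LA},\quad \underline\alpha_A=\widetilde F_{\underline LA},\quad \widetilde\rho=\tfrac12\widetilde F_{\underline LL},\quad \sigma=\tfrac12\in^{AB}\widetilde F_{AB}$$ be its null components ($\in_{AB}$ the area form of the spheres). Define, with $C(u)=\{t-r=u\}$ and $dV_{C(u)}$ its Euclidean volume element, $$\begin{aligned} E_0^{(s,\gamma,\epsilon)}(0,t_0)[F]={}&|q|^2+\sup_{0\le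 t\le t_0}\int_{\mathbb R^3\cap\{t\}}\big(\tau_+^{2s}|\alpha|^2+\tau_-^{2s}|\underline\alpha|^2+\tau_+^{2s}(\widetilde\rho^2+\sigma^2)\big)w_\gamma\,dx\\ &+\sup_{u\in\mathbb R}\int_{C(u)\cap\{0\le t\le t_0\}}\big(\tau_+^{2s}|\alpha|^2+\tau_-^{2s}(\widetilde\rho^2+\sigma^2)\big)w_\gamma\,dV_{C(u)}\\ &+\int_0^{t_0}\!\!\int_{\mathbb R^3}\Big(\tau_+^{2s}|\alpha|^2+\tau_0^{1+2\epsilon}\big(\tau_-^{2s}|\underline\alpha|^2+\tau_+^{2s}\widetilde\rho^2+\tau_+^{2s}\sigma^2\big)\Big)w'_{\gamma,\epsilon}\,dx\,dt . \end{aligned}$$ Then for all $\gamma,\epsilon,\delta>0$ there is a constant $C$, depending only on $\gamma,\epsilon,\delta$ and the fixed function $\chi^+$, such that for all $s$ with $\tfrac12<s\le1$, $s+\gamma\le\tfrac32-\delta$ and $\epsilon\le s-\tfrac12$, and for all $t_0,F,J$ as above, $$\begin{aligned} E_0^{(s,\gamma,\epsilon)}(0,t_0)[F]\le C\Big[&\int_0^{t_0}\!\!\int_{\mathbb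 R^3}\big(\tau_+^{2s+1+2\epsilon}\tau_-^{-2\epsilon}|J_L|^2+\tau_+^{1+2\epsilon-2s}\tau_-^{4s-2\epsilon}|J_{\underline L}|^2+\tau_+^{2s}\tau_-|J_A|^2\big)w_{\gamma,\epsilon}\,dx\,dt\\ &+\int_{\mathbb R^3}(1+r^2)^{s+\gamma}\big(|E^{df}|^2+|H|^2\big)\,dx+\big\|(1+r)^{s+\gamma}J_0(0)\big\|_{L^{6/5}_x}^2\Big], \end{aligned}$$ where $|J_A|^2=\delta^{AB}J_AJ_B$. (Both sides take values in $[0,\infty]$; there is nothing to prove when the right-hand side is infinite. In particular the estimate covers every $s$ with $s+\gamma<\frac32$, and for $\gamma<\frac12$ the constant may be taken to depend on $\gamma,\epsilon,\chi^+$ only.) -/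

import Mathlib

open MeasureTheory Set
open scoped ENNReal ContDiff

namespace MorawetzEM

noncomputable section

/-- Euclidean three-space. -/
abbrev Space : Type := EuclideanSpace ℝ (Fin 3)

/-- Minkowski space-time in the global inertial coordinates `p = (t, x)`. -/
abbrev Spacetime : Type := ℝ × Space

/-- Real one-forms at a point of space-time. -/
abbrev OneForm : Type := Spacetime →L[ℝ] ℝ

/-- Real two-forms at a point of space-time. -/
abbrev TwoForm : Type := Spacetime [⋀^Fin 2]→L[ℝ] ℝ

/-! ### Minkowski geometry and Maxwell's equations -/

/-- The coordinate vector fields: `∂ 0 = ∂ₜ` and `∂ 1, ∂ 2, ∂ 3` the spatial ones. -/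
def basisVec : Fin 4 → Spacetime :=
  Fin.cons (1, 0) (fun i : Fin 3 => (0, EuclideanSpace.single i 1))

/-- The coordinates of a space-time vector. -/
def coord (v : Spacetime) : Fin 4 → ℝ := Fin.cons v.1 (fun i : Fin 3 => v.2 i)

/-- The diagonal entries of the (inverse) Minkowski metric `diag (-1, 1, 1, 1)`. -/
def eta (a : Fin 4) : ℝ := if a = 0 then -1 else 1

/-- The Lorentzian volume form, with the orientation for which `∈₀₁₂₃ = -1`, that is
`∈⁰¹²³ = 1`. -/
def volForm (v : Fin 4 → Spacetime) : ℝ := -Matrix.det (Matrix.of fun a => coord (v a))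

/-- The coordinate components `G_{ab}` of a two-form. -/
def comp (G : TwoForm) (a b : Fin 4) : ℝ := G ![basisVec a, basisVec b]

/-- The components of the Hodge dual, `⋆G_{ab} = 1/2 ∈_{ab}^{cd} G_{cd}`. -/
def hodge (G : TwoForm) (a b : Fin 4) : ℝ :=
  (1 / 2) * ∑ c, ∑ d, eta c * eta d *
    volForm ![basisVec a, basisVec b, basisVec c, basisVec d] * comp G c d

/-- The divergence `∇^b G_{ab}` at the point `p` of a tensor field given by its components. -/
def tensorDiv (G : Spacetime → Fin 4 → Fin 4 → ℝ) (a : Fin 4) (p : Spacetime) : ℝ :=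
  ∑ b, eta b * fderiv ℝ (fun y => G y a b) p (basisVec b)

/-- Maxwell's equations `∇^b F_{ab} = J_a`, `∇^b ⋆F_{ab} = 0` at every point of `S`. -/
def MaxwellOn (F : Spacetime → TwoForm) (J : Spacetime → OneForm) (S : Set Spacetime) : Prop :=
  ∀ p ∈ S, ∀ a : Fin 4,
    tensorDiv (fun y => comp (F y)) a p = J p (basisVec a) ∧
    tensorDiv (fun y => hodge (F y)) a p = 0

/-- The time slab `0 ≤ t ≤ t₀`. -/
def slab (t₀ : ℝ) : Set Spacetime := {p | 0 ≤ p.1 ∧ p.1 ≤ t₀}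

/-- The electric field `E_i = F_{0i}`. -/
def electric (G : TwoForm) : Space := WithLp.toLp 2 fun i : Fin 3 => comp G 0 i.succ

/-- The magnetic field `H_i = ⋆F_{0i}`. -/
def magnetic (G : TwoForm) : Space := WithLp.toLp 2 fun i : Fin 3 => hodge G 0 i.succ

/-! ### The spherical null frame

All null components are defined at the points where `r ≠ 0`; the value at `r = 0` plays no
role, since only integrals of them are used. -/

/-- The unit radial direction `ω = x / r`. -/
def omega (p : Spacetime) : Space := ‖p.2‖⁻¹ • p.2

/-- `L = ∂ₜ + ∂ᵣ`. -/
def vecL (p : Spacetime) : Spacetime := (1, omega p)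

/-- `Lbar = ∂ₜ - ∂ᵣ`. -/
def vecLbar (p : Spacetime) : Spacetime := (1, -omega p)

/-- The angular part `∂_i - ω_i ∂ᵣ` of `∂_i`. If `e_1, e_2` is an orthonormal frame tangent to
the sphere `r = const`, this is `⟨∂_i, e_A⟩ e_A`, hence
`∑ A, ξ(e_A)² = ∑ i, ξ(∂_i - ω_i ∂ᵣ)²` for every one-form `ξ`, and likewise for contractions
of two-tensors over the angular indices. -/
def angVec (p : Spacetime) (i : Fin 3) : Spacetime :=
  (0, EuclideanSpace.single i 1 - (omega p) i • omega p)

/-- `|α|² = δ^{AB} α_A α_B`, where `α_A = G(L, e_A)`. -/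
def alphaSq (G : TwoForm) (p : Spacetime) : ℝ := ∑ i, (G ![vecL p, angVec p i]) ^ 2

/-- `|αbar|² = δ^{AB} αbar_A αbar_B`, where `αbar_A = G(Lbar, e_A)`. -/
def alphaBarSq (G : TwoForm) (p : Spacetime) : ℝ := ∑ i, (G ![vecLbar p, angVec p i]) ^ 2

/-- `ρ = 1/2 G(Lbar, L)`. -/
def rho (G : TwoForm) (p : Spacetime) : ℝ := (1 / 2) * G ![vecLbar p, vecL p]

/-- `σ = 1/2 ∈^{AB} G_{AB}`, where `∈_{AB} = 1/2 ∈(Lbar, L, e_A, e_B)`. -/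
def sigma (G : TwoForm) (p : Spacetime) : ℝ :=
  (1 / 2) * ∑ i, ∑ j,
    ((1 / 2) * volForm ![vecLbar p, vecL p, angVec p i, angVec p j]) *
      G ![angVec p i, angVec p j]

/-- The squared length `δ^{AB} J_A J_B` of the angular part of a one-form. -/
def angSq (j : OneForm) (p : Spacetime) : ℝ := ∑ i, (j (angVec p i)) ^ 2

/-! ### Weights -/

/-- `χ` is a smoothed Heaviside function. -/
structure IsSmoothStep (χ : ℝ → ℝ) : Prop where
  smooth : ContDiff ℝ ∞ χ
  mono : Monotone χ
  eq_zero : ∀ y, y ≤ 0 → χ y = 0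
  eq_one : ∀ y, 1 ≤ y → χ y = 1

/-- `τ₊ = (1 + (t + r)²)^(1/2)`. -/
def tauPlus (p : Spacetime) : ℝ := Real.sqrt (1 + (p.1 + ‖p.2‖) ^ 2)

/-- `τ₋ = (1 + (t - r)²)^(1/2)`. -/
def tauMinus (p : Spacetime) : ℝ := Real.sqrt (1 + (p.1 - ‖p.2‖) ^ 2)

/-- `τ₀ = τ₋ / τ₊`. -/
def tauZero (p : Spacetime) : ℝ := tauMinus p / tauPlus p

/-- The weight `w_γ`. -/
def weight (χ : ℝ → ℝ) (γ : ℝ) (p : Spacetime) : ℝ :=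
  χ (‖p.2‖ - p.1) * tauMinus p ^ (2 * γ) + (1 - χ (‖p.2‖ - p.1))

/-- The weight `w_{γ,ε}`. -/
def weightEps (χ : ℝ → ℝ) (γ ε : ℝ) (p : Spacetime) : ℝ :=
  χ (‖p.2‖ - p.1) * tauMinus p ^ (2 * γ) + (1 - χ (‖p.2‖ - p.1)) * tauMinus p ^ (2 * ε)

/-- The weight `w'_{γ,ε}`. -/
def weightPrime (χ : ℝ → ℝ) (γ ε : ℝ) (p : Spacetime) : ℝ :=
  χ (‖p.2‖ - p.1) * tauMinus p ^ (2 * γ - 1) +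
    (1 - χ (‖p.2‖ - p.1)) * tauMinus p ^ (-2 * ε - 1)

/-! ### Charge, pure-charge field and remainder -/

/-- The charge `q = ∫ J₀(0, x) dx`, measured on the initial slice. -/
def charge (J : Spacetime → OneForm) : ℝ := ∫ x : Space, J (0, x) (basisVec 0)

/-- The wedge product of two one-forms, `(a ∧ b)(v, w) = a v * b w - a w * b v`. -/
def wedge (a b : OneForm) : TwoForm :=
  ContinuousMultilinearMap.alternatization
    ((ContinuousMultilinearMap.mkPiAlgebra ℝ (Fin 2) ℝ).compContinuousLinearMap ![a, b])

theorem wedge_apply (a b : OneForm) (v w : Spacetime) :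
    wedge a b ![v, w] = a v * b w - a w * b v := by
  simp [wedge, ContinuousMultilinearMap.alternatization_apply_apply, Fin.sum_univ_two,
    Fin.prod_univ_two, Finset.univ_perm_fin_succ, ← Finset.univ_product_univ]
  ring

/-- The pure-charge field `q / (4 π r²) * χ(r - t - 2) dt ∧ dr` on `t ≥ 0`; its electric part is
`q ω / (4 π r²) * χ(r - t - 2)` and its magnetic part vanishes. -/
def chargeField (χ : ℝ → ℝ) (q : ℝ) (p : Spacetime) : TwoForm :=
  (q / (4 * Real.pi * ‖p.2‖ ^ 2) * χ (‖p.2‖ - p.1 - 2)) •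
    wedge (ContinuousLinearMap.fst ℝ ℝ Space)
      ((innerSL ℝ (omega p)).comp (ContinuousLinearMap.snd ℝ ℝ Space))

/-- The remainder field obtained from `F` by subtracting the pure-charge field. -/
def remainder (χ : ℝ → ℝ) (F : Spacetime → TwoForm) (J : Spacetime → OneForm)
    (p : Spacetime) : TwoForm :=
  F p - chargeField χ (charge J) p

/-! ### The energy -/

/-- The integral of `f` over `C(u) ∩ {0 ≤ t ≤ t₀}`, where `C(u) = {t - r = u}` carries the
Euclidean volume element of a hypersurface of `ℝ⁴`. As `C(u)` is the graph of
`x ↦ u + |x|`, whose gradient has length one, this element is `√2 dx`. -/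
def coneIntegral (u t₀ : ℝ) (f : Spacetime → ℝ) : ℝ≥0∞ :=
  ENNReal.ofReal (Real.sqrt 2) *
    ∫⁻ x in {x : Space | 0 ≤ u + ‖x‖ ∧ u + ‖x‖ ≤ t₀}, ENNReal.ofReal (f (u + ‖x‖, x))

/-- The fixed-time energy density of a field `G`. -/
def fixedTimeDensity (χ : ℝ → ℝ) (s γ : ℝ) (G : Spacetime → TwoForm) (p : Spacetime) : ℝ :=
  (tauPlus p ^ (2 * s) * alphaSq (G p) p + tauMinus p ^ (2 * s) * alphaBarSq (G p) p
    + tauPlus p ^ (2 * s) * (rho (G p) p ^ 2 + sigma (G p) p ^ 2)) * weight χ γ p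

/-- The characteristic energy density of a field `G`. -/
def coneDensity (χ : ℝ → ℝ) (s γ : ℝ) (G : Spacetime → TwoForm) (p : Spacetime) : ℝ :=
  (tauPlus p ^ (2 * s) * alphaSq (G p) p
    + tauMinus p ^ (2 * s) * (rho (G p) p ^ 2 + sigma (G p) p ^ 2)) * weight χ γ p

/-- The space-time energy density of a field `G`. -/
def bulkDensity (χ : ℝ → ℝ) (s γ ε : ℝ) (G : Spacetime → TwoForm) (p : Spacetime) : ℝ :=
  (tauPlus p ^ (2 * s) * alphaSq (G p) p
    + tauZero p ^ (1 + 2 * ε) *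
      (tauMinus p ^ (2 * s) * alphaBarSq (G p) p + tauPlus p ^ (2 * s) * rho (G p) p ^ 2
        + tauPlus p ^ (2 * s) * sigma (G p) p ^ 2)) * weightPrime χ γ ε p

/-- The charge modified generalized Morawetz energy of `F` in the slab `0 ≤ t ≤ t₀`. -/
def morawetzEnergy (χ : ℝ → ℝ) (s γ ε t₀ : ℝ) (F : Spacetime → TwoForm)
    (J : Spacetime → OneForm) : ℝ≥0∞ :=
  ENNReal.ofReal (|charge J| ^ 2)
    + (⨆ t ∈ Icc (0 : ℝ) t₀, ∫⁻ x : Space,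
        ENNReal.ofReal (fixedTimeDensity χ s γ (remainder χ F J) (t, x)))
    + (⨆ u : ℝ, coneIntegral u t₀ (coneDensity χ s γ (remainder χ F J)))
    + ∫⁻ t in Icc (0 : ℝ) t₀, ∫⁻ x : Space,
        ENNReal.ofReal (bulkDensity χ s γ ε (remainder χ F J) (t, x))

/-! ### The right-hand side -/

/-- The weighted space-time norm (squared) of the null components of the current. -/
def currentNormSq (χ : ℝ → ℝ) (s γ ε t₀ : ℝ) (J : Spacetime → OneForm) : ℝ≥0∞ :=
  ∫⁻ t in Icc (0 : ℝ) t₀, ∫⁻ x : Space, ENNReal.ofReal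
    ((tauPlus (t, x) ^ (2 * s + 1 + 2 * ε) * tauMinus (t, x) ^ (-2 * ε)
          * |J (t, x) (vecL (t, x))| ^ 2
      + tauPlus (t, x) ^ (1 + 2 * ε - 2 * s) * tauMinus (t, x) ^ (4 * s - 2 * ε)
          * |J (t, x) (vecLbar (t, x))| ^ 2
      + tauPlus (t, x) ^ (2 * s) * tauMinus (t, x) * angSq (J (t, x)) (t, x))
      * weightEps χ γ ε (t, x))

/-- The potential `φ = Δ⁻¹ J₀(0)`, that is `φ(x) = -1/(4π) ∫ J₀(0, y) / |x - y| dy`. -/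
def potential (J : Spacetime → OneForm) (x : Space) : ℝ :=
  -(1 / (4 * Real.pi)) * ∫ y : Space, ‖x - y‖⁻¹ * J (0, y) (basisVec 0)

/-- The curl-free part `∇φ` of the initial electric field. -/
def electricCF (J : Spacetime → OneForm) (x : Space) : Space := gradient (potential J) x

/-- The divergence-free part of the initial electric field. -/
def electricDF (F : Spacetime → TwoForm) (J : Spacetime → OneForm) (x : Space) : Space :=
  electric (F (0, x)) - electricCF J x

/-- The weighted `L²` norm (squared) of the initial data `(E^{df}, H)`. -/
def dataNormSq (s γ : ℝ) (F : Spacetime → TwoForm) (J : Spacetime → OneForm) : ℝ≥0∞ :=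
  ∫⁻ x : Space, ENNReal.ofReal
    ((1 + ‖x‖ ^ 2) ^ (s + γ) * (‖electricDF F J x‖ ^ 2 + ‖magnetic (F (0, x))‖ ^ 2))

/-- The norm `‖(1 + r)^{s + γ} J₀(0)‖` in `L^{6/5}`. -/
def chargeDensityNorm (s γ : ℝ) (J : Spacetime → OneForm) : ℝ≥0∞ :=
  eLpNorm (fun x : Space => (1 + ‖x‖) ^ (s + γ) * J (0, x) (basisVec 0)) (6 / 5) volume

end

end MorawetzEM

namespace MorawetzEM

noncomputable section

/-! ### Null components in terms of the electric and magnetic fields -/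

/-! The proof is the multiplier method, applied to the remainder field `F - F̄`, followed by a
potential-theoretic estimate of its data at `t = 0`.

Write `u = t - r`, `v = t + r`. The energy-momentum tensor of the remainder is contracted with `P L
+ Q Lbar`, where `P = W τ₊^{2s}`, `Q = W τ₋^{2s}` and `W = wIn(u) + kIn(u) mOut(v)`. This `W` is
comparable to `w_γ` but monotone in both optical variables. The divergence of the current
(`div_current`, `bulk_ge`) then has a sign. Since `-∂_u W` dominates `w'_{γ,ε}`, the term in `α` is
controlled. Since `-∂_v W` dominates `τ₀^{1+2ε} w'_{γ,ε}`, so are `αbar`, `ρ`, `σ`. There remains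
the coefficient of `ρ² + σ²` that contains no derivative of `W`. It is nonnegative because the
trapezoidal rule overestimates increments of `y ↦ (1 + y²)^s` for `1/2 ≤ s ≤ 1` (`trapezoid`); for
`s = 1` it vanishes, which is the conformal Morawetz field. The source term is absorbed by
Cauchy–Schwarz (`source_le`); the weights of the current on the right-hand side are those that this
requires. The condition `ε ≤ s - 1/2` enters there.

The current is integrated over the slab with three cutoffs. A radial one excises the axis, where the
null frame is singular, and costs `O(η²)` for radius `η`. A cutoff in `v` provides compact support,
and its derivative has a favourable sign. A decreasing function `ζ` of `u` yields a flux term with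
density `-ζ'`; concentrating `-ζ'` at one value of `u` gives the cone integrals, while `ζ = 1` gives
the fixed-time and space-time terms. This leads to `morawetzEnergy_le`: the energy is bounded by the
charge, the initial energy of the remainder and the norm of the modified current.

The modified current differs from `J` by the current of `F̄`, a multiple of `dt - dr` supported in
`2 ≤ r - t ≤ 3`. Only its `Lbar` component is nonzero, of size `|q| / r²`, and it contributes
`O(q²)`. By Hölder, `|q|` is bounded by the weighted `L^{6/5}` norm of `J₀` as soon as `s + γ >
1/2`.

Initially the electric part of the remainder is `E^{df} + (∇φ - Ē)`, and `∇φ - Ē` is an integral of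
`J₀` against the Coulomb kernel at `x - y` minus its value at `y = 0`, cut off for small `x`. The
subtraction improves the decay for `|x| ≫ |y|` from `|x|^{-2}` to `|y| |x|^{-3}`; this allows
weights `s + γ` up to `3/2 - δ` in place of the unmodified threshold `1/2`. With the weights
inserted, the kernel is dominated by the Riesz kernel `|x - y|^{-2}` plus a kernel concentrated on
comparable scales (`excessKernel_le`). The first is bounded from `L^{6/5}` to `L²` by
Hardy–Littlewood–Sobolev (`riesz_le`), the second by a Schur test (`schur_le`). -/

theorem twoForm_swap (G : TwoForm) (v w : Spacetime) : G ![w, v] = -G ![v, w] := by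
  have h := G.map_swap (v := ![v, w]) (i := 0) (j := 1) (by decide)
  have e : ![v, w] ∘ ⇑(Equiv.swap (0 : Fin 2) 1) = ![w, v] := by
    funext i
    fin_cases i <;> simp
  rw [e] at h
  exact h

theorem twoForm_self (G : TwoForm) (v : Spacetime) : G ![v, v] = 0 := by
  have := twoForm_swap G v v
  linarith

theorem twoForm_add_left (G : TwoForm) (v v' w : Spacetime) :
    G ![v + v', w] = G ![v, w] + G ![v', w] := by
  simpa using G.map_vecCons_add (x := v) (y := v') ![w]

theorem twoForm_smul_left (G : TwoForm) (c : ℝ) (v w : Spacetime) :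
    G ![c • v, w] = c * G ![v, w] := by
  simpa using G.map_vecCons_smul ![w] c v

theorem twoForm_add_right (G : TwoForm) (v w w' : Spacetime) :
    G ![v, w + w'] = G ![v, w] + G ![v, w'] := by
  rw [twoForm_swap, twoForm_add_left, twoForm_swap G v w, twoForm_swap G v w']
  ring

theorem twoForm_smul_right (G : TwoForm) (c : ℝ) (v w : Spacetime) :
    G ![v, c • w] = c * G ![v, w] := by
  rw [twoForm_swap, twoForm_smul_left, twoForm_swap G v w]
  ring

theorem basisVec_zero : basisVec 0 = (1, 0) := rfl
theorem basisVec_one : basisVec 1 = (0, EuclideanSpace.single 0 1) := rfl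
theorem basisVec_two : basisVec 2 = (0, EuclideanSpace.single 1 1) := rfl
theorem basisVec_three : basisVec 3 = (0, EuclideanSpace.single 2 1) := rfl

theorem eq_coord_sum (v : Spacetime) :
    v = v.1 • basisVec 0 + (v.2 0 • basisVec 1 + (v.2 1 • basisVec 2 + v.2 2 • basisVec 3)) := by
  refine Prod.ext ?_ ?_
  · simp [basisVec_zero, basisVec_one, basisVec_two, basisVec_three]
  · ext i
    fin_cases i <;> simp [basisVec_zero, basisVec_one, basisVec_two, basisVec_three]

theorem comp_swap (G : TwoForm) (a b : Fin 4) : comp G b a = -comp G a b := twoForm_swap G _ _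

theorem comp_self (G : TwoForm) (a : Fin 4) : comp G a a = 0 := twoForm_self G _

/-- The electric components. -/
def el (G : TwoForm) (i : Fin 3) : ℝ := comp G 0 i.succ

/-- The magnetic components. -/
def mg (G : TwoForm) (i : Fin 3) : ℝ := hodge G 0 i.succ

theorem volForm_apply (a b c d : Spacetime) : volForm ![a, b, c, d] =
    -Matrix.det !![a.1, a.2 0, a.2 1, a.2 2; b.1, b.2 0, b.2 1, b.2 2;
      c.1, c.2 0, c.2 1, c.2 2; d.1, d.2 0, d.2 1, d.2 2] := by
  unfold volForm
  congr 2
  ext i j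
  fin_cases i <;> fin_cases j <;> rfl

theorem det_four (M : Matrix (Fin 4) (Fin 4) ℝ) : M.det =
    M 0 0 * (M 1 1 * (M 2 2 * M 3 3 - M 2 3 * M 3 2) - M 1 2 * (M 2 1 * M 3 3 - M 2 3 * M 3 1)
      + M 1 3 * (M 2 1 * M 3 2 - M 2 2 * M 3 1))
    - M 0 1 * (M 1 0 * (M 2 2 * M 3 3 - M 2 3 * M 3 2) - M 1 2 * (M 2 0 * M 3 3 - M 2 3 * M 3 0)
      + M 1 3 * (M 2 0 * M 3 2 - M 2 2 * M 3 0))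
    + M 0 2 * (M 1 0 * (M 2 1 * M 3 3 - M 2 3 * M 3 1) - M 1 1 * (M 2 0 * M 3 3 - M 2 3 * M 3 0)
      + M 1 3 * (M 2 0 * M 3 1 - M 2 1 * M 3 0))
    - M 0 3 * (M 1 0 * (M 2 1 * M 3 2 - M 2 2 * M 3 1) - M 1 1 * (M 2 0 * M 3 2 - M 2 2 * M 3 0)
      + M 1 2 * (M 2 0 * M 3 1 - M 2 1 * M 3 0)) := by
  rw [Matrix.det_succ_row_zero]
  simp [Fin.sum_univ_four, Matrix.det_fin_three, Fin.succAbove]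
  ring

theorem hodge_values (G : TwoForm) :
    hodge G 0 1 = -comp G 2 3 ∧ hodge G 0 2 = comp G 1 3 ∧ hodge G 0 3 = -comp G 1 2 ∧
    hodge G 2 3 = comp G 0 1 ∧ hodge G 1 3 = -comp G 0 2 ∧ hodge G 1 2 = comp G 0 3 := by
  have h := comp_swap G
  refine ⟨?_, ?_, ?_, ?_, ?_, ?_⟩ <;>
  · simp [hodge, Fin.sum_univ_four, eta, volForm_apply, det_four, basisVec_zero, basisVec_one,
      basisVec_two, basisVec_three]
    try rw [h 2 3]
    try rw [h 1 3]
    try rw [h 1 2]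
    try rw [h 0 1]
    try rw [h 0 2]
    try rw [h 0 3]
    ring

theorem hodge_self (G : TwoForm) (a : Fin 4) : hodge G a a = 0 := by
  fin_cases a <;>
  simp [hodge, eta, volForm_apply, det_four, basisVec_zero, basisVec_one,
      basisVec_two, basisVec_three]

theorem hodge_swap (G : TwoForm) (a b : Fin 4) : hodge G b a = -hodge G a b := by
  fin_cases a <;> fin_cases b <;>
  simp [hodge, Fin.sum_univ_four, eta, volForm_apply, det_four, basisVec_zero, basisVec_one,
      basisVec_two, basisVec_three] <;> ring

theorem comp_values (G : TwoForm) :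
    comp G 0 1 = el G 0 ∧ comp G 0 2 = el G 1 ∧ comp G 0 3 = el G 2 ∧
    comp G 2 3 = -mg G 0 ∧ comp G 1 3 = mg G 1 ∧ comp G 1 2 = -mg G 2 := by
  obtain ⟨h1, h2, h3, -⟩ := hodge_values G
  refine ⟨rfl, rfl, rfl, ?_, ?_, ?_⟩
  · have : mg G 0 = hodge G 0 1 := rfl
    rw [this, h1]; ring
  · have : mg G 1 = hodge G 0 2 := rfl
    rw [this, h2]
  · have : mg G 2 = hodge G 0 3 := rfl
    rw [this, h3]; ring

theorem twoForm_apply (G : TwoForm) (v w : Spacetime) : G ![v, w] =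
    el G 0 * (v.1 * w.2 0 - v.2 0 * w.1) + el G 1 * (v.1 * w.2 1 - v.2 1 * w.1)
      + el G 2 * (v.1 * w.2 2 - v.2 2 * w.1)
      - (mg G 0 * (v.2 1 * w.2 2 - v.2 2 * w.2 1) + mg G 1 * (v.2 2 * w.2 0 - v.2 0 * w.2 2)
        + mg G 2 * (v.2 0 * w.2 1 - v.2 1 * w.2 0)) := by
  obtain ⟨h1, h2, h3, h4, h5, h6⟩ := comp_values G
  conv_lhs => rw [eq_coord_sum v, eq_coord_sum w]
  simp only [twoForm_add_left, twoForm_add_right, twoForm_smul_left, twoForm_smul_right]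
  have e : ∀ a b, G ![basisVec a, basisVec b] = comp G a b := fun _ _ => rfl
  simp only [e]
  rw [comp_swap G 0 1, comp_swap G 0 2, comp_swap G 0 3, comp_swap G 1 2, comp_swap G 1 3,
    comp_swap G 2 3]
  simp only [comp_self]
  rw [h1, h2, h3, h4, h5, h6]
  ring

/-- Space-time points off the axis carry a unit radial direction. -/
theorem omega_sq {p : Spacetime} (hp : p.2 ≠ 0) :
    omega p 0 ^ 2 + omega p 1 ^ 2 + omega p 2 ^ 2 = 1 := by
  have h : ‖omega p‖ = 1 := by
    rw [omega, norm_smul, norm_inv, norm_norm, inv_mul_cancel₀ (norm_ne_zero_iff.mpr hp)]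
  have h2 := EuclideanSpace.norm_sq_eq (omega p)
  rw [h] at h2
  simp [Fin.sum_univ_three] at h2
  linarith

theorem angVec_fst (p : Spacetime) (i : Fin 3) : (angVec p i).1 = 0 := rfl

theorem angVec_snd (p : Spacetime) (i j : Fin 3) :
    (angVec p i).2 j = (if j = i then 1 else 0) - omega p i * omega p j := by
  simp [angVec]

theorem vecL_angVec (G : TwoForm) (p : Spacetime) :
    G ![vecL p, angVec p 0] = el G 0 - omega p 0 * (el G 0 * omega p 0 + el G 1 * omega p 1
        + el G 2 * omega p 2) + (omega p 1 * mg G 2 - omega p 2 * mg G 1) ∧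
    G ![vecL p, angVec p 1] = el G 1 - omega p 1 * (el G 0 * omega p 0 + el G 1 * omega p 1
        + el G 2 * omega p 2) + (omega p 2 * mg G 0 - omega p 0 * mg G 2) ∧
    G ![vecL p, angVec p 2] = el G 2 - omega p 2 * (el G 0 * omega p 0 + el G 1 * omega p 1
        + el G 2 * omega p 2) + (omega p 0 * mg G 1 - omega p 1 * mg G 0) := by
  refine ⟨?_, ?_, ?_⟩ <;>
  · rw [twoForm_apply]
    simp only [angVec_fst, angVec_snd, vecL]
    simp
    ring

theorem vecLbar_angVec (G : TwoForm) (p : Spacetime) :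
    G ![vecLbar p, angVec p 0] = el G 0 - omega p 0 * (el G 0 * omega p 0 + el G 1 * omega p 1
        + el G 2 * omega p 2) - (omega p 1 * mg G 2 - omega p 2 * mg G 1) ∧
    G ![vecLbar p, angVec p 1] = el G 1 - omega p 1 * (el G 0 * omega p 0 + el G 1 * omega p 1
        + el G 2 * omega p 2) - (omega p 2 * mg G 0 - omega p 0 * mg G 2) ∧
    G ![vecLbar p, angVec p 2] = el G 2 - omega p 2 * (el G 0 * omega p 0 + el G 1 * omega p 1
        + el G 2 * omega p 2) - (omega p 0 * mg G 1 - omega p 1 * mg G 0) := by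
  refine ⟨?_, ?_, ?_⟩ <;>
  · rw [twoForm_apply]
    simp only [angVec_fst, angVec_snd, vecLbar]
    simp
    ring

theorem rho_eq (G : TwoForm) {p : Spacetime} :
    rho G p = el G 0 * omega p 0 + el G 1 * omega p 1 + el G 2 * omega p 2 := by
  rw [rho, twoForm_apply]
  simp [vecL, vecLbar]
  ring

theorem sigma_eq (G : TwoForm) {p : Spacetime} (hp : p.2 ≠ 0) :
    sigma G p = mg G 0 * omega p 0 + mg G 1 * omega p 1 + mg G 2 * omega p 2 := by
  have hw := omega_sq hp
  -- Both factors are triple products of the spatial vectors `a_i`, `a_j`: the volume form gives `-2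
  -- ω·(a_i × a_j)` and `G` gives `-H·(a_i × a_j)`.
  have key : ∀ i j : Fin 3, volForm ![vecLbar p, vecL p, angVec p i, angVec p j] *
      G ![angVec p i, angVec p j] = 2 * (((angVec p i).2 1 * (angVec p j).2 2
        - (angVec p i).2 2 * (angVec p j).2 1) * omega p 0 +
        ((angVec p i).2 2 * (angVec p j).2 0
        - (angVec p i).2 0 * (angVec p j).2 2) * omega p 1 +
        ((angVec p i).2 0 * (angVec p j).2 1
        - (angVec p i).2 1 * (angVec p j).2 0) * omega p 2) *
        (((angVec p i).2 1 * (angVec p j).2 2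
        - (angVec p i).2 2 * (angVec p j).2 1) * mg G 0 +
        ((angVec p i).2 2 * (angVec p j).2 0
        - (angVec p i).2 0 * (angVec p j).2 2) * mg G 1 +
        ((angVec p i).2 0 * (angVec p j).2 1
        - (angVec p i).2 1 * (angVec p j).2 0) * mg G 2) := by
    intro i j
    rw [twoForm_apply, volForm_apply, det_four]
    simp [vecL, vecLbar, angVec_fst]
    ring
  unfold sigma
  simp only [Fin.sum_univ_three, mul_assoc, key]
  simp only [angVec_snd]
  simp
  generalize omega p 0 = a at *
  generalize omega p 1 = b at *
  generalize omega p 2 = c at *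
  generalize mg G 0 = x at *
  generalize mg G 1 = y at *
  generalize mg G 2 = z at *
  have ha : 1 - a * a = b * b + c * c := by linarith
  have hb : 1 - b * b = a * a + c * c := by linarith
  have hc : 1 - c * c = a * a + b * b := by linarith
  rw [ha, hb, hc]
  -- After the substitutions the double sum equals `(H·ω) n⁴` with `n = |ω|²`; the coefficient is
  -- the geometric sum `(n⁴ - 1) / (n - 1)`.
  linear_combination (x * a + y * b + z * c) * ((a ^ 2 + b ^ 2 + c ^ 2) ^ 3
    + (a ^ 2 + b ^ 2 + c ^ 2) ^ 2 + (a ^ 2 + b ^ 2 + c ^ 2) + 1) * hw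

theorem alphaSq_eq (G : TwoForm) {p : Spacetime} (hp : p.2 ≠ 0) :
    alphaSq G p = (el G 0 ^ 2 + el G 1 ^ 2 + el G 2 ^ 2) + (mg G 0 ^ 2 + mg G 1 ^ 2 + mg G 2 ^ 2)
      - (rho G p ^ 2 + sigma G p ^ 2)
      + 2 * (el G 0 * (omega p 1 * mg G 2 - omega p 2 * mg G 1)
        + el G 1 * (omega p 2 * mg G 0 - omega p 0 * mg G 2)
        + el G 2 * (omega p 0 * mg G 1 - omega p 1 * mg G 0)) := by
  have hw := omega_sq hp
  obtain ⟨h0, h1, h2⟩ := vecL_angVec G p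
  rw [alphaSq, Fin.sum_univ_three, h0, h1, h2, rho_eq, sigma_eq G hp]
  linear_combination ((el G 0 * omega p 0 + el G 1 * omega p 1 + el G 2 * omega p 2) ^ 2
    + mg G 0 ^ 2 + mg G 1 ^ 2 + mg G 2 ^ 2) * hw

theorem alphaBarSq_eq (G : TwoForm) {p : Spacetime} (hp : p.2 ≠ 0) :
    alphaBarSq G p =
      (el G 0 ^ 2 + el G 1 ^ 2 + el G 2 ^ 2) + (mg G 0 ^ 2 + mg G 1 ^ 2 + mg G 2 ^ 2)
      - (rho G p ^ 2 + sigma G p ^ 2)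
      - 2 * (el G 0 * (omega p 1 * mg G 2 - omega p 2 * mg G 1)
        + el G 1 * (omega p 2 * mg G 0 - omega p 0 * mg G 2)
        + el G 2 * (omega p 0 * mg G 1 - omega p 1 * mg G 0)) := by
  have hw := omega_sq hp
  obtain ⟨h0, h1, h2⟩ := vecLbar_angVec G p
  rw [alphaBarSq, Fin.sum_univ_three, h0, h1, h2, rho_eq, sigma_eq G hp]
  linear_combination ((el G 0 * omega p 0 + el G 1 * omega p 1 + el G 2 * omega p 2) ^ 2
    + mg G 0 ^ 2 + mg G 1 ^ 2 + mg G 2 ^ 2) * hw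

/-! ### Maxwell's equations in components -/

/-- The partial derivative along a coordinate vector field. -/
def pd (b : Fin 4) (f : Spacetime → ℝ) (p : Spacetime) : ℝ := fderiv ℝ f p (basisVec b)

theorem pd_neg (b : Fin 4) (f : Spacetime → ℝ) (p : Spacetime) :
    pd b (fun y => -f y) p = -pd b f p := by
  simp [pd]

theorem pd_zero (b : Fin 4) (p : Spacetime) : pd b (fun _ => 0) p = 0 := by
  simp [pd]

/-- Duality sends `(E, H)` to `(H, -E)`, so the two tensor equations become `div E = J₀`, `∂ₜE =
curl H + J`, `div H = 0`, `∂ₜH = -curl E`. The signs of all later identities follow this convention.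
-/
theorem maxwell_comp {F : Spacetime → TwoForm} {J : Spacetime → OneForm} {S : Set Spacetime}
    (h : MaxwellOn F J S) {p : Spacetime} (hp : p ∈ S) :
    (pd 1 (fun y => el (F y) 0) p + pd 2 (fun y => el (F y) 1) p + pd 3 (fun y => el (F y) 2) p
      = J p (basisVec 0)) ∧
    (pd 0 (fun y => el (F y) 0) p = pd 2 (fun y => mg (F y) 2) p - pd 3 (fun y => mg (F y) 1) p
      + J p (basisVec 1)) ∧
    (pd 0 (fun y => el (F y) 1) p = pd 3 (fun y => mg (F y) 0) p - pd 1 (fun y => mg (F y) 2) p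
      + J p (basisVec 2)) ∧
    (pd 0 (fun y => el (F y) 2) p = pd 1 (fun y => mg (F y) 1) p - pd 2 (fun y => mg (F y) 0) p
      + J p (basisVec 3)) ∧
    (pd 1 (fun y => mg (F y) 0) p + pd 2 (fun y => mg (F y) 1) p + pd 3 (fun y => mg (F y) 2) p
      = 0) ∧
    (pd 0 (fun y => mg (F y) 0) p = -(pd 2 (fun y => el (F y) 2) p - pd 3 (fun y => el (F y) 1) p))
      ∧
    (pd 0 (fun y => mg (F y) 1) p = -(pd 3 (fun y => el (F y) 0) p - pd 1 (fun y => el (F y) 2) p))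
      ∧
    (pd 0 (fun y => mg (F y) 2) p = -(pd 1 (fun y => el (F y) 1) p - pd 2 (fun y => el (F y) 0) p))
      := by
  have c := fun G => comp_values G
  have hh : ∀ G : TwoForm, hodge G 0 1 = mg G 0 ∧ hodge G 0 2 = mg G 1 ∧ hodge G 0 3 = mg G 2 ∧
      hodge G 2 3 = el G 0 ∧ hodge G 1 3 = -el G 1 ∧ hodge G 1 2 = el G 2 := by
    intro G
    obtain ⟨-, -, -, h4, h5, h6⟩ := hodge_values G
    refine ⟨rfl, rfl, rfl, ?_, ?_, ?_⟩
    · rw [h4]; exact (c G).1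
    · rw [h5, (c G).2.1]
    · rw [h6]; exact (c G).2.2.1
  have s : ∀ G : TwoForm, comp G 1 0 = -el G 0 ∧ comp G 2 0 = -el G 1 ∧ comp G 3 0 = -el G 2 ∧
      comp G 3 2 = mg G 0 ∧ comp G 3 1 = -mg G 1 ∧ comp G 2 1 = mg G 2 := by
    intro G
    obtain ⟨h1, h2, h3, h4, h5, h6⟩ := c G
    rw [comp_swap G 0 1, comp_swap G 0 2, comp_swap G 0 3, comp_swap G 2 3, comp_swap G 1 3,
      comp_swap G 1 2, h1, h2, h3, h4, h5, h6]
    simp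
  have sh : ∀ G : TwoForm, hodge G 1 0 = -mg G 0 ∧ hodge G 2 0 = -mg G 1 ∧ hodge G 3 0 = -mg G 2 ∧
      hodge G 3 2 = -el G 0 ∧ hodge G 3 1 = el G 1 ∧ hodge G 2 1 = -el G 2 := by
    intro G
    obtain ⟨h1, h2, h3, h4, h5, h6⟩ := hh G
    rw [hodge_swap G 0 1, hodge_swap G 0 2, hodge_swap G 0 3, hodge_swap G 2 3, hodge_swap G 1 3,
      hodge_swap G 1 2, h1, h2, h3, h4, h5, h6]
    simp
  have e0 : eta 0 = -1 := rfl
  have e1 : eta 1 = 1 := rfl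
  have e2 : eta 2 = 1 := rfl
  have e3 : eta 3 = 1 := rfl
  have fold : ∀ (b : Fin 4) (f : Spacetime → ℝ), fderiv ℝ f p (basisVec b) = pd b f p :=
    fun _ _ => rfl
  have H := fun a => h p hp a
  simp only [tensorDiv, Fin.sum_univ_four, e0, e1, e2, e3, fold] at H
  obtain ⟨a0, b0⟩ := H 0
  obtain ⟨a1, b1⟩ := H 1
  obtain ⟨a2, b2⟩ := H 2
  obtain ⟨a3, b3⟩ := H 3
  simp only [comp_self, hodge_self, c, hh, s, sh, pd_neg, pd_zero] at a0 a1 a2 a3 b0 b1 b2 b3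
  refine ⟨?_, ?_, ?_, ?_, ?_, ?_, ?_, ?_⟩ <;> linarith

/-! ### The divergence of the energy current -/

/-- The energy density of the multiplier `P L + Q Lbar` in terms of the fields. -/
def currentT (P Q : ℝ) (w e h : Fin 3 → ℝ) : ℝ :=
  (P + Q) * ((e 0 * e 0 + e 1 * e 1 + e 2 * e 2 + (h 0 * h 0 + h 1 * h 1 + h 2 * h 2)) / 2)
    + (P - Q) * (e 0 * (w 1 * h 2 - w 2 * h 1) + e 1 * (w 2 * h 0 - w 0 * h 2)
      + e 2 * (w 0 * h 1 - w 1 * h 0))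

/-- The spatial components of the energy current of the multiplier `P L + Q Lbar`. -/
def currentX (P Q : ℝ) (w e h : Fin 3 → ℝ) (i : Fin 3) : ℝ :=
  (P + Q) * (e (i + 2) * h (i + 1) - e (i + 1) * h (i + 2))
    + (P - Q) * (w i * ((e 0 * e 0 + e 1 * e 1 + e 2 * e 2
        + (h 0 * h 0 + h 1 * h 1 + h 2 * h 2)) / 2)
      - e i * (e 0 * w 0 + e 1 * w 1 + e 2 * w 2) - h i * (h 0 * w 0 + h 1 * w 1 + h 2 * w 2))

section Pd

variable {b : Fin 4} {f g : Spacetime → ℝ} {p : Spacetime}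

theorem pd_add (hf : DifferentiableAt ℝ f p) (hg : DifferentiableAt ℝ g p) :
    pd b (fun y => f y + g y) p = pd b f p + pd b g p := by
  simp [pd, fderiv_fun_add hf hg]

theorem pd_sub (hf : DifferentiableAt ℝ f p) (hg : DifferentiableAt ℝ g p) :
    pd b (fun y => f y - g y) p = pd b f p - pd b g p := by
  simp [pd, fderiv_fun_sub hf hg]

theorem pd_mul (hf : DifferentiableAt ℝ f p) (hg : DifferentiableAt ℝ g p) :
    pd b (fun y => f y * g y) p = f p * pd b g p + g p * pd b f p := by
  simp [pd, fderiv_fun_mul hf hg]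

theorem pd_div_two (hf : DifferentiableAt ℝ f p) :
    pd b (fun y => f y / 2) p = pd b f p / 2 := by
  have : (fun y => f y / 2) = fun y => f y * (2 : ℝ)⁻¹ := by
    ext y; rw [div_eq_mul_inv]
  rw [this, pd, fderiv_mul_const hf]
  simp [pd]; ring

end Pd

/-- Poynting's identity for the multiplier `P L + Q Lbar`. The bulk terms are read off from null
derivatives: `Pt - Pr = Lbar P` multiplies `|α|²`, `Qt + Qr = L Q` multiplies `|αbar|²`, and `(P -
Q) / r - (L P + Lbar Q) / 2` multiplies `ρ² + σ²`. Here `ri` stands for `1 / r`, and `P`, `Q` depend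
on `t` and `r` only. -/
theorem div_current {e h w : Fin 3 → Spacetime → ℝ} {P Q : Spacetime → ℝ} {p : Spacetime}
    (he : ∀ i, DifferentiableAt ℝ (e i) p) (hh : ∀ i, DifferentiableAt ℝ (h i) p)
    (hw : ∀ i, DifferentiableAt ℝ (w i) p)
    (hP : DifferentiableAt ℝ P p) (hQ : DifferentiableAt ℝ Q p)
    {ri Pt Pr Qt Qr : ℝ} {j : Fin 4 → ℝ}
    (hunit : w 0 p ^ 2 + w 1 p ^ 2 + w 2 p ^ 2 = 1)
    (hwt : ∀ i, pd 0 (w i) p = 0)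
    (hwx : ∀ i k : Fin 3, pd k.succ (w i) p = ri * ((if i = k then 1 else 0) - w i p * w k p))
    (hPt : pd 0 P p = Pt) (hPx : ∀ k : Fin 3, pd k.succ P p = Pr * w k p)
    (hQt : pd 0 Q p = Qt) (hQx : ∀ k : Fin 3, pd k.succ Q p = Qr * w k p)
    (m0 : pd 1 (e 0) p + pd 2 (e 1) p + pd 3 (e 2) p = j 0)
    (m1 : pd 0 (e 0) p = pd 2 (h 2) p - pd 3 (h 1) p + j 1)
    (m2 : pd 0 (e 1) p = pd 3 (h 0) p - pd 1 (h 2) p + j 2)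
    (m3 : pd 0 (e 2) p = pd 1 (h 1) p - pd 2 (h 0) p + j 3)
    (n0 : pd 1 (h 0) p + pd 2 (h 1) p + pd 3 (h 2) p = 0)
    (n1 : pd 0 (h 0) p = -(pd 2 (e 2) p - pd 3 (e 1) p))
    (n2 : pd 0 (h 1) p = -(pd 3 (e 0) p - pd 1 (e 2) p))
    (n3 : pd 0 (h 2) p = -(pd 1 (e 1) p - pd 2 (e 0) p))
    {ρ σ S : ℝ} (hρ : ρ = e 0 p * w 0 p + e 1 p * w 1 p + e 2 p * w 2 p)
    (hσ : σ = h 0 p * w 0 p + h 1 p * w 1 p + h 2 p * w 2 p)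
    (hS : S = (P p + Q p) * (e 0 p * j 1 + e 1 p * j 2 + e 2 p * j 3)
      + (P p - Q p) * (j 0 * ρ + (j 1 * (w 1 p * h 2 p - w 2 p * h 1 p)
        + j 2 * (w 2 p * h 0 p - w 0 p * h 2 p) + j 3 * (w 0 p * h 1 p - w 1 p * h 0 p))))
    {α β : ℝ} 
    (hα : α = (e 0 p ^ 2 + e 1 p ^ 2 + e 2 p ^ 2) + (h 0 p ^ 2 + h 1 p ^ 2 + h 2 p ^ 2)
      - (ρ ^ 2 + σ ^ 2) + 2 * (e 0 p * (w 1 p * h 2 p - w 2 p * h 1 p)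
        + e 1 p * (w 2 p * h 0 p - w 0 p * h 2 p) + e 2 p * (w 0 p * h 1 p - w 1 p * h 0 p)))
    (hβ : β = (e 0 p ^ 2 + e 1 p ^ 2 + e 2 p ^ 2) + (h 0 p ^ 2 + h 1 p ^ 2 + h 2 p ^ 2)
      - (ρ ^ 2 + σ ^ 2) - 2 * (e 0 p * (w 1 p * h 2 p - w 2 p * h 1 p)
        + e 1 p * (w 2 p * h 0 p - w 0 p * h 2 p) + e 2 p * (w 0 p * h 1 p - w 1 p * h 0 p))) :
    pd 0 (fun y => currentT (P y) (Q y) (w · y) (e · y) (h · y)) p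
      - (pd 1 (fun y => currentX (P y) (Q y) (w · y) (e · y) (h · y) 0) p
        + pd 2 (fun y => currentX (P y) (Q y) (w · y) (e · y) (h · y) 1) p
        + pd 3 (fun y => currentX (P y) (Q y) (w · y) (e · y) (h · y) 2) p)
      = S - (-(1 / 2) * (Pt - Pr) * α - (1 / 2) * (Qt + Qr) * β
        + ((P p - Q p) * ri - (1 / 2) * (Pt + Pr) - (1 / 2) * (Qt - Qr)) * (ρ ^ 2 + σ ^ 2)) := by
  have he0 := he 0
  have he1 := he 1
  have he2 := he 2
  have hh0 := hh 0
  have hh1 := hh 1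
  have hh2 := hh 2
  have hw0 := hw 0
  have hw1 := hw 1
  have hw2 := hw 2
  have q1 := hPx 0
  have q2 := hPx 1
  have q3 := hPx 2
  have q4 := hQx 0
  have q5 := hQx 1
  have q6 := hQx 2
  have x00 := hwx 0 0
  have x01 := hwx 0 1
  have x02 := hwx 0 2
  have x10 := hwx 1 0
  have x11 := hwx 1 1
  have x12 := hwx 1 2
  have x20 := hwx 2 0
  have x21 := hwx 2 1
  have x22 := hwx 2 2
  have s0 : (0 : Fin 3).succ = 1 := rfl
  have s1 : (1 : Fin 3).succ = 2 := rfl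
  have s2 : (2 : Fin 3).succ = 3 := rfl
  have r1 : (0 : Fin 3) + 2 = 2 := rfl
  have r2 : (0 : Fin 3) + 1 = 1 := rfl
  have r3 : (1 : Fin 3) + 2 = 0 := rfl
  have r4 : (1 : Fin 3) + 1 = 2 := rfl
  have r5 : (2 : Fin 3) + 2 = 1 := rfl
  have r6 : (2 : Fin 3) + 1 = 0 := rfl
  simp only [s0, s1, s2] at q1 q2 q3 q4 q5 q6 x00 x01 x02 x10 x11 x12 x20 x21 x22
  rw [if_pos trivial] at x00 x11 x22
  rw [if_neg (by decide)] at x01 x02 x10 x12 x20 x21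
  simp only [currentT, currentX, r1, r2, r3, r4, r5, r6]
  simp (disch := fun_prop) only [pd_add, pd_sub, pd_mul, pd_div_two]
  simp only [hwt, hPt, hQt, q1, q2, q3, q4, q5, q6, x00, x01, x02, x10, x11, x12, x20, x21, x22,
    m1, m2, m3, n1, n2, n3]
  have m0' : pd 1 (e 0) p = j 0 - pd 2 (e 1) p - pd 3 (e 2) p := by linarith
  have n0' : pd 1 (h 0) p = - pd 2 (h 1) p - pd 3 (h 2) p := by linarith
  rw [m0', n0', hS, hα, hβ, hρ, hσ]
  -- The identity holds modulo `|ω|² = 1`; the coefficient collects the places where `|ω|²`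
  -- multiplies the energy density, coming from the radial derivatives of `P`, `Q` and from `div ω`.
  linear_combination (-(Pr - Qr) * ((e 0 p * e 0 p + e 1 p * e 1 p + e 2 p * e 2 p
    + (h 0 p * h 0 p + h 1 p * h 1 p + h 2 p * h 2 p)) / 2)
    + ri * (P p - Q p) * ((e 0 p * e 0 p + e 1 p * e 1 p + e 2 p * e 2 p
    + (h 0 p * h 0 p + h 1 p * h 1 p + h 2 p * h 2 p)) / 2)) * hunit

/-! ### The divergence theorem on a slab -/

theorem slab_eq_prod (T : ℝ) : slab T = Icc (0 : ℝ) T ×ˢ (univ : Set Space) := by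
  ext p; simp [slab]

theorem volume_restrict_slab (T : ℝ) :
    (volume : Measure Spacetime).restrict (slab T) =
      ((volume : Measure ℝ).restrict (Icc 0 T)).prod (volume : Measure Space) := by
  rw [slab_eq_prod, Measure.volume_eq_prod, ← Measure.prod_restrict, Measure.restrict_univ]

theorem measurableSet_slab (T : ℝ) : MeasurableSet (slab T) := by
  rw [slab_eq_prod]; exact measurableSet_Icc.prod MeasurableSet.univ

theorem integrableOn_slab {f : Spacetime → ℝ} {T R : ℝ} (hf : ContinuousOn f (slab T))
    (hR : ∀ p ∈ slab T, R < ‖p.2‖ → f p = 0) : IntegrableOn f (slab T) := by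
  have hK : IsCompact (Icc (0 : ℝ) T ×ˢ Metric.closedBall (0 : Space) R) :=
    isCompact_Icc.prod (isCompact_closedBall 0 R)
  have hsub : Icc (0 : ℝ) T ×ˢ Metric.closedBall (0 : Space) R ⊆ slab T := by
    rw [slab_eq_prod]; exact prod_mono_right (subset_univ _)
  refine IntegrableOn.of_forall_sdiff_eq_zero ((hf.mono hsub).integrableOn_compact hK)
    (measurableSet_slab T) ?_
  rintro p ⟨hp, hp2⟩
  refine hR p hp ?_
  by_contra hcon
  rw [not_lt] at hcon
  exact hp2 ⟨hp, by simpa using hcon⟩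

theorem integral_pd_succ {f : Space → ℝ} {R : ℝ} (hf : ContDiff ℝ 1 f)
    (hR : ∀ x, R < ‖x‖ → f x = 0) (v : Space) : ∫ x, fderiv ℝ f x v = 0 := by
  have hc : HasCompactSupport f := by
    refine HasCompactSupport.intro (isCompact_closedBall (0 : Space) R) ?_
    intro x hx
    refine hR x ?_
    simpa using hx
  have h := integral_mul_fderiv_eq_neg_fderiv_mul_of_integrable (μ := (volume : Measure Space))
    (f := fun _ => (1 : ℝ)) (g := f) (v := v) (by simp) ?_ ?_ (by simp) ?_
  · simpa using h
  · simp only [one_mul]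
    refine Continuous.integrable_of_hasCompactSupport ?_ (hc.fderiv_apply (𝕜 := ℝ) v)
    exact (hf.continuous_fderiv one_ne_zero).clm_apply continuous_const
  · simpa using hf.continuous.integrable_of_hasCompactSupport hc
  · intro x _
    exact hf.differentiable one_ne_zero x

theorem continuousOn_pd {f : Spacetime → ℝ} {S : Set Spacetime}
    (hf : ∀ p ∈ S, ContDiffAt ℝ 1 f p) (b : Fin 4) : ContinuousOn (pd b f) S := by
  intro p hp
  have : ContinuousAt (fderiv ℝ f) p := (hf p hp).continuousAt_fderiv one_ne_zero
  exact (this.clm_apply continuousAt_const).continuousWithinAt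

/-- The function is assumed to vanish for `t > -1`, not merely `t ≥ 0`, so that it vanishes in a
full neighbourhood of a point of the slab and its derivatives vanish as well. -/
theorem pd_eq_zero_of_norm_lt {f : Spacetime → ℝ} {R : ℝ}
    (hR : ∀ p : Spacetime, -1 < p.1 → R < ‖p.2‖ → f p = 0) (b : Fin 4) {p : Spacetime}
    (hp : -1 < p.1) (hp2 : R < ‖p.2‖) : pd b f p = 0 := by
  have : f =ᶠ[nhds p] fun _ => 0 := by
    have h1 : ∀ᶠ y : Spacetime in nhds p, -1 < y.1 := continuous_fst.continuousAt.eventually_const_lt hp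
    have h2 : ∀ᶠ y : Spacetime in nhds p, R < ‖y.2‖ :=
      continuous_snd.norm.continuousAt.eventually_const_lt hp2
    filter_upwards [h1, h2] with y a b using hR y a b
  rw [pd, this.fderiv_eq]
  simp

/-- Spatial derivatives integrate to zero on each slice by compact support, and the time derivative
is integrated along vertical lines. The minus sign in front of the spatial part is the Minkowski
one. -/
theorem slab_divergence {T R : ℝ} (hT : 0 ≤ T) {V : Fin 4 → Spacetime → ℝ}
    (hV : ∀ a, ∀ p ∈ slab T, ContDiffAt ℝ 1 (V a) p)
    (hR : ∀ a, ∀ p : Spacetime, -1 < p.1 → R < ‖p.2‖ → V a p = 0) :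
    IntegrableOn (fun p => pd 0 (V 0) p - (pd 1 (V 1) p + pd 2 (V 2) p + pd 3 (V 3) p)) (slab T) ∧
    ∫ x : Space, V 0 (T, x) = (∫ x : Space, V 0 (0, x))
      + ∫ p in slab T, (pd 0 (V 0) p - (pd 1 (V 1) p + pd 2 (V 2) p + pd 3 (V 3) p)) := by
  have hint : ∀ a b, IntegrableOn (pd b (V a)) (slab T) := fun a b =>
    integrableOn_slab (continuousOn_pd (hV a) b)
      fun p hp hp2 => pd_eq_zero_of_norm_lt (hR a) b (by linarith [hp.1]) hp2
  have hmem : ∀ t ∈ Icc 0 T, ∀ x : Space, ((t, x) : Spacetime) ∈ slab T := fun t ht x => ht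
  have hspace : ∀ i : Fin 3, ∫ p in slab T, pd i.succ (V i.succ) p = 0 := by
    intro i
    rw [volume_restrict_slab, integral_prod]
    · refine setIntegral_eq_zero_of_forall_eq_zero fun t ht => ?_
      have hd : ContDiff ℝ 1 fun x : Space => V i.succ (t, x) := by
        rw [contDiff_iff_contDiffAt]
        intro x
        exact (hV i.succ (t, x) (hmem t ht x)).comp x (contDiffAt_const.prodMk contDiffAt_id)
      have h0 := integral_pd_succ (R := R) hd
        (fun x hx => hR i.succ (t, x) (by show (-1 : ℝ) < t; linarith [ht.1]) hx)
        (EuclideanSpace.single i 1)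
      rw [← h0]
      congr 1
      ext x
      have hdf : DifferentiableAt ℝ (V i.succ) (t, x) :=
        (hV i.succ (t, x) (hmem t ht x)).differentiableAt one_ne_zero
      have hm : HasFDerivAt (fun x : Space => ((t, x) : Spacetime))
          (ContinuousLinearMap.inr ℝ ℝ Space) x := hasFDerivAt_prodMk_right t x
      have := (hdf.hasFDerivAt.comp x hm).fderiv
      change _ = fderiv ℝ (V i.succ ∘ fun x : Space => ((t, x) : Spacetime)) x _
      rw [this]
      rfl
    · have := hint i.succ i.succ
      rwa [IntegrableOn, volume_restrict_slab] at this
  have htime : ∫ p in slab T, pd 0 (V 0) p = (∫ x : Space, V 0 (T, x)) - ∫ x : Space, V 0 (0, x) := by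
    have hslice : ∀ t ∈ Icc 0 T, Integrable fun x : Space => V 0 (t, x) := by
      intro t ht
      have hd : Continuous fun x : Space => V 0 (t, x) := by
        rw [continuous_iff_continuousAt]
        intro x
        exact (hV 0 (t, x) (hmem t ht x)).continuousAt.comp (by fun_prop)
      refine hd.integrable_of_hasCompactSupport ?_
      refine HasCompactSupport.intro (isCompact_closedBall (0 : Space) R) ?_
      intro x hx
      exact hR 0 (t, x) (by show (-1 : ℝ) < t; linarith [ht.1]) (by simpa using hx)
    rw [volume_restrict_slab, integral_prod_symm, ← integral_sub (hslice T ⟨hT, le_rfl⟩)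
      (hslice 0 ⟨le_rfl, hT⟩)]
    · congr 1
      ext x
      rw [integral_Icc_eq_integral_Ioc, ← intervalIntegral.integral_of_le hT]
      have hline : ∀ t : ℝ, HasFDerivAt (fun t : ℝ => ((t, x) : Spacetime))
          (ContinuousLinearMap.inl ℝ ℝ Space) t := fun t => hasFDerivAt_prodMk_left t x
      refine intervalIntegral.integral_eq_sub_of_hasDerivAt (f := fun t => V 0 (t, x)) ?_ ?_
      · intro t ht
        rw [uIcc_of_le hT] at ht
        have hdf : DifferentiableAt ℝ (V 0) (t, x) :=
          (hV 0 (t, x) (hmem t ht x)).differentiableAt one_ne_zero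
        have := (hdf.hasFDerivAt.comp t (hline t)).hasDerivAt
        have e : (fderiv ℝ (V 0) (t, x) ∘SL ContinuousLinearMap.inl ℝ ℝ Space) 1
            = pd 0 (V 0) (t, x) := by
          simp [pd, basisVec_zero]
        rw [e] at this
        exact this
      · apply ContinuousOn.intervalIntegrable
        rw [uIcc_of_le hT]
        exact (continuousOn_pd (hV 0) 0).comp (by fun_prop) fun t ht => hmem t ht x
    · have := hint 0 0
      rwa [IntegrableOn, volume_restrict_slab] at this
  have e2 : IntegrableOn (fun p => pd 1 (V 1) p + pd 2 (V 2) p) (slab T) :=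
    (hint 1 1).add (hint 2 2)
  have e1 : IntegrableOn (fun p => pd 1 (V 1) p + pd 2 (V 2) p + pd 3 (V 3) p) (slab T) :=
    e2.add (hint 3 3)
  refine ⟨(hint 0 0).sub e1, ?_⟩
  rw [integral_sub (hint 0 0) e1, integral_add e2 (hint 3 3),
    integral_add (hint 1 1) (hint 2 2), htime]
  have h1 := hspace 0
  have h2 := hspace 1
  have h3 := hspace 2
  change ∫ p in slab T, pd 1 (V 1) p = 0 at h1
  change ∫ p in slab T, pd 2 (V 2) p = 0 at h2
  change ∫ p in slab T, pd 3 (V 3) p = 0 at h3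
  rw [h1, h2, h3]
  ring

/-! ### Weights -/

/-- The Japanese bracket. -/
def jap (u : ℝ) : ℝ := Real.sqrt (1 + u ^ 2)

theorem one_le_jap (u : ℝ) : 1 ≤ jap u := by
  rw [jap, Real.one_le_sqrt]; nlinarith

theorem jap_pos (u : ℝ) : 0 < jap u := lt_of_lt_of_le one_pos (one_le_jap u)

theorem jap_sq (u : ℝ) : jap u ^ 2 = 1 + u ^ 2 := Real.sq_sqrt (by positivity)

theorem abs_lt_jap (u : ℝ) : |u| < jap u := by
  rw [jap, Real.lt_sqrt (abs_nonneg u), sq_abs]; linarith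

theorem jap_le (u : ℝ) : jap u ≤ 1 + |u| := by
  rw [jap, Real.sqrt_le_left (by positivity)]
  nlinarith [abs_nonneg u, sq_abs u]

theorem jap_sub_pos (u : ℝ) : 0 < jap u - u := by
  have := abs_lt_jap u
  have := le_abs_self u
  linarith

theorem jap_add_pos (u : ℝ) : 0 < jap u + u := by
  have := abs_lt_jap u
  have := neg_abs_le u
  linarith

theorem hasDerivAt_jap (u : ℝ) : HasDerivAt jap (u / jap u) u := by
  have h : HasDerivAt (fun u : ℝ => 1 + u ^ 2) (2 * u) u := by
    simpa using (hasDerivAt_pow 2 u).const_add 1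
  refine (h.sqrt (by positivity)).congr_deriv ?_
  change 2 * u / (2 * jap u) = u / jap u
  have := jap_pos u
  field_simp

theorem contDiff_jap : ContDiff ℝ 1 jap := by
  unfold jap
  exact ContDiff.sqrt (by fun_prop) fun x => by positivity

/-- The decreasing function of the optical function `u` that generates the weights. -/
def wIn (γ ε u : ℝ) : ℝ := 1 + (jap u - u) ^ (2 * γ) + (1 + (jap u + u)) ^ (-2 * ε)

/-- The factor depending on `u` of the auxiliary weight. -/
def kIn (γ ε u : ℝ) : ℝ := 1 + (jap u - u) ^ (2 * γ + 2 * ε)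

/-- The factor depending on `v = t + r` of the auxiliary weight. -/
def mOut (ε v : ℝ) : ℝ := (1 + v) ^ (-2 * ε)

/-- The derivative of `wIn`. -/
def dwIn (γ ε u : ℝ) : ℝ := -(2 * γ * (jap u - u) ^ (2 * γ) / jap u)
  - 2 * ε * (1 + (jap u + u)) ^ (-2 * ε - 1) * ((jap u + u) / jap u)

/-- The derivative of `kIn`. -/
def dkIn (γ ε u : ℝ) : ℝ := -((2 * γ + 2 * ε) * (jap u - u) ^ (2 * γ + 2 * ε) / jap u)

/-- The derivative of `mOut`. -/
def dmOut (ε v : ℝ) : ℝ := -(2 * ε * (1 + v) ^ (-2 * ε - 1))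

theorem hasDerivAt_jap_sub_rpow (a u : ℝ) :
    HasDerivAt (fun u => (jap u - u) ^ a) (-(a * (jap u - u) ^ a / jap u)) u := by
  have h : HasDerivAt (fun u => jap u - u) (u / jap u - 1) u :=
    (hasDerivAt_jap u).sub (hasDerivAt_id u)
  refine (h.rpow_const (p := a) (Or.inl (jap_sub_pos u).ne')).congr_deriv ?_
  have h1 := jap_pos u
  have h2 := jap_sub_pos u
  rw [Real.rpow_sub_one h2.ne']
  field_simp
  ring

theorem hasDerivAt_wIn (γ ε u : ℝ) : HasDerivAt (wIn γ ε) (dwIn γ ε u) u := by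
  have h : HasDerivAt (fun u => 1 + (jap u + u)) (u / jap u + 1) u :=
    ((hasDerivAt_jap u).add (hasDerivAt_id u)).const_add 1
  have h2 := h.rpow_const (p := -2 * ε) (Or.inl (by have := jap_add_pos u; positivity))
  refine (((hasDerivAt_jap_sub_rpow (2 * γ) u).const_add 1).add h2).congr_deriv ?_
  have h1 := jap_pos u
  rw [dwIn]
  field_simp
  ring

theorem hasDerivAt_kIn (γ ε u : ℝ) : HasDerivAt (kIn γ ε) (dkIn γ ε u) u :=
  (hasDerivAt_jap_sub_rpow (2 * γ + 2 * ε) u).const_add 1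

theorem hasDerivAt_mOut (ε : ℝ) {v : ℝ} (hv : -1 < v) : HasDerivAt (mOut ε) (dmOut ε v) v := by
  have h : HasDerivAt (fun v : ℝ => 1 + v) 1 v := (hasDerivAt_id v).const_add 1
  refine (h.rpow_const (p := -2 * ε) (Or.inl (by linarith))).congr_deriv ?_
  rw [dmOut]
  ring

theorem contDiff_wIn (γ ε : ℝ) : ContDiff ℝ 1 (wIn γ ε) := by
  unfold wIn
  refine (contDiff_const.add ((contDiff_jap.sub contDiff_id).rpow_const_of_ne
    fun x => (jap_sub_pos x).ne')).add ?_
  exact (contDiff_const.add (contDiff_jap.add contDiff_id)).rpow_const_of_ne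
    fun x => by have := jap_add_pos x; simp only [id]; positivity

theorem contDiff_kIn (γ ε : ℝ) : ContDiff ℝ 1 (kIn γ ε) := by
  unfold kIn
  exact contDiff_const.add ((contDiff_jap.sub contDiff_id).rpow_const_of_ne
    fun x => (jap_sub_pos x).ne')

theorem contDiffAt_mOut (ε : ℝ) {v : ℝ} (hv : -1 < v) : ContDiffAt ℝ 1 (mOut ε) v := by
  unfold mOut
  exact (contDiffAt_const.add contDiffAt_id).rpow_const_of_ne (by simp only [id]; linarith)

theorem one_le_kIn (γ ε u : ℝ) : 1 ≤ kIn γ ε u := by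
  have := Real.rpow_nonneg (jap_sub_pos u).le (2 * γ + 2 * ε)
  unfold kIn
  linarith

theorem mOut_nonneg (ε : ℝ) {v : ℝ} (hv : 0 ≤ v) : 0 ≤ mOut ε v := by
  unfold mOut; positivity

theorem dkIn_nonpos {γ ε : ℝ} (hγ : 0 < γ) (hε : 0 < ε) (u : ℝ) : dkIn γ ε u ≤ 0 := by
  have := jap_sub_pos u
  have := jap_pos u
  unfold dkIn
  rw [neg_nonpos]
  positivity

/-- The weights with the step function evaluated: `x` is the value of the step, `τ` that of `τ₋`. -/
theorem mix_bounds {γ ε x τ : ℝ} (hγ : 0 < γ) (hε : 0 < ε) (hx0 : 0 ≤ x) (hx1 : x ≤ 1) (hτ : 1 ≤ τ)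
    (h : x = 1 ∨ τ ≤ 2) :
    x * τ ^ (2 * γ) + (1 - x) ≤ τ ^ (2 * γ) ∧
    τ ^ (2 * γ) ≤ 4 ^ γ * (x * τ ^ (2 * γ) + (1 - x)) ∧
    τ ^ (2 * γ) ≤ 4 ^ γ * (x * τ ^ (2 * γ) + (1 - x) * τ ^ (2 * ε)) ∧
    x * τ ^ (2 * γ - 1) + (1 - x) * τ ^ (-2 * ε - 1) ≤ τ ^ (2 * γ - 1) ∧
    τ ^ (2 * γ - 1) ≤ 4 ^ (γ + ε) * (x * τ ^ (2 * γ - 1) + (1 - x) * τ ^ (-2 * ε - 1)) := by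
  have hτ0 : 0 < τ := by linarith
  have a1 : 1 ≤ τ ^ (2 * γ) := Real.one_le_rpow hτ (by linarith)
  have a2 : 1 ≤ τ ^ (2 * ε) := Real.one_le_rpow hτ (by linarith)
  have a3 : (1 : ℝ) ≤ 4 ^ γ := Real.one_le_rpow (by norm_num) hγ.le
  have a4 : (1 : ℝ) ≤ 4 ^ (γ + ε) := Real.one_le_rpow (by norm_num) (by linarith)
  have a5 : τ ^ (-2 * ε - 1) ≤ τ ^ (2 * γ - 1) := Real.rpow_le_rpow_of_exponent_le hτ (by linarith)
  have a6 : 0 < τ ^ (2 * γ - 1) := by positivity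
  have a7 : 0 < τ ^ (-2 * ε - 1) := by positivity
  have four : ∀ a : ℝ, (4 : ℝ) ^ a = 2 ^ (2 * a) := by
    intro a
    rw [Real.rpow_mul (by norm_num)]
    norm_num
  refine ⟨?_, ?_, ?_, ?_, ?_⟩
  · nlinarith
  · rcases h with rfl | h
    · nlinarith
    · have : τ ^ (2 * γ) ≤ 4 ^ γ := by
        rw [four]
        exact Real.rpow_le_rpow hτ0.le h (by linarith)
      have : 1 ≤ x * τ ^ (2 * γ) + (1 - x) := by nlinarith
      nlinarith
  · rcases h with rfl | h
    · nlinarith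
    · have : τ ^ (2 * γ) ≤ 4 ^ γ := by
        rw [four]
        exact Real.rpow_le_rpow hτ0.le h (by linarith)
      have : 1 ≤ x * τ ^ (2 * γ) + (1 - x) * τ ^ (2 * ε) := by nlinarith
      nlinarith
  · nlinarith
  · rcases h with rfl | h
    · nlinarith
    · have h1 : τ ^ (2 * γ - 1) ≤ 4 ^ (γ + ε) * τ ^ (-2 * ε - 1) := by
        have : τ ^ (2 * γ - 1) = τ ^ (2 * (γ + ε)) * τ ^ (-2 * ε - 1) := by
          rw [← Real.rpow_add hτ0]; congr 1; ring
        rw [this, four]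
        exact mul_le_mul_of_nonneg_right (Real.rpow_le_rpow hτ0.le h (by linarith)) a7.le
      have h2 : τ ^ (-2 * ε - 1) ≤ x * τ ^ (2 * γ - 1) + (1 - x) * τ ^ (-2 * ε - 1) := by nlinarith
      nlinarith

theorem four_rpow (a : ℝ) : (4 : ℝ) ^ a = 2 ^ (2 * a) := by
  rw [Real.rpow_mul (by norm_num)]
  norm_num

theorem IsSmoothStep.nonneg {χ : ℝ → ℝ} (hχ : IsSmoothStep χ) (y : ℝ) : 0 ≤ χ y := by
  rw [← hχ.eq_zero (min y 0) (min_le_right _ _)]; exact hχ.mono (min_le_left _ _)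

theorem IsSmoothStep.le_one {χ : ℝ → ℝ} (hχ : IsSmoothStep χ) (y : ℝ) : χ y ≤ 1 := by
  rw [← hχ.eq_one (max y 1) (le_max_right _ _)]; exact hχ.mono (le_max_left _ _)

theorem neg_dwIn_eq (γ ε u : ℝ) : -dwIn γ ε u = 2 * γ * (jap u - u) ^ (2 * γ) / jap u
    + 2 * ε * (1 + (jap u + u)) ^ (-2 * ε - 1) * ((jap u + u) / jap u) := by
  rw [dwIn]; ring

/-- `jap u - u` decreases and `jap u + u` increases, so both nonconstant summands of `wIn` decrease.
The first makes `-wIn'` at least of order `|u|^{2γ-1}` as `u → -∞`, the second at least of order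
`u^{-2ε-1}` as `u → ∞`; these are the two regimes of `w'_{γ,ε}`. -/
theorem neg_dwIn_nonneg {γ ε : ℝ} (hγ : 0 < γ) (hε : 0 < ε) (u : ℝ) : 0 ≤ -dwIn γ ε u := by
  have := jap_sub_pos u
  have := jap_add_pos u
  have := jap_pos u
  rw [neg_dwIn_eq]
  positivity

/-- The derivative of the outer factor dominates the degenerate weight. -/
theorem outer_bound {γ ε u v y : ℝ} (hε : 0 < ε) (huv : |u| ≤ v)
    (hyk : jap u ^ (1 + 2 * ε) * y ≤ kIn γ ε u) :
    (jap u / jap v) ^ (1 + 2 * ε) * y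
      ≤ (2 * ε)⁻¹ * 2 ^ (2 * ε + 1) * -(kIn γ ε u * dmOut ε v) := by
  have t0 := jap_pos u
  have hjv := jap_pos v
  have hv0 : 0 ≤ v := (abs_nonneg u).trans huv
  have hk := one_le_kIn γ ε u
  have hvj : 1 + v ≤ 2 * jap v := by
    have := one_le_jap v
    have := abs_lt_jap v
    have := le_abs_self v
    linarith
  have e1 : (jap u / jap v) ^ (1 + 2 * ε) * y = jap u ^ (1 + 2 * ε) * y / jap v ^ (1 + 2 * ε) := by
    rw [Real.div_rpow t0.le hjv.le]; ring
  have e2 : (1 + v) ^ (1 + 2 * ε) ≤ 2 ^ (2 * ε + 1) * jap v ^ (1 + 2 * ε) := by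
    rw [add_comm (2 * ε) 1, ← Real.mul_rpow (by norm_num) hjv.le]
    exact Real.rpow_le_rpow (by linarith) hvj (by linarith)
  have e3 : (1 + v) ^ (-2 * ε - 1) = ((1 + v) ^ (1 + 2 * ε))⁻¹ := by
    rw [← Real.rpow_neg (by linarith)]; congr 1; ring
  have e4 : 0 < (1 + v) ^ (1 + 2 * ε) := by positivity
  have e5 : 0 < jap v ^ (1 + 2 * ε) := by positivity
  rw [e1, dmOut, e3]
  calc jap u ^ (1 + 2 * ε) * y / jap v ^ (1 + 2 * ε) ≤ kIn γ ε u / jap v ^ (1 + 2 * ε) := by gcongr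
    _ ≤ kIn γ ε u * (2 ^ (2 * ε + 1) * ((1 + v) ^ (1 + 2 * ε))⁻¹) := by
        rw [div_eq_mul_inv]
        refine mul_le_mul_of_nonneg_left ?_ (by linarith)
        rw [← div_eq_mul_inv, inv_eq_one_div, div_le_div_iff₀ e5 e4]
        linarith
    _ = (2 * ε)⁻¹ * 2 ^ (2 * ε + 1) * -(kIn γ ε u * -(2 * ε * ((1 + v) ^ (1 + 2 * ε))⁻¹)) := by
        field_simp

/-- `jap u ≤ 1 + |u| ≤ 1 + v`. The resulting gain `τ₋^{-2ε}` compensates the extra `2ε` in the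
exponent of `kIn`, so that the product `kIn · mOut` does not exceed the order of `w_γ`. -/
theorem mOut_le {ε u v : ℝ} (hε : 0 < ε) (huv : |u| ≤ v) : mOut ε v ≤ jap u ^ (-2 * ε) :=
  Real.rpow_le_rpow_of_nonpos (jap_pos u) ((jap_le u).trans (by linarith)) (by linarith)

/-- For `u ≤ 0` one has `τ₋ ≤ jap u - u ≤ 2 τ₋`, so every summand of `W` is at most of order
`τ₋^{2γ}`. The exponent `2γ + 2ε` of `kIn` is dictated by the fourth bound: it equals that of
`τ₋^{1+2ε} τ₋^{2γ-1}`. The last bound is the compatibility of weights that lets the source be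
absorbed. -/
theorem weight_bounds_exterior {γ ε x u v : ℝ} (hγ : 0 < γ) (hε : 0 < ε) (huv : |u| ≤ v)
    (hx0 : 0 ≤ x) (hx1 : x ≤ 1) (hmix : x = 1 ∨ jap u ≤ 2) (hu : u ≤ 0) {A W w' : ℝ}
    (hA : A = 3 + 4 ^ γ + 4 ^ (γ + ε)) (hW : W = wIn γ ε u + kIn γ ε u * mOut ε v)
    (hw' : w' = x * jap u ^ (2 * γ - 1) + (1 - x) * jap u ^ (-2 * ε - 1)) :
    x * jap u ^ (2 * γ) + (1 - x) ≤ W ∧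
    W ≤ A * 4 ^ γ * (x * jap u ^ (2 * γ) + (1 - x)) ∧
    w' ≤ (2 * γ)⁻¹ * -dwIn γ ε u ∧
    jap u ^ (1 + 2 * ε) * w' ≤ kIn γ ε u ∧
    W ^ 2 ≤ A ^ 2 * (4 ^ (γ + ε) * 4 ^ γ) *
      (w' * (x * jap u ^ (2 * γ) + (1 - x) * jap u ^ (2 * ε)) * jap u) := by
  obtain ⟨b1, b2, b3, b4, b5⟩ := mix_bounds hγ hε hx0 hx1 (one_le_jap u) hmix
  rw [← hw'] at b4 b5
  have t1 := one_le_jap u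
  have t0 := jap_pos u
  have hs := jap_sub_pos u
  have ha := jap_add_pos u
  have hm := mOut_le hε huv
  have hm0 : 0 ≤ mOut ε v := mOut_nonneg ε ((abs_nonneg u).trans huv)
  have hm1 : mOut ε v ≤ 1 := hm.trans (Real.rpow_le_one_of_one_le_of_nonpos t1 (by linarith))
  have hk := one_le_kIn γ ε u
  have hthird : (1 + (jap u + u)) ^ (-2 * ε) ≤ 1 :=
    Real.rpow_le_one_of_one_le_of_nonpos (by linarith) (by linarith)
  have hthird0 : 0 < (1 + (jap u + u)) ^ (-2 * ε) := by positivity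
  have h1 : jap u ≤ jap u - u := by linarith
  have h2 : jap u - u ≤ 2 * jap u := by
    have := abs_lt_jap u
    rw [abs_of_nonpos hu] at this
    linarith
  rw [wIn, kIn] at hW
  rw [kIn] at hk ⊢
  rw [neg_dwIn_eq]
  generalize jap u = τ at *
  generalize mOut ε v = m at *
  have g1 : τ ^ (2 * γ) ≤ (τ - u) ^ (2 * γ) := Real.rpow_le_rpow t0.le h1 (by linarith)
  have g2 : (τ - u) ^ (2 * γ) ≤ 4 ^ γ * τ ^ (2 * γ) := by
    rw [four_rpow, ← Real.mul_rpow (by norm_num) t0.le]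
    exact Real.rpow_le_rpow hs.le h2 (by linarith)
  have g3 : (τ - u) ^ (2 * γ + 2 * ε) ≤ 4 ^ (γ + ε) * τ ^ (2 * γ + 2 * ε) := by
    rw [four_rpow, mul_add 2 γ ε, ← Real.mul_rpow (by norm_num) t0.le]
    exact Real.rpow_le_rpow hs.le h2 (by linarith)
  have g4 : τ ^ (2 * γ + 2 * ε) ≤ (τ - u) ^ (2 * γ + 2 * ε) :=
    Real.rpow_le_rpow t0.le h1 (by linarith)
  have g5 : 1 ≤ τ ^ (2 * γ) := Real.one_le_rpow t1 (by linarith)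
  have g6 : τ ^ (2 * γ + 2 * ε) * τ ^ (-2 * ε) = τ ^ (2 * γ) := by
    rw [← Real.rpow_add t0]; congr 1; ring
  have hkm1 : (τ - u) ^ (2 * γ + 2 * ε) * m ≤ 4 ^ (γ + ε) * τ ^ (2 * γ) := by
    calc _ ≤ (4 ^ (γ + ε) * τ ^ (2 * γ + 2 * ε)) * τ ^ (-2 * ε) := by gcongr
      _ = _ := by rw [mul_assoc, g6]
  have hkm0 : 0 ≤ (1 + (τ - u) ^ (2 * γ + 2 * ε)) * m := by positivity
  -- The `3` in `A` accounts for the constant in `wIn`, the summand `(1 + jap u + u)^{-2ε} ≤ 1` and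
  -- the summand `mOut ≤ 1`; the other two terms come from the factor `2` in `jap u - u ≤ 2 τ₋`.
  have hWle : W ≤ A * τ ^ (2 * γ) := by
    rw [hW, hA]
    linarith
  have hWge : τ ^ (2 * γ) ≤ W := by
    rw [hW]
    linarith
  have hW0 : 0 ≤ W := by linarith
  have hA0 : 0 < A := by rw [hA]; positivity
  have hw'0 : 0 ≤ w' := by
    have h1x : 0 ≤ 1 - x := by linarith
    rw [hw']
    positivity
  refine ⟨b1.trans hWge, ?_, ?_, ?_, ?_⟩
  · calc W ≤ A * (4 ^ γ * (x * τ ^ (2 * γ) + (1 - x))) :=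
          hWle.trans (mul_le_mul_of_nonneg_left b2 hA0.le)
      _ = A * 4 ^ γ * (x * τ ^ (2 * γ) + (1 - x)) := by ring
  · have e5 : 0 ≤ (2 * γ)⁻¹ * (2 * ε * (1 + (τ + u)) ^ (-2 * ε - 1) * ((τ + u) / τ)) := by positivity
    calc w' ≤ τ ^ (2 * γ) / τ := by rw [← Real.rpow_sub_one t0.ne']; exact b4
      _ ≤ (τ - u) ^ (2 * γ) / τ := by gcongr
      _ = (2 * γ)⁻¹ * (2 * γ * (τ - u) ^ (2 * γ) / τ) := by field_simp
      _ ≤ _ := by rw [mul_add]; linarith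
  · calc τ ^ (1 + 2 * ε) * w' ≤ τ ^ (1 + 2 * ε) * τ ^ (2 * γ - 1) := by gcongr
      _ = τ ^ (2 * γ + 2 * ε) := by rw [← Real.rpow_add t0]; congr 1; ring
      _ ≤ _ := g4.trans (by linarith)
  · have e1 : τ ^ (2 * γ) * τ ^ (2 * γ) = τ ^ (2 * γ - 1) * τ ^ (2 * γ) * τ := by
      rw [Real.rpow_sub_one t0.ne']; field_simp
    have e2 : τ ^ (2 * γ - 1) * τ ^ (2 * γ) ≤
        (4 ^ (γ + ε) * w') * (4 ^ γ * (x * τ ^ (2 * γ) + (1 - x) * τ ^ (2 * ε))) :=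
      mul_le_mul b5 b3 (by positivity) (by positivity)
    calc W ^ 2 ≤ (A * τ ^ (2 * γ)) ^ 2 := pow_le_pow_left₀ hW0 hWle 2
      _ = A ^ 2 * (τ ^ (2 * γ - 1) * τ ^ (2 * γ) * τ) := by rw [← e1]; ring
      _ ≤ A ^ 2 * ((4 ^ (γ + ε) * w') *
          (4 ^ γ * (x * τ ^ (2 * γ) + (1 - x) * τ ^ (2 * ε))) * τ) :=
          mul_le_mul_of_nonneg_left (mul_le_mul_of_nonneg_right e2 t0.le) (by positivity)
      _ = A ^ 2 * (4 ^ (γ + ε) * 4 ^ γ) *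
          (w' * (x * τ ^ (2 * γ) + (1 - x) * τ ^ (2 * ε)) * τ) := by ring

/-- For `u ≥ 0` one has `jap u - u ≤ 1`, hence `wIn ≤ 3`, `kIn ≤ 2`, `mOut ≤ 1`, and `W` is of order
one. The lower bound for `-wIn'` comes solely from its summand with `ε`. -/
theorem weight_bounds_interior {γ ε u v : ℝ} (hγ : 0 < γ) (hε : 0 < ε) (huv : |u| ≤ v)
    (hu : 0 ≤ u) {W : ℝ} (hW : W = wIn γ ε u + kIn γ ε u * mOut ε v) :
    1 ≤ W ∧ W ≤ 5 ∧
    jap u ^ (-2 * ε - 1) ≤ (2 * ε)⁻¹ * 3 ^ (2 * ε + 1) * -dwIn γ ε u ∧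
    jap u ^ (1 + 2 * ε) * jap u ^ (-2 * ε - 1) ≤ kIn γ ε u ∧
    jap u ^ (-2 * ε - 1) * jap u ^ (2 * ε) * jap u = 1 := by
  have t1 := one_le_jap u
  have t0 := jap_pos u
  have hs := jap_sub_pos u
  have ha := jap_add_pos u
  have hm := mOut_le hε huv
  have hm0 : 0 ≤ mOut ε v := mOut_nonneg ε ((abs_nonneg u).trans huv)
  have hm1 : mOut ε v ≤ 1 := hm.trans (Real.rpow_le_one_of_one_le_of_nonpos t1 (by linarith))
  have hk := one_le_kIn γ ε u
  have hthird : (1 + (jap u + u)) ^ (-2 * ε) ≤ 1 :=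
    Real.rpow_le_one_of_one_le_of_nonpos (by linarith) (by linarith)
  have hthird0 : 0 < (1 + (jap u + u)) ^ (-2 * ε) := by positivity
  have h1 : jap u - u ≤ 1 := by
    have := jap_le u
    rw [abs_of_nonneg hu] at this
    linarith
  have hut : u ≤ jap u := by
    have := abs_lt_jap u
    have := le_abs_self u
    linarith
  rw [wIn, kIn] at hW
  rw [kIn] at hk ⊢
  rw [neg_dwIn_eq]
  generalize jap u = τ at *
  generalize mOut ε v = m at *
  have h2 : (τ - u) ^ (2 * γ) ≤ 1 := Real.rpow_le_one hs.le h1 (by linarith)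
  have h3 : (τ - u) ^ (2 * γ + 2 * ε) ≤ 1 := Real.rpow_le_one hs.le h1 (by linarith)
  have h20 : 0 < (τ - u) ^ (2 * γ) := by positivity
  have h30 : 0 < (τ - u) ^ (2 * γ + 2 * ε) := by positivity
  have hkm0 : 0 ≤ (1 + (τ - u) ^ (2 * γ + 2 * ε)) * m := by positivity
  refine ⟨by linarith, by nlinarith, ?_, ?_, ?_⟩
  -- The constant `3` arises from `1 + τ + u ≤ 3 τ`, valid because `1 ≤ τ` and `u ≤ τ`.
  · have e2 : (3 * τ) ^ (-2 * ε - 1) ≤ (1 + (τ + u)) ^ (-2 * ε - 1) :=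
      Real.rpow_le_rpow_of_nonpos (by positivity) (by linarith) (by linarith)
    have e3 : 1 ≤ (τ + u) / τ := by rw [le_div_iff₀ t0]; linarith
    have e5 : 0 ≤ 2 * γ * (τ - u) ^ (2 * γ) / τ := by positivity
    have e6 : 2 * ε * (3 * τ) ^ (-2 * ε - 1) * 1
        ≤ 2 * ε * (1 + (τ + u)) ^ (-2 * ε - 1) * ((τ + u) / τ) := by gcongr
    have e4 : (3 : ℝ) ^ (2 * ε + 1) * 3 ^ (-2 * ε - 1) = 1 := by
      rw [← Real.rpow_add (by norm_num)]; ring_nf; simp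
    calc τ ^ (-2 * ε - 1) = (3 ^ (2 * ε + 1) * 3 ^ (-2 * ε - 1)) * τ ^ (-2 * ε - 1) := by
          rw [e4, one_mul]
      _ = (2 * ε)⁻¹ * 3 ^ (2 * ε + 1) * (2 * ε * (3 * τ) ^ (-2 * ε - 1) * 1) := by
          rw [Real.mul_rpow (by norm_num) t0.le]
          field_simp
      _ ≤ _ := by
          refine mul_le_mul_of_nonneg_left ?_ (by positivity)
          linarith
  · rw [← Real.rpow_add t0]
    have : (1 + 2 * ε + (-2 * ε - 1)) = 0 := by ring
    rw [this, Real.rpow_zero]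
    linarith
  · have : τ ^ (-2 * ε - 1) * τ ^ (2 * ε) * τ ^ (1 : ℝ) = 1 := by
      rw [← Real.rpow_add t0, ← Real.rpow_add t0]
      have : -2 * ε - 1 + 2 * ε + 1 = 0 := by ring
      rw [this, Real.rpow_zero]
    rwa [Real.rpow_one] at this

/-- The comparison of the generating weights with the weights of the energy. -/
theorem exists_weight_bounds {χ : ℝ → ℝ} (hχ : IsSmoothStep χ) {γ ε : ℝ} (hγ : 0 < γ)
    (hε : 0 < ε) : ∃ K : ℝ, 0 < K ∧ ∀ u v x W w' : ℝ, |u| ≤ v → x = χ (-u) →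
      W = wIn γ ε u + kIn γ ε u * mOut ε v →
      w' = x * jap u ^ (2 * γ - 1) + (1 - x) * jap u ^ (-2 * ε - 1) →
      x * jap u ^ (2 * γ) + (1 - x) ≤ W ∧
      W ≤ K * (x * jap u ^ (2 * γ) + (1 - x)) ∧
      w' ≤ K * -dwIn γ ε u ∧
      (jap u / jap v) ^ (1 + 2 * ε) * w' ≤ K * -(kIn γ ε u * dmOut ε v) ∧
      W ^ 2 ≤ K * (w' * (x * jap u ^ (2 * γ) + (1 - x) * jap u ^ (2 * ε)) * jap u) := by
  set A : ℝ := 3 + 4 ^ γ + 4 ^ (γ + ε) with hA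
  have hA0 : 0 < A := by positivity
  obtain ⟨K, hK0, K1, K2, K3, K4, K5, K6⟩ : ∃ K : ℝ, 0 < K ∧ A * 4 ^ γ ≤ K ∧
      A ^ 2 * (4 ^ (γ + ε) * 4 ^ γ) ≤ K ∧ 25 ≤ K ∧ (2 * γ)⁻¹ ≤ K ∧
      (2 * ε)⁻¹ * 3 ^ (2 * ε + 1) ≤ K ∧ (2 * ε)⁻¹ * 2 ^ (2 * ε + 1) ≤ K := by
    have p1 : 0 < A * 4 ^ γ := by positivity
    have p2 : 0 < A ^ 2 * (4 ^ (γ + ε) * 4 ^ γ) := by positivity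
    have p3 : 0 < (2 * γ)⁻¹ := by positivity
    have p4 : 0 < (2 * ε)⁻¹ * 3 ^ (2 * ε + 1) := by positivity
    have p5 : 0 < (2 * ε)⁻¹ * 2 ^ (2 * ε + 1) := by positivity
    refine ⟨A * 4 ^ γ + A ^ 2 * (4 ^ (γ + ε) * 4 ^ γ) + 25 + (2 * γ)⁻¹
      + (2 * ε)⁻¹ * 3 ^ (2 * ε + 1) + (2 * ε)⁻¹ * 2 ^ (2 * ε + 1), ?_, ?_, ?_, ?_, ?_, ?_, ?_⟩ <;>
      linarith
  refine ⟨K, hK0, ?_⟩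
  intro u v x W w' huv hx hW hw'
  have hx0 : 0 ≤ x := hx ▸ hχ.nonneg _
  have hx1 : x ≤ 1 := hx ▸ hχ.le_one _
  have h1x : 0 ≤ 1 - x := by linarith
  have t0 := jap_pos u
  have hdw := neg_dwIn_nonneg hγ hε u
  have hdm : 0 ≤ -(kIn γ ε u * dmOut ε v) := by
    have := one_le_kIn γ ε u
    have hv0 : 0 ≤ v := (abs_nonneg u).trans huv
    rw [dmOut, mul_neg, neg_neg]
    positivity
  have hw'0 : 0 ≤ w' := by rw [hw']; positivity
  rcases le_total u 0 with hu | hu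
  -- Either the step has saturated, or `-1 ≤ u ≤ 0`, where `τ₋ ≤ 2` and all powers of `τ₋` are
  -- comparable.
  · have hmix : x = 1 ∨ jap u ≤ 2 := by
      rcases le_total u (-1) with h | h
      · exact Or.inl (hx.trans (hχ.eq_one _ (by linarith)))
      · right
        have := jap_le u
        rw [abs_of_nonpos hu] at this
        linarith
    obtain ⟨b1, b2, b3, b4, b5⟩ := weight_bounds_exterior hγ hε huv hx0 hx1 hmix hu hA hW hw'
    refine ⟨b1, b2.trans ?_, b3.trans ?_, (outer_bound hε huv b4).trans ?_, b5.trans ?_⟩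
    · exact mul_le_mul_of_nonneg_right K1 (by positivity)
    · exact mul_le_mul_of_nonneg_right K4 hdw
    · exact mul_le_mul_of_nonneg_right K6 hdm
    · exact mul_le_mul_of_nonneg_right K2 (by positivity)
  · have hx' : x = 0 := hx.trans (hχ.eq_zero _ (by linarith))
    obtain ⟨b1, b2, b3, b4, b5⟩ := weight_bounds_interior hγ hε huv hu hW
    have hw2 : w' = jap u ^ (-2 * ε - 1) := by rw [hw', hx']; ring
    rw [hw2, hx']
    refine ⟨by linarith, by linarith, b3.trans ?_, (outer_bound hε huv b4).trans ?_, ?_⟩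
    · exact mul_le_mul_of_nonneg_right K5 hdw
    · exact mul_le_mul_of_nonneg_right K6 hdm
    · have e : jap u ^ (-2 * ε - 1) * (0 * jap u ^ (2 * γ) + (1 - 0) * jap u ^ (2 * ε)) * jap u
          = jap u ^ (-2 * ε - 1) * jap u ^ (2 * ε) * jap u := by ring
      rw [e, b5]
      nlinarith

/-! ### The pointwise energy inequality -/

/-- The derivative of `jap y ^ (2 * s)`. -/
def djap (s y : ℝ) : ℝ := 2 * s * y * jap y ^ (2 * s - 2)

theorem hasDerivAt_jap_rpow (a y : ℝ) :
    HasDerivAt (fun y => jap y ^ a) (a * y * jap y ^ (a - 2)) y := by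
  have h0 := jap_pos y
  refine ((hasDerivAt_jap y).rpow_const (p := a) (Or.inl h0.ne')).congr_deriv ?_
  have : jap y ^ (a - 1) = jap y ^ (a - 2) * jap y := by
    rw [← Real.rpow_add_one h0.ne']; congr 1; ring
  rw [this]
  field_simp

theorem hasDerivAt_djap (s y : ℝ) : HasDerivAt (djap s)
    (2 * s * ((2 * s - 1) * jap y ^ (2 * s - 2) + (2 - 2 * s) * jap y ^ (2 * s - 4))) y := by
  have h0 := jap_pos y
  have h : HasDerivAt (fun y : ℝ => 2 * s * y) (2 * s) y := by
    simpa using (hasDerivAt_id y).const_mul (2 * s)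
  refine (h.mul (hasDerivAt_jap_rpow (2 * s - 2) y)).congr_deriv ?_
  have e : 2 * s - 2 - 2 = 2 * s - 4 := by ring
  have e2 : jap y ^ (2 * s - 2) = jap y ^ (2 * s - 4) * jap y ^ 2 := by
    rw [← Real.rpow_natCast (jap y) 2, ← Real.rpow_add h0]; congr 1; push_cast; ring
  rw [e, e2, jap_sq]
  ring

theorem jap_le_jap {y z : ℝ} (h : |y| ≤ |z|) : jap y ≤ jap z := by
  unfold jap
  exact Real.sqrt_le_sqrt (by have := sq_le_sq.mpr h; linarith)

/-- Mean value theorem for the derivative of `f(y) = jap y ^ (2s)`. For `1/2 ≤ s ≤ 1` both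
coefficients in `f''` are nonnegative and both powers of `jap` decrease in `|y|`, so `f''(c) ≥
f''(v)` at every `c` between `u` and `v`, because `|c| ≤ v`. -/
theorem djap_slope {s u v : ℝ} (hs : 1 / 2 ≤ s) (hs1 : s ≤ 1) (huv : |u| ≤ v) :
    (v - u) * (2 * s * ((2 * s - 1) * jap v ^ (2 * s - 2) + (2 - 2 * s) * jap v ^ (2 * s - 4)))
      ≤ djap s v - djap s u := by
  rcases (le_of_abs_le huv).eq_or_lt with h | h
  · rw [h]; simp
  obtain ⟨c, hc, hc2⟩ := exists_hasDerivAt_eq_slope (djap s) _ h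
    (fun y _ => (hasDerivAt_djap s y).continuousAt.continuousWithinAt)
    (fun y _ => hasDerivAt_djap s y)
  have hvu : 0 < v - u := by linarith
  rw [eq_div_iff hvu.ne'] at hc2
  rw [← hc2, mul_comm]
  have hcv : jap c ≤ jap v := jap_le_jap (by
    rw [abs_le] at huv
    rw [abs_of_nonneg (by linarith : 0 ≤ v), abs_le]
    exact ⟨by linarith [hc.1], hc.2.le⟩)
  have e1 : jap v ^ (2 * s - 2) ≤ jap c ^ (2 * s - 2) :=
    Real.rpow_le_rpow_of_nonpos (jap_pos c) hcv (by linarith)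
  have e2 : jap v ^ (2 * s - 4) ≤ jap c ^ (2 * s - 4) :=
    Real.rpow_le_rpow_of_nonpos (jap_pos c) hcv (by linarith)
  refine mul_le_mul_of_nonneg_right (mul_le_mul_of_nonneg_left ?_ (by linarith)) hvu.le
  exact add_le_add (mul_le_mul_of_nonneg_left e1 (by linarith))
    (mul_le_mul_of_nonneg_left e2 (by linarith))

/-- The trapezoidal rule overestimates the increments of `jap y ^ (2 * s)`. -/
theorem trapezoid {s u v : ℝ} (hs : 1 / 2 ≤ s) (hs1 : s ≤ 1) (huv : |u| ≤ v) :
    (v - u) * (djap s v + djap s u) ≤ 2 * (jap v ^ (2 * s) - jap u ^ (2 * s)) := by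
  -- The defect `G` of the trapezoidal rule is followed as `v` increases from `|u|`. It vanishes
  -- there, trivially for `u ≥ 0` and by the parity of `f` and `f'` for `u < 0`, and `djap_slope`
  -- says that `G' ≥ 0`.
  let G : ℝ → ℝ := fun v => 2 * (jap v ^ (2 * s) - jap u ^ (2 * s)) - (v - u) * (djap s v + djap s u)
  have hG : ∀ v, HasDerivAt G (djap s v - djap s u - (v - u) * (2 * s *
      ((2 * s - 1) * jap v ^ (2 * s - 2) + (2 - 2 * s) * jap v ^ (2 * s - 4)))) v := by
    intro v
    have h1 : HasDerivAt (fun v => 2 * (jap v ^ (2 * s) - jap u ^ (2 * s))) (2 * djap s v) v :=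
      ((hasDerivAt_jap_rpow (2 * s) v).sub_const _).const_mul 2
    have h2 := ((hasDerivAt_id v).sub_const u).mul ((hasDerivAt_djap s v).add_const (djap s u))
    refine (h1.sub h2).congr_deriv ?_
    simp only [id]
    ring
  have hmono : MonotoneOn G (Ici |u|) := by
    refine monotoneOn_of_deriv_nonneg (convex_Ici _) (fun y _ => (hG y).continuousAt.continuousWithinAt)
      (fun y _ => (hG y).differentiableAt.differentiableWithinAt) ?_
    intro y hy
    rw [interior_Ici] at hy
    rw [(hG y).deriv]
    have := djap_slope hs hs1 (le_of_lt hy : |u| ≤ y)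
    linarith
  have h0 : G |u| = 0 := by
    have e : jap |u| = jap u := by simp [jap]
    simp only [G, e, djap]
    rcases abs_cases u with ⟨h, -⟩ | ⟨h, -⟩ <;> rw [h] <;> ring
  have := hmono (mem_Ici.mpr le_rfl) (mem_Ici.mpr huv) huv
  rw [h0] at this
  simp only [G] at this
  linarith

/-- Weighted arithmetic–geometric mean inequality: `N` is controlled by the geometric mean of the
weights `A` and `B`, and `c` is the share of the first square that one is willing to spend. -/
theorem mul_le_of_sq_le {N A B D a b c : ℝ} (hA : 0 ≤ A) (hB : 0 ≤ B) (hD : 0 ≤ D) (hc : 0 < c)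
    (h : N ^ 2 ≤ D * (A * B)) : N * (a * b) ≤ c * (A * a ^ 2) + D / (4 * c) * (B * b ^ 2) := by
  refine le_of_abs_le (abs_le_of_sq_le_sq ?_ (by positivity))
  have h1 : (N * (a * b)) ^ 2 ≤ D * (A * B) * (a * b) ^ 2 := by
    rw [mul_pow]
    exact mul_le_mul_of_nonneg_right h (sq_nonneg _)
  have h2 : D * (A * B) * (a * b) ^ 2 = 4 * (c * (A * a ^ 2)) * (D / (4 * c) * (B * b ^ 2)) := by
    field_simp
  nlinarith [sq_nonneg (c * (A * a ^ 2) - D / (4 * c) * (B * b ^ 2))]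

/-- The source term is absorbed by the bulk term up to the norm of the current. -/
theorem source_le {s ε tp tm W w' wE K : ℝ} (hεs : ε ≤ s - 1 / 2)
    (htm : 1 ≤ tm) (htp : tm ≤ tp) (hw' : 0 ≤ w') (hwE : 0 ≤ wE) (hK : 0 < K)
    (hW : W ^ 2 ≤ K * (w' * wE * tm)) {a b j : Fin 3 → ℝ} {ρ σ jL jB : ℝ} :
    W * tp ^ (2 * s) * (ρ * jL + (a 0 * j 0 + a 1 * j 1 + a 2 * j 2))
      + W * tm ^ (2 * s) * ((b 0 * j 0 + b 1 * j 1 + b 2 * j 2) - ρ * jB) ≤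
    (1 / (2 * K)) * ((tp ^ (2 * s) * (a 0 ^ 2 + a 1 ^ 2 + a 2 ^ 2) + (tm / tp) ^ (1 + 2 * ε) *
        (tm ^ (2 * s) * (b 0 ^ 2 + b 1 ^ 2 + b 2 ^ 2) + tp ^ (2 * s) * ρ ^ 2
          + tp ^ (2 * s) * σ ^ 2)) * w')
      + 2 * K ^ 2 * ((tp ^ (2 * s + 1 + 2 * ε) * tm ^ (-2 * ε) * jL ^ 2
        + tp ^ (1 + 2 * ε - 2 * s) * tm ^ (4 * s - 2 * ε) * jB ^ 2
        + tp ^ (2 * s) * tm * (j 0 ^ 2 + j 1 ^ 2 + j 2 ^ 2)) * wE) := by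
  have tm0 : 0 < tm := by linarith
  have tp0 : 0 < tp := by linarith
  -- Each component of `α` and `αbar` is used once and `ρ` twice, so spending `1 / (4K)` each time
  -- costs at most `1 / (2K)` of the bulk density, half of the `1 / K` that the multiplier provides.
  have hc : 0 < 1 / (4 * K) := by positivity
  have hD : K / (4 * (1 / (4 * K))) = K ^ 2 := by field_simp
  set z := (tm / tp) ^ (1 + 2 * ε) with hz
  have hz' : z = tm ^ (1 + 2 * ε) * tp ^ (-(1 + 2 * ε)) := by
    rw [hz, Real.div_rpow tm0.le tp0.le, Real.rpow_neg tp0.le, div_eq_mul_inv]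
  have hz0 : 0 < z := by positivity
  have hp0 : 0 < tp ^ (2 * s) := by positivity
  have hm0 : 0 < tm ^ (2 * s) := by positivity
  -- The hypothesis `hW` reduces the four comparisons of weights below to inequalities `y τ₋ ≤ B`
  -- between powers of `τ₋` and `τ₊`.
  have key : ∀ y B : ℝ, 0 ≤ B → y * tm ≤ B → W ^ 2 * y ≤ K * (w' * (wE * B)) := by
    intro y B hB hyB
    rcases le_total y 0 with hy | hy
    · have : W ^ 2 * y ≤ 0 := mul_nonpos_of_nonneg_of_nonpos (sq_nonneg W) hy
      have : 0 ≤ K * (w' * (wE * B)) := by positivity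
      linarith
    calc W ^ 2 * y ≤ K * (w' * wE * tm) * y := mul_le_mul_of_nonneg_right hW hy
      _ = K * (w' * wE) * (y * tm) := by ring
      _ ≤ K * (w' * wE) * B := mul_le_mul_of_nonneg_left hyB (by positivity)
      _ = _ := by ring
  have t1 : (W * tp ^ (2 * s)) ^ 2 ≤ K * ((tp ^ (2 * s) * w') * (tp ^ (2 * s) * tm * wE)) := by
    have := key ((tp ^ (2 * s)) ^ 2) ((tp ^ (2 * s)) ^ 2 * tm) (by positivity) le_rfl
    rw [mul_pow]
    refine this.trans_eq ?_
    ring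
  have t2 : (W * tm ^ (2 * s)) ^ 2 ≤ K * ((z * tm ^ (2 * s) * w') * (tp ^ (2 * s) * tm * wE)) := by
    -- This is `τ₀^{2s} ≤ τ₀^{1+2ε}`, true since `τ₀ ≤ 1` and `ε ≤ s - 1/2`. It allows the pairing
    -- of `αbar` with the angular current at the same weight as that of `α`.
    have hle : tm ^ (2 * s) ≤ z * tp ^ (2 * s) := by
      rw [hz', mul_assoc, ← Real.rpow_add tp0]
      have e1 : tm ^ (2 * s) = tm ^ (1 + 2 * ε) * tm ^ (-(1 + 2 * ε) + 2 * s) := by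
        rw [← Real.rpow_add tm0]; congr 1; ring
      rw [e1]
      exact mul_le_mul_of_nonneg_left (Real.rpow_le_rpow tm0.le htp (by linarith)) (by positivity)
    have := key ((tm ^ (2 * s)) ^ 2) (tm ^ (2 * s) * (z * tp ^ (2 * s)) * tm) (by positivity)
      (by rw [sq]; gcongr)
    rw [mul_pow]
    refine this.trans_eq ?_
    ring
  have t3 : (W * tp ^ (2 * s)) ^ 2 ≤ K * ((z * tp ^ (2 * s) * w') *
      (tp ^ (2 * s + 1 + 2 * ε) * tm ^ (-2 * ε) * wE)) := by
    -- Equality: the weight of `J_L` is exactly the one that balances the degenerate weight of `ρ`.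
    -- The same holds for the weight of `J_Lbar` in `t4`.
    have e : z * tp ^ (2 * s) * (tp ^ (2 * s + 1 + 2 * ε) * tm ^ (-2 * ε))
        = (tp ^ (2 * s)) ^ 2 * tm := by
      have e1 : tp ^ (2 * s + 1 + 2 * ε) = tp ^ (2 * s) * tp ^ (1 + 2 * ε) := by
        rw [← Real.rpow_add tp0]; congr 1; ring
      have e2 : tm ^ (1 + 2 * ε) * tm ^ (-2 * ε) = tm := by
        rw [← Real.rpow_add tm0]
        have : 1 + 2 * ε + -2 * ε = 1 := by ring
        rw [this, Real.rpow_one]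
      have e3 : tp ^ (-(1 + 2 * ε)) * tp ^ (1 + 2 * ε) = 1 := by
        rw [← Real.rpow_add tp0, neg_add_cancel, Real.rpow_zero]
      rw [hz', e1]
      calc _ = (tp ^ (2 * s)) ^ 2 * (tp ^ (-(1 + 2 * ε)) * tp ^ (1 + 2 * ε))
            * (tm ^ (1 + 2 * ε) * tm ^ (-2 * ε)) := by ring
        _ = _ := by rw [e2, e3, mul_one]
    have := key ((tp ^ (2 * s)) ^ 2) (z * tp ^ (2 * s) * (tp ^ (2 * s + 1 + 2 * ε) * tm ^ (-2 * ε)))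
      (by positivity) (by rw [e])
    rw [mul_pow]
    refine this.trans_eq ?_
    ring
  have t4 : (W * tm ^ (2 * s)) ^ 2 ≤ K * ((z * tp ^ (2 * s) * w') *
      (tp ^ (1 + 2 * ε - 2 * s) * tm ^ (4 * s - 2 * ε) * wE)) := by
    have e : z * tp ^ (2 * s) * (tp ^ (1 + 2 * ε - 2 * s) * tm ^ (4 * s - 2 * ε))
        = (tm ^ (2 * s)) ^ 2 * tm := by
      have e1 : tm ^ (1 + 2 * ε) * tm ^ (4 * s - 2 * ε) = (tm ^ (2 * s)) ^ 2 * tm := by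
        have : (tm ^ (2 * s)) ^ 2 * tm = tm ^ (2 * s) * tm ^ (2 * s) * tm ^ (1 : ℝ) := by
          rw [Real.rpow_one]; ring
        rw [this, ← Real.rpow_add tm0, ← Real.rpow_add tm0, ← Real.rpow_add tm0]
        congr 1; ring
      have e3 : tp ^ (-(1 + 2 * ε)) * tp ^ (2 * s) * tp ^ (1 + 2 * ε - 2 * s) = 1 := by
        rw [← Real.rpow_add tp0, ← Real.rpow_add tp0]
        have : -(1 + 2 * ε) + 2 * s + (1 + 2 * ε - 2 * s) = 0 := by ring
        rw [this, Real.rpow_zero]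
      rw [hz']
      calc _ = (tp ^ (-(1 + 2 * ε)) * tp ^ (2 * s) * tp ^ (1 + 2 * ε - 2 * s))
            * (tm ^ (1 + 2 * ε) * tm ^ (4 * s - 2 * ε)) := by ring
        _ = _ := by rw [e1, e3, one_mul]
    have := key ((tm ^ (2 * s)) ^ 2) (z * tp ^ (2 * s) * (tp ^ (1 + 2 * ε - 2 * s) *
      tm ^ (4 * s - 2 * ε))) (by positivity) (by rw [e])
    rw [mul_pow]
    refine this.trans_eq ?_
    ring
  have A : ∀ i, W * tp ^ (2 * s) * (a i * j i) ≤ 1 / (4 * K) * (tp ^ (2 * s) * w' * a i ^ 2)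
      + K ^ 2 * (tp ^ (2 * s) * tm * wE * j i ^ 2) := by
    intro i
    have := mul_le_of_sq_le (a := a i) (b := j i) (by positivity) (by positivity) hK.le hc t1
    rwa [hD] at this
  have B : ∀ i, W * tm ^ (2 * s) * (b i * j i) ≤ 1 / (4 * K) * (z * tm ^ (2 * s) * w' * b i ^ 2)
      + K ^ 2 * (tp ^ (2 * s) * tm * wE * j i ^ 2) := by
    intro i
    have := mul_le_of_sq_le (a := b i) (b := j i) (by positivity) (by positivity) hK.le hc t2
    rwa [hD] at this
  have C := mul_le_of_sq_le (a := ρ) (b := jL) (by positivity) (by positivity) hK.le hc t3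
  have E := mul_le_of_sq_le (a := -ρ) (b := jB) (by positivity) (by positivity) hK.le hc t4
  rw [hD] at C E
  have A0 := A 0
  have A1 := A 1
  have A2 := A 2
  have B0 := B 0
  have B1 := B 1
  have B2 := B 2
  have n1 : 0 ≤ 1 / (4 * K) * (tp ^ (2 * s) * w' * (a 0 ^ 2 + a 1 ^ 2 + a 2 ^ 2)) := by positivity
  have n2 : 0 ≤ 1 / (4 * K) * (z * tm ^ (2 * s) * w' * (b 0 ^ 2 + b 1 ^ 2 + b 2 ^ 2)) := by
    positivity
  have n3 : 0 ≤ 1 / (2 * K) * (z * tp ^ (2 * s) * w' * σ ^ 2) := by positivity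
  have n4 : 0 ≤ K ^ 2 * (tp ^ (2 * s + 1 + 2 * ε) * tm ^ (-2 * ε) * wE * jL ^ 2) := by positivity
  have n5 : 0 ≤ K ^ 2 * (tp ^ (1 + 2 * ε - 2 * s) * tm ^ (4 * s - 2 * ε) * wE * jB ^ 2) := by
    positivity
  have hcc : 1 / (2 * K) = 2 * (1 / (4 * K)) := by field_simp; norm_num
  rw [hcc] at n3 ⊢
  generalize 1 / (4 * K) = c at *
  linarith

/-- Lower bound for the bulk term of the multiplier `Wt (f(v) L + f(u) Lbar)`. -/
theorem bulk_ge {fv fu dfv dfu ri κ κ' ζ ζ' θ θ' W Wu Wv α β R Pt Pr Qt Qr P Q : ℝ}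
    (hfv : 0 ≤ fv) (hfu : 0 ≤ fu) (hB : dfv + dfu ≤ (fv - fu) * ri)
    (hκ : 0 ≤ κ) (hκ' : 0 ≤ κ') (hζ : 0 ≤ ζ) (hζ' : ζ' ≤ 0) (hθ : 0 ≤ θ) (hθ' : θ' ≤ 0)
    (hW : 0 ≤ W) (hα : 0 ≤ α) (hβ : 0 ≤ β) (hR : 0 ≤ R) (hWu : Wu ≤ 0)
    (hP : P = κ * (ζ * θ * W * fv)) (hQ : Q = κ * (ζ * θ * W * fu))
    (hPt : Pt = κ * (((ζ' * θ * W + ζ * θ * Wu) + (ζ * θ' * W + ζ * θ * Wv)) * fv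
      + ζ * θ * W * dfv))
    (hPr : Pr = κ' * (ζ * θ * W * fv) + κ * ((-(ζ' * θ * W + ζ * θ * Wu)
      + (ζ * θ' * W + ζ * θ * Wv)) * fv + ζ * θ * W * dfv))
    (hQt : Qt = κ * (((ζ' * θ * W + ζ * θ * Wu) + (ζ * θ' * W + ζ * θ * Wv)) * fu
      + ζ * θ * W * dfu))
    (hQr : Qr = κ' * (ζ * θ * W * fu) + κ * ((-(ζ' * θ * W + ζ * θ * Wu)
      + (ζ * θ' * W + ζ * θ * Wv)) * fu - ζ * θ * W * dfu)) :
    κ * (ζ * θ) * (-Wu * fv * α + -Wv * (fu * β + fv * R)) + κ * (-ζ' * θ) * (W * (fv * α + fu * R))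
      - κ' * (ζ * θ * W * (fu * β + fv * R)) ≤
    (-(1 / 2) * (Pt - Pr) * α - (1 / 2) * (Qt + Qr) * β
        + ((P - Q) * ri - (1 / 2) * (Pt + Pr) - (1 / 2) * (Qt - Qr)) * R) := by
  -- The discarded terms all have a sign: `e1` is the slack in the trapezoidal inequality, `e2` the
  -- `u`-derivative of `W` in the coefficient of `ρ² + σ²`, `e3` the outer cutoff, `e4` and `e5` the
  -- favourable part of the radial cutoff.
  have e1 : 0 ≤ κ * (ζ * θ) * W * ((fv - fu) * ri - (dfv + dfu)) * R := by
    have : 0 ≤ (fv - fu) * ri - (dfv + dfu) := by linarith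
    positivity
  have hu' : 0 ≤ -Wu := by linarith
  have hz' : 0 ≤ -ζ' := by linarith
  have ht' : 0 ≤ -θ' := by linarith
  have e2 : 0 ≤ κ * (ζ * θ) * -Wu * (fu * R) := by positivity
  have e3 : 0 ≤ κ * (ζ * -θ') * W * (fu * β + fv * R) := by positivity
  have e4 : 0 ≤ κ' * (ζ * θ * W) * (fv * α + fu * β + fv * R) := by positivity
  have e5 : 0 ≤ κ' * (ζ * θ * W) * (fu * R) := by positivity
  rw [hP, hQ, hPt, hPr, hQt, hQr]
  linarith

/-! ### Derivatives of functions of the optical variables -/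

theorem pd_comp {b : Fin 4} {a : ℝ → ℝ} {a' : ℝ} {φ : Spacetime → ℝ} {p : Spacetime}
    (ha : HasDerivAt a a' (φ p)) (hφ : DifferentiableAt ℝ φ p) :
    pd b (fun y => a (φ y)) p = a' * pd b φ p := by
  have := (ha.comp_hasFDerivAt p hφ.hasFDerivAt).fderiv
  change fderiv ℝ (a ∘ φ) p (basisVec b) = _
  rw [this]
  simp [pd]

/-- The radius. -/
def rr (p : Spacetime) : ℝ := ‖p.2‖

/-- The outgoing optical function `t - r`. -/
def uu (p : Spacetime) : ℝ := p.1 - ‖p.2‖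

/-- The incoming optical function `t + r`. -/
def vv (p : Spacetime) : ℝ := p.1 + ‖p.2‖

theorem contDiffAt_rr {p : Spacetime} (hp : p.2 ≠ 0) : ContDiffAt ℝ 1 rr p :=
  contDiffAt_snd.norm ℝ hp

theorem contDiffAt_uu {p : Spacetime} (hp : p.2 ≠ 0) : ContDiffAt ℝ 1 uu p :=
  contDiffAt_fst.sub (contDiffAt_rr hp)

theorem contDiffAt_vv {p : Spacetime} (hp : p.2 ≠ 0) : ContDiffAt ℝ 1 vv p :=
  contDiffAt_fst.add (contDiffAt_rr hp)

theorem contDiffAt_omega {p : Spacetime} (hp : p.2 ≠ 0) (i : Fin 3) :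
    ContDiffAt ℝ 1 (fun y => omega y i) p := by
  have h : (fun y : Spacetime => omega y i) = fun y => (rr y)⁻¹ * y.2 i := by
    ext y; simp [omega, rr]
  rw [h]
  refine ((contDiffAt_rr hp).inv (norm_ne_zero_iff.mpr hp)).mul ?_
  exact (EuclideanSpace.proj (𝕜 := ℝ) i : Space →L[ℝ] ℝ).contDiff.contDiffAt.comp p contDiffAt_snd

theorem pd_fst (b : Fin 4) (p : Spacetime) : pd b (fun y => y.1) p = if b = 0 then 1 else 0 := by
  have : fderiv ℝ (fun y : Spacetime => y.1) p = ContinuousLinearMap.fst ℝ ℝ Space := fderiv_fst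
  rw [pd, this]
  fin_cases b <;> simp [basisVec_zero, basisVec_one, basisVec_two, basisVec_three]

theorem pd_snd (b : Fin 4) (i : Fin 3) (p : Spacetime) :
    pd b (fun y => y.2 i) p = if b = i.succ then 1 else 0 := by
  have : HasFDerivAt (fun y : Spacetime => y.2 i)
      ((EuclideanSpace.proj (𝕜 := ℝ) i : Space →L[ℝ] ℝ).comp
        (ContinuousLinearMap.snd ℝ ℝ Space)) p :=
    ((EuclideanSpace.proj (𝕜 := ℝ) i : Space →L[ℝ] ℝ).comp
        (ContinuousLinearMap.snd ℝ ℝ Space)).hasFDerivAt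
  rw [pd, this.fderiv]
  refine Fin.cases ?_ (fun k => ?_) b
  · simp [basisVec_zero, (Fin.succ_ne_zero i).symm]
  · have : basisVec k.succ = (0, EuclideanSpace.single k 1) := rfl
    simp [this, Fin.succ_inj, eq_comm]

theorem pd_rr {p : Spacetime} (hp : p.2 ≠ 0) :
    pd 0 rr p = 0 ∧ ∀ i : Fin 3, pd i.succ rr p = omega p i := by
  have h : HasFDerivAt rr ((innerSL ℝ (omega p)).comp (ContinuousLinearMap.snd ℝ ℝ Space)) p := by
    have h1 : HasFDerivAt (fun x : Space => ‖x‖) (innerSL ℝ (omega p)) p.2 := by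
      have h2 := (hasStrictFDerivAt_norm_sq p.2).hasFDerivAt.sqrt (by simpa using hp)
      have h3 : (fun x : Space => Real.sqrt (‖x‖ ^ 2)) = fun x => ‖x‖ := by
        ext x; exact Real.sqrt_sq (norm_nonneg x)
      rw [h3] at h2
      refine h2.congr_fderiv ?_
      rw [Real.sqrt_sq (norm_nonneg _)]
      ext x
      have := norm_ne_zero_iff.mpr hp
      simp [omega]
      field_simp
    exact h1.comp p hasFDerivAt_snd
  constructor
  · rw [pd, h.fderiv]; simp [basisVec_zero]
  · intro i
    rw [pd, h.fderiv]
    have : basisVec i.succ = (0, EuclideanSpace.single i 1) := rfl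
    simp [this, EuclideanSpace.inner_single_right]

theorem pd_uu {p : Spacetime} (hp : p.2 ≠ 0) :
    pd 0 uu p = 1 ∧ ∀ i : Fin 3, pd i.succ uu p = -omega p i := by
  have e : ∀ b, pd b uu p = pd b (fun y => y.1) p - pd b rr p := fun b =>
    pd_sub differentiableAt_fst ((contDiffAt_rr hp).differentiableAt one_ne_zero)
  obtain ⟨h0, h1⟩ := pd_rr hp
  constructor
  · rw [e, pd_fst, h0]; simp
  · intro i
    rw [e, pd_fst, h1, if_neg (Fin.succ_ne_zero i)]; ring

theorem pd_vv {p : Spacetime} (hp : p.2 ≠ 0) :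
    pd 0 vv p = 1 ∧ ∀ i : Fin 3, pd i.succ vv p = omega p i := by
  have e : ∀ b, pd b vv p = pd b (fun y => y.1) p + pd b rr p := fun b =>
    pd_add differentiableAt_fst ((contDiffAt_rr hp).differentiableAt one_ne_zero)
  obtain ⟨h0, h1⟩ := pd_rr hp
  constructor
  · rw [e, pd_fst, h0]; simp
  · intro i
    rw [e, pd_fst, h1, if_neg (Fin.succ_ne_zero i)]; ring

theorem pd_omega {p : Spacetime} (hp : p.2 ≠ 0) (i : Fin 3) :
    pd 0 (fun y => omega y i) p = 0 ∧ ∀ k : Fin 3, pd k.succ (fun y => omega y i) p =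
      (rr p)⁻¹ * ((if i = k then 1 else 0) - omega p i * omega p k) := by
  have hr : rr p ≠ 0 := norm_ne_zero_iff.mpr hp
  have hd : DifferentiableAt ℝ (fun y => (rr y)⁻¹) p :=
    ((contDiffAt_rr hp).inv hr).differentiableAt one_ne_zero
  have hd2 : DifferentiableAt ℝ (fun y : Spacetime => y.2 i) p :=
    ((EuclideanSpace.proj (𝕜 := ℝ) i : Space →L[ℝ] ℝ).comp
        (ContinuousLinearMap.snd ℝ ℝ Space)).differentiableAt
  have h : (fun y : Spacetime => omega y i) = fun y => (rr y)⁻¹ * y.2 i := by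
    ext y; simp [omega, rr]
  have e : ∀ b, pd b (fun y => omega y i) p = (rr p)⁻¹ * pd b (fun y => y.2 i) p
      + p.2 i * (-(rr p ^ 2)⁻¹ * pd b rr p) := by
    intro b
    rw [h, pd_mul hd hd2, pd_comp (hasDerivAt_inv hr)
      ((contDiffAt_rr hp).differentiableAt one_ne_zero)]
  have hx : p.2 i = rr p * omega p i := by
    simp [omega, rr]
    rw [← mul_assoc, mul_inv_cancel₀ (norm_ne_zero_iff.mpr hp), one_mul]
  obtain ⟨h0, h1⟩ := pd_rr hp
  constructor
  · rw [e, pd_snd, h0, if_neg (Fin.succ_ne_zero i).symm]; ring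
  · intro k
    rw [e, pd_snd, h1, hx]
    simp only [Fin.succ_inj, eq_comm (a := k)]
    field_simp
    ring

/-! ### The remainder field -/

theorem el_sub (G G' : TwoForm) (i : Fin 3) : el (G - G') i = el G i - el G' i := rfl

theorem mg_sub (G G' : TwoForm) (i : Fin 3) : mg (G - G') i = mg G i - mg G' i := by
  have h1 := hodge_values (G - G')
  have h2 := hodge_values G
  have h3 := hodge_values G'
  have e : ∀ a b, comp (G - G') a b = comp G a b - comp G' a b := fun _ _ => rfl
  fin_cases i
  · change hodge _ 0 1 = hodge _ 0 1 - hodge _ 0 1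
    rw [h1.1, h2.1, h3.1, e]; ring
  · change hodge _ 0 2 = hodge _ 0 2 - hodge _ 0 2
    rw [h1.2.1, h2.2.1, h3.2.1, e]
  · change hodge _ 0 3 = hodge _ 0 3 - hodge _ 0 3
    rw [h1.2.2.1, h2.2.2.1, h3.2.2.1, e]; ring

/-- The radial profile of the pure-charge field. -/
def profile (χ : ℝ → ℝ) (q : ℝ) (p : Spacetime) : ℝ :=
  q / (4 * Real.pi * ‖p.2‖ ^ 2) * χ (‖p.2‖ - p.1 - 2)

/-- The radial profile of the current of the pure-charge field. -/
def dprofile (χ : ℝ → ℝ) (q : ℝ) (p : Spacetime) : ℝ :=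
  q / (4 * Real.pi * ‖p.2‖ ^ 2) * deriv χ (‖p.2‖ - p.1 - 2)

/-- The current of the pure-charge field. -/
def chargeCurrent (χ : ℝ → ℝ) (q : ℝ) (p : Spacetime) : OneForm :=
  dprofile χ q p • (ContinuousLinearMap.fst ℝ ℝ Space
    - (innerSL ℝ (omega p)).comp (ContinuousLinearMap.snd ℝ ℝ Space))

theorem chargeField_apply (χ : ℝ → ℝ) (q : ℝ) (p v w : Spacetime) :
    chargeField χ q p ![v, w] = profile χ q p * (v.1 * inner ℝ (omega p) w.2
      - w.1 * inner ℝ (omega p) v.2) := by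
  have : chargeField χ q p ![v, w] = profile χ q p *
    (wedge (ContinuousLinearMap.fst ℝ ℝ Space)
      ((innerSL ℝ (omega p)).comp (ContinuousLinearMap.snd ℝ ℝ Space)) ![v, w]) := rfl
  rw [this, wedge_apply]
  rfl

theorem el_chargeField (χ : ℝ → ℝ) (q : ℝ) (p : Spacetime) (i : Fin 3) :
    el (chargeField χ q p) i = profile χ q p * omega p i := by
  have : basisVec i.succ = (0, EuclideanSpace.single i 1) := rfl
  rw [el, comp, chargeField_apply, this, basisVec_zero]
  simp [EuclideanSpace.inner_single_right]

theorem mg_chargeField (χ : ℝ → ℝ) (q : ℝ) (p : Spacetime) (i : Fin 3) :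
    mg (chargeField χ q p) i = 0 := by
  have h1 := hodge_values (chargeField χ q p)
  have e : ∀ a b : Fin 3, comp (chargeField χ q p) a.succ b.succ = 0 := by
    intro a b
    have h : ∀ k : Fin 3, basisVec k.succ = (0, EuclideanSpace.single k 1) := fun _ => rfl
    rw [comp, chargeField_apply, h, h]
    simp
  fin_cases i
  · change hodge _ 0 1 = 0
    rw [h1.1, neg_eq_zero]; exact e 1 2
  · change hodge _ 0 2 = 0
    rw [h1.2.1]; exact e 0 2
  · change hodge _ 0 3 = 0
    rw [h1.2.2.1, neg_eq_zero]; exact e 0 1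

theorem contDiffAt_profile {χ : ℝ → ℝ} (hχ : IsSmoothStep χ) (q : ℝ) {p : Spacetime}
    (hp : p.2 ≠ 0) : ContDiffAt ℝ 1 (profile χ q) p := by
  have h1 : ContDiffAt ℝ 1 (fun p : Spacetime => ‖p.2‖) p := contDiffAt_rr hp
  have hχ1 : ContDiff ℝ 1 χ := hχ.smooth.of_le (by exact_mod_cast le_top)
  unfold profile
  refine (contDiffAt_const.div (contDiffAt_const.mul (h1.pow 2)) ?_).mul
    (hχ1.contDiffAt.comp p ((h1.sub contDiffAt_fst).sub contDiffAt_const))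
  have := norm_ne_zero_iff.mpr hp
  positivity

theorem pd_profile {χ : ℝ → ℝ} (hχ : IsSmoothStep χ) (q : ℝ) {p : Spacetime} (hp : p.2 ≠ 0) :
    pd 0 (profile χ q) p = -dprofile χ q p ∧ ∀ i : Fin 3, pd i.succ (profile χ q) p =
      (dprofile χ q p - 2 * (rr p)⁻¹ * profile χ q p) * omega p i := by
  have hr : rr p ≠ 0 := norm_ne_zero_iff.mpr hp
  have hχd : ∀ y, HasDerivAt χ (deriv χ y) y := fun y =>
    (hχ.smooth.differentiable (by simp) y).hasDerivAt
  have hA : HasDerivAt (fun r : ℝ => q / (4 * Real.pi * r ^ 2))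
      (-2 * (rr p)⁻¹ * (q / (4 * Real.pi * rr p ^ 2))) (rr p) := by
    have h0 : HasDerivAt (fun r : ℝ => 4 * Real.pi * r ^ 2) (4 * Real.pi * (2 * rr p)) (rr p) := by
      simpa using (hasDerivAt_pow 2 (rr p)).const_mul (4 * Real.pi)
    refine ((hasDerivAt_const (rr p) q).div h0 (by positivity)).congr_deriv ?_
    have := Real.pi_pos
    field_simp
    ring
  have hdr := (contDiffAt_rr hp).differentiableAt one_ne_zero
  have hdu := (contDiffAt_uu hp).differentiableAt one_ne_zero
  have hB : HasDerivAt (fun u : ℝ => χ (-u - 2)) (-deriv χ (-uu p - 2)) (uu p) := by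
    have h0 : HasDerivAt (fun u : ℝ => -u - 2) (-1) (uu p) := (hasDerivAt_neg _).sub_const 2
    exact ((hχd (-uu p - 2)).comp (uu p) h0).congr_deriv (by ring)
  have hprof : profile χ q = fun p => q / (4 * Real.pi * rr p ^ 2) * χ (-uu p - 2) := by
    ext y; simp [profile, rr, uu]
  have hdprof : dprofile χ q p = q / (4 * Real.pi * rr p ^ 2) * deriv χ (-uu p - 2) := by
    simp [dprofile, rr, uu]
  have e : ∀ b, pd b (profile χ q) p = q / (4 * Real.pi * rr p ^ 2) *
      (-deriv χ (-uu p - 2) * pd b uu p) + χ (-uu p - 2) *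
      (-2 * (rr p)⁻¹ * (q / (4 * Real.pi * rr p ^ 2)) * pd b rr p) := by
    intro b
    have dA : DifferentiableAt ℝ (fun p => q / (4 * Real.pi * rr p ^ 2)) p :=
      hA.differentiableAt.comp p hdr
    have dB : DifferentiableAt ℝ (fun p => χ (-uu p - 2)) p := hB.differentiableAt.comp p hdu
    rw [hprof, pd_mul dA dB, pd_comp hB hdu, pd_comp hA hdr]
  have hprofp : profile χ q p = q / (4 * Real.pi * rr p ^ 2) * χ (-uu p - 2) := by rw [hprof]
  obtain ⟨r0, r1⟩ := pd_rr hp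
  obtain ⟨u0, u1⟩ := pd_uu hp
  constructor
  · rw [e, r0, u0, hdprof]; ring
  · intro i
    rw [e, r1, u1, hdprof, hprofp]; ring

/-- The remainder field solves Maxwell's equations with a modified current. -/
theorem maxwell_remainder {χ : ℝ → ℝ} (hχ : IsSmoothStep χ) {F : Spacetime → TwoForm}
    {J : Spacetime → OneForm} {T : ℝ} (hF : ∀ p ∈ slab T, ContDiffAt ℝ 1 F p)
    (h : MaxwellOn F J (slab T)) {p : Spacetime} (hp : p ∈ slab T) (hp0 : p.2 ≠ 0)
    {e m : Fin 3 → Spacetime → ℝ} {j : Fin 4 → ℝ}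
    (he : e = fun i y => el (remainder χ F J y) i) (hm : m = fun i y => mg (remainder χ F J y) i)
    (hj : j = fun a => (J p - chargeCurrent χ (charge J) p) (basisVec a)) :
    (∀ i, ContDiffAt ℝ 1 (e i) p) ∧ (∀ i, ContDiffAt ℝ 1 (m i) p) ∧
    (pd 1 (e 0) p + pd 2 (e 1) p + pd 3 (e 2) p = j 0) ∧
    (pd 0 (e 0) p = pd 2 (m 2) p - pd 3 (m 1) p + j 1) ∧
    (pd 0 (e 1) p = pd 3 (m 0) p - pd 1 (m 2) p + j 2) ∧
    (pd 0 (e 2) p = pd 1 (m 1) p - pd 2 (m 0) p + j 3) ∧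
    (pd 1 (m 0) p + pd 2 (m 1) p + pd 3 (m 2) p = 0) ∧
    (pd 0 (m 0) p = -(pd 2 (e 2) p - pd 3 (e 1) p)) ∧
    (pd 0 (m 1) p = -(pd 3 (e 0) p - pd 1 (e 2) p)) ∧
    (pd 0 (m 2) p = -(pd 1 (e 1) p - pd 2 (e 0) p)) := by
  set q := charge J
  have happ : ∀ v w : Spacetime, ContDiffAt ℝ 1 (fun y => F y ![v, w]) p := by
    intro v w
    exact (ContinuousAlternatingMap.apply ℝ Spacetime ℝ ![v, w]).contDiff.contDiffAt.comp p (hF p hp)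
  have hel : ∀ i, ContDiffAt ℝ 1 (fun y => el (F y) i) p := fun i => happ _ _
  have hmg : ∀ i, ContDiffAt ℝ 1 (fun y => mg (F y) i) p := by
    intro i
    unfold mg hodge
    refine contDiffAt_const.mul (ContDiffAt.sum fun c _ => ContDiffAt.sum fun d _ => ?_)
    exact contDiffAt_const.mul (happ _ _)
  have hpr := contDiffAt_profile hχ q hp0
  have hom := fun i => contDiffAt_omega hp0 i
  have ee : ∀ i, e i = fun y => el (F y) i - profile χ q y * omega y i := by
    intro i
    rw [he]
    ext y
    change el (F y - chargeField χ q y) i = _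
    rw [el_sub, el_chargeField]
  have em : ∀ i, m i = fun y => mg (F y) i := by
    intro i
    rw [hm]
    ext y
    change mg (F y - chargeField χ q y) i = _
    rw [mg_sub, mg_chargeField, sub_zero]
  have d1 : ∀ b i, pd b (e i) p = pd b (fun y => el (F y) i) p
      - (profile χ q p * pd b (fun y => omega y i) p + omega p i * pd b (profile χ q) p) := by
    intro b i
    have a1 := (hel i).differentiableAt one_ne_zero
    have a2 := hpr.differentiableAt one_ne_zero
    have a3 := (hom i).differentiableAt one_ne_zero
    have a4 : DifferentiableAt ℝ (fun y => profile χ q y * omega y i) p := a2.mul a3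
    rw [ee, pd_sub a1 a4, pd_mul a2 a3]
  obtain ⟨p0, p1⟩ := pd_profile hχ q hp0
  have o0 := fun i => (pd_omega hp0 i).1
  have o1 := fun i => (pd_omega hp0 i).2
  have hw := omega_sq hp0
  -- Off the axis the Coulomb field `q ω / (4π r²)` solves the vacuum equations, so only derivatives
  -- falling on the step survive. They assemble into a multiple of `dt - dr`.
  have k0 : j 0 = J p (basisVec 0) - dprofile χ q p := by
    rw [hj]; simp [chargeCurrent, basisVec_zero, q]
  have k1 : ∀ i : Fin 3, j i.succ = J p (basisVec i.succ) + dprofile χ q p * omega p i := by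
    intro i
    have : basisVec i.succ = (0, EuclideanSpace.single i 1) := rfl
    rw [hj]; simp [chargeCurrent, this, EuclideanSpace.inner_single_right, q]
  obtain ⟨m0, m1, m2, m3, n0, n1, n2, n3⟩ := maxwell_comp h hp
  have dt : ∀ i, pd 0 (e i) p = pd 0 (fun y => el (F y) i) p + omega p i * dprofile χ q p := by
    intro i
    rw [d1, o0, p0]; ring
  have dx : ∀ k i : Fin 3, pd k.succ (e i) p = pd k.succ (fun y => el (F y) i) p
      - (profile χ q p * (rr p)⁻¹ * ((if i = k then 1 else 0) - 3 * omega p i * omega p k)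
        + dprofile χ q p * (omega p i * omega p k)) := by
    intro k i
    rw [d1, o1, p1]; ring
  have x : ∀ k i : Fin 3, i ≠ k → pd k.succ (e i) p = pd k.succ (fun y => el (F y) i) p
      - (profile χ q p * (rr p)⁻¹ * (0 - 3 * omega p i * omega p k)
        + dprofile χ q p * (omega p i * omega p k)) := by
    intro k i hik
    rw [dx, if_neg hik]
  have y : ∀ k : Fin 3, pd k.succ (e k) p = pd k.succ (fun y => el (F y) k) p
      - (profile χ q p * (rr p)⁻¹ * (1 - 3 * omega p k * omega p k)
        + dprofile χ q p * (omega p k * omega p k)) := by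
    intro k
    rw [dx, if_pos rfl]
  have x01 := x 0 1 (by decide)
  have x02 := x 0 2 (by decide)
  have x10 := x 1 0 (by decide)
  have x12 := x 1 2 (by decide)
  have x20 := x 2 0 (by decide)
  have x21 := x 2 1 (by decide)
  have y0 := y 0
  have y1 := y 1
  have y2 := y 2
  have c1 := k1 0
  have c2 := k1 1
  have c3 := k1 2
  have s0 : (0 : Fin 3).succ = 1 := rfl
  have s1 : (1 : Fin 3).succ = 2 := rfl
  have s2 : (2 : Fin 3).succ = 3 := rfl
  simp only [s0, s1, s2] at x01 x02 x10 x12 x20 x21 y0 y1 y2 c1 c2 c3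
  refine ⟨?_, ?_, ?_, ?_, ?_, ?_, ?_, ?_, ?_, ?_⟩
  · intro i
    rw [ee]
    exact (hel i).sub (hpr.mul (hom i))
  · intro i
    rw [em]
    exact hmg i
  · rw [y0, y1, y2, k0]
    linear_combination m0 + (3 * profile χ q p * (rr p)⁻¹ - dprofile χ q p) * hw
  · rw [dt, em, em, c1]; linear_combination m1
  · rw [dt, em, em, c2]; linear_combination m2
  · rw [dt, em, em, c3]; linear_combination m3
  · rw [em, em, em]; exact n0
  · rw [em, x12, x21]; linear_combination n1
  · rw [em, x20, x02]; linear_combination n2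
  · rw [em, x01, x10]; linear_combination n3

/-! ### The multiplier and its energy current -/

/-- The constant `K` compares the generating weights with the weights of the energy. -/
def WeightBounds (χ : ℝ → ℝ) (γ ε K : ℝ) : Prop :=
  ∀ u v x W w' : ℝ, |u| ≤ v → x = χ (-u) →
      W = wIn γ ε u + kIn γ ε u * mOut ε v →
      w' = x * jap u ^ (2 * γ - 1) + (1 - x) * jap u ^ (-2 * ε - 1) →
      x * jap u ^ (2 * γ) + (1 - x) ≤ W ∧
      W ≤ K * (x * jap u ^ (2 * γ) + (1 - x)) ∧
      w' ≤ K * -dwIn γ ε u ∧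
      (jap u / jap v) ^ (1 + 2 * ε) * w' ≤ K * -(kIn γ ε u * dmOut ε v) ∧
      W ^ 2 ≤ K * (w' * (x * jap u ^ (2 * γ) + (1 - x) * jap u ^ (2 * ε)) * jap u)

/-- The generating weight on space-time. -/
def genW (γ ε : ℝ) (p : Spacetime) : ℝ := wIn γ ε (uu p) + kIn γ ε (uu p) * mOut ε (vv p)

/-- The coefficient of a multiplier, cut off in the radius and in both optical functions. -/
def mult (κ ζ θ : ℝ → ℝ) (γ ε : ℝ) (f : Spacetime → ℝ) (p : Spacetime) : ℝ :=
  κ (rr p) * (ζ (uu p) * θ (vv p) * genW γ ε p * f p)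

/-- The energy current of the multiplier. -/
def energyCurrent (κ ζ θ : ℝ → ℝ) (s γ ε : ℝ) (G : Spacetime → TwoForm) :
    Fin 4 → Spacetime → ℝ :=
  Fin.cons (fun y => currentT (mult κ ζ θ γ ε (fun y => jap (vv y) ^ (2 * s)) y)
      (mult κ ζ θ γ ε (fun y => jap (uu y) ^ (2 * s)) y) (fun i => omega y i)
      (fun i => el (G y) i) (fun i => mg (G y) i))
    (fun i y => currentX (mult κ ζ θ γ ε (fun y => jap (vv y) ^ (2 * s)) y)
      (mult κ ζ θ γ ε (fun y => jap (uu y) ^ (2 * s)) y) (fun i => omega y i)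
      (fun i => el (G y) i) (fun i => mg (G y) i) i)

/-- The density of the weighted norm of the current. -/
def currentDensity (χ : ℝ → ℝ) (s γ ε : ℝ) (J : Spacetime → OneForm) (p : Spacetime) : ℝ :=
  (tauPlus p ^ (2 * s + 1 + 2 * ε) * tauMinus p ^ (-2 * ε) * |J p (vecL p)| ^ 2
      + tauPlus p ^ (1 + 2 * ε - 2 * s) * tauMinus p ^ (4 * s - 2 * ε) * |J p (vecLbar p)| ^ 2
      + tauPlus p ^ (2 * s) * tauMinus p * angSq (J p) p) * weightEps χ γ ε p

theorem vv_nonneg {p : Spacetime} (hp : 0 ≤ p.1) : 0 ≤ vv p := add_nonneg hp (norm_nonneg _)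

theorem abs_uu_le {p : Spacetime} (hp : 0 ≤ p.1) : |uu p| ≤ vv p := by
  have := norm_nonneg p.2
  rw [uu, vv, abs_le]
  constructor <;> linarith

section Mult

variable {κ ζ θ : ℝ → ℝ} {γ ε : ℝ} {p : Spacetime}

theorem contDiffAt_genW (hp0 : p.2 ≠ 0) (hv : 0 ≤ vv p) : ContDiffAt ℝ 1 (genW γ ε) p := by
  have hu := contDiffAt_uu hp0
  refine ((contDiff_wIn γ ε).contDiffAt.comp p hu).add
    (((contDiff_kIn γ ε).contDiffAt.comp p hu).mul ?_)
  exact (contDiffAt_mOut ε (by linarith)).comp p (contDiffAt_vv hp0)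

theorem contDiff_jap_rpow (a : ℝ) : ContDiff ℝ 1 fun y => jap y ^ a :=
  contDiff_jap.rpow_const_of_ne fun y => (jap_pos y).ne'

theorem contDiffAt_mult (hκ : ContDiff ℝ 1 κ) (hζ : ContDiff ℝ 1 ζ) (hθ : ContDiff ℝ 1 θ)
    (hp0 : p.2 ≠ 0) (hv : 0 ≤ vv p) {f : Spacetime → ℝ} (hf : ContDiffAt ℝ 1 f p) :
    ContDiffAt ℝ 1 (mult κ ζ θ γ ε f) p := by
  refine (hκ.contDiffAt.comp p (contDiffAt_rr hp0)).mul
    ((((hζ.contDiffAt.comp p (contDiffAt_uu hp0)).mul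
      (hθ.contDiffAt.comp p (contDiffAt_vv hp0))).mul (contDiffAt_genW hp0 hv)).mul hf)

theorem pd_mult (hκ : ContDiff ℝ 1 κ) (hζ : ContDiff ℝ 1 ζ) (hθ : ContDiff ℝ 1 θ)
    (hp0 : p.2 ≠ 0) (hv : 0 ≤ vv p) {f : Spacetime → ℝ} (hf : ContDiffAt ℝ 1 f p) (b : Fin 4) :
    pd b (mult κ ζ θ γ ε f) p =
      deriv κ (rr p) * pd b rr p * (ζ (uu p) * θ (vv p) * genW γ ε p * f p)
      + κ (rr p) * (((deriv ζ (uu p) * θ (vv p) * genW γ ε p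
          + ζ (uu p) * θ (vv p) * (dwIn γ ε (uu p) + dkIn γ ε (uu p) * mOut ε (vv p))) * pd b uu p
        + (ζ (uu p) * deriv θ (vv p) * genW γ ε p
          + ζ (uu p) * θ (vv p) * (kIn γ ε (uu p) * dmOut ε (vv p))) * pd b vv p) * f p
        + ζ (uu p) * θ (vv p) * genW γ ε p * pd b f p) := by
  have du := (contDiffAt_uu hp0).differentiableAt one_ne_zero
  have dv := (contDiffAt_vv hp0).differentiableAt one_ne_zero
  have dr := (contDiffAt_rr hp0).differentiableAt one_ne_zero
  have df := hf.differentiableAt one_ne_zero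
  have k1 := fun y => ((hκ.differentiable one_ne_zero) y).hasDerivAt
  have z1 := fun y => ((hζ.differentiable one_ne_zero) y).hasDerivAt
  have t1 := fun y => ((hθ.differentiable one_ne_zero) y).hasDerivAt
  have m1 := hasDerivAt_mOut ε (v := vv p) (by linarith)
  have w1 := hasDerivAt_wIn γ ε (uu p)
  have kk1 := hasDerivAt_kIn γ ε (uu p)
  have a1 : DifferentiableAt ℝ (fun y => κ (rr y)) p := (k1 _).differentiableAt.comp p dr
  have a2 : DifferentiableAt ℝ (fun y => ζ (uu y)) p := (z1 _).differentiableAt.comp p du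
  have a3 : DifferentiableAt ℝ (fun y => θ (vv y)) p := (t1 _).differentiableAt.comp p dv
  have a4 : DifferentiableAt ℝ (fun y => wIn γ ε (uu y)) p := w1.differentiableAt.comp p du
  have a5 : DifferentiableAt ℝ (fun y => kIn γ ε (uu y)) p := kk1.differentiableAt.comp p du
  have a6 : DifferentiableAt ℝ (fun y => mOut ε (vv y)) p := m1.differentiableAt.comp p dv
  have a7 : DifferentiableAt ℝ (fun y => kIn γ ε (uu y) * mOut ε (vv y)) p := a5.mul a6
  have a8 : DifferentiableAt ℝ (fun y => ζ (uu y) * θ (vv y)) p := a2.mul a3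
  have a9 : DifferentiableAt ℝ (fun y => wIn γ ε (uu y) + kIn γ ε (uu y) * mOut ε (vv y)) p :=
    a4.add a7
  have a10 : DifferentiableAt ℝ (fun y => ζ (uu y) * θ (vv y) *
    (wIn γ ε (uu y) + kIn γ ε (uu y) * mOut ε (vv y))) p := a8.mul a9
  have a11 : DifferentiableAt ℝ (fun y => ζ (uu y) * θ (vv y) *
    (wIn γ ε (uu y) + kIn γ ε (uu y) * mOut ε (vv y)) * f y) p := a10.mul df
  have e : mult κ ζ θ γ ε f = fun y => κ (rr y) * (ζ (uu y) * θ (vv y) *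
    (wIn γ ε (uu y) + kIn γ ε (uu y) * mOut ε (vv y)) * f y) := rfl
  rw [e, pd_mul a1 a11, pd_mul a10 df, pd_mul a8 a9, pd_mul a2 a3, pd_add a4 a7, pd_mul a5 a6,
    pd_comp (k1 _) dr, pd_comp (z1 _) du, pd_comp (t1 _) dv, pd_comp w1 du, pd_comp kk1 du,
    pd_comp m1 dv, genW]
  ring

end Mult

theorem oneForm_apply (j : OneForm) (v : Spacetime) : j v = v.1 * j (basisVec 0)
    + (v.2 0 * j (basisVec 1) + (v.2 1 * j (basisVec 2) + v.2 2 * j (basisVec 3))) := by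
  conv_lhs => rw [eq_coord_sum v]
  simp only [map_add, map_smul, smul_eq_mul]

/-- The source term of the energy identity in the null frame. -/
theorem source_eq (G : TwoForm) (j : OneForm) {p : Spacetime} (hp : p.2 ≠ 0) (P Q : ℝ) :
    (P + Q) * (el G 0 * j (basisVec 1) + el G 1 * j (basisVec 2) + el G 2 * j (basisVec 3))
      + (P - Q) * (j (basisVec 0) * rho G p
        + (j (basisVec 1) * (omega p 1 * mg G 2 - omega p 2 * mg G 1)
        + j (basisVec 2) * (omega p 2 * mg G 0 - omega p 0 * mg G 2)
        + j (basisVec 3) * (omega p 0 * mg G 1 - omega p 1 * mg G 0)))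
    = P * (rho G p * j (vecL p) + (G ![vecL p, angVec p 0] * j (angVec p 0)
        + G ![vecL p, angVec p 1] * j (angVec p 1) + G ![vecL p, angVec p 2] * j (angVec p 2)))
      + Q * ((G ![vecLbar p, angVec p 0] * j (angVec p 0)
        + G ![vecLbar p, angVec p 1] * j (angVec p 1)
        + G ![vecLbar p, angVec p 2] * j (angVec p 2)) - rho G p * j (vecLbar p)) := by
  have hw := omega_sq hp
  obtain ⟨a0, a1, a2⟩ := vecL_angVec G p
  obtain ⟨b0, b1, b2⟩ := vecLbar_angVec G p
  rw [a0, a1, a2, b0, b1, b2, rho_eq, oneForm_apply j (vecL p), oneForm_apply j (vecLbar p),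
    oneForm_apply j (angVec p 0), oneForm_apply j (angVec p 1), oneForm_apply j (angVec p 2)]
  simp only [angVec_fst, angVec_snd, vecL, vecLbar]
  simp
  linear_combination (-(P + Q) * (el G 0 * omega p 0 + el G 1 * omega p 1 + el G 2 * omega p 2)
    * (omega p 0 * j (basisVec 1) + omega p 1 * j (basisVec 2) + omega p 2 * j (basisVec 3))) * hw

/-- The divergence of the energy current controls the energy densities. -/
theorem energy_divergence_le {χ : ℝ → ℝ} (hχ : IsSmoothStep χ) {s γ ε K T : ℝ} (hγ : 0 < γ)
    (hε : 0 < ε) (hεs : ε ≤ s - 1 / 2) (hs1 : s ≤ 1) (hK0 : 0 < K) (hK : WeightBounds χ γ ε K)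
    {F : Spacetime → TwoForm} {J : Spacetime → OneForm}
    (hF : ∀ p ∈ slab T, ContDiffAt ℝ 1 F p) (h : MaxwellOn F J (slab T))
    {κ ζ θ : ℝ → ℝ} (hκ : ContDiff ℝ 1 κ) (hζ : ContDiff ℝ 1 ζ) (hθ : ContDiff ℝ 1 θ)
    (hκ0 : ∀ y, 0 ≤ κ y) (hζ0 : ∀ y, 0 ≤ ζ y) (hθ0 : ∀ y, 0 ≤ θ y)
    (hκ' : ∀ y, 0 ≤ deriv κ y) (hζ' : ∀ y, deriv ζ y ≤ 0) (hθ' : ∀ y, deriv θ y ≤ 0)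
    {p : Spacetime} (hp : p ∈ slab T) (hp0 : p.2 ≠ 0) {G : Spacetime → TwoForm}
    (hG : G = remainder χ F J) {V : Fin 4 → Spacetime → ℝ} (hV : V = energyCurrent κ ζ θ s γ ε G) :
    pd 0 (V 0) p - (pd 1 (V 1) p + pd 2 (V 2) p + pd 3 (V 3) p) ≤
      -(1 / (2 * K) * (κ (rr p) * (ζ (uu p) * θ (vv p)) * bulkDensity χ s γ ε G p))
      - κ (rr p) * (-deriv ζ (uu p) * θ (vv p)) * coneDensity χ s γ G p
      + 2 * K ^ 2 * (κ (rr p) * (ζ (uu p) * θ (vv p)) *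
          currentDensity χ s γ ε (fun p => J p - chargeCurrent χ (charge J) p) p)
      + deriv κ (rr p) * (ζ (uu p) * θ (vv p) * genW γ ε p *
        (jap (uu p) ^ (2 * s) * alphaBarSq (G p) p
          + jap (vv p) ^ (2 * s) * (rho (G p) p ^ 2 + sigma (G p) p ^ 2))) := by
  have hv := vv_nonneg hp.1
  have huv := abs_uu_le hp.1
  have hs : 1 / 2 ≤ s := by linarith
  set jj := J p - chargeCurrent χ (charge J) p with hjj
  obtain ⟨de, dm, m0, m1, m2, m3, n0, n1, n2, n3⟩ :=
    maxwell_remainder (e := fun i y => el (G y) i) (m := fun i y => mg (G y) i)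
      (j := fun a => jj (basisVec a)) hχ hF h hp hp0 (by rw [hG]) (by rw [hG]) rfl
  have hfv : ContDiffAt ℝ 1 (fun y => jap (vv y) ^ (2 * s)) p :=
    (contDiff_jap_rpow (2 * s)).contDiffAt.comp p (contDiffAt_vv hp0)
  have hfu : ContDiffAt ℝ 1 (fun y => jap (uu y) ^ (2 * s)) p :=
    (contDiff_jap_rpow (2 * s)).contDiffAt.comp p (contDiffAt_uu hp0)
  have pfv : ∀ b, pd b (fun y => jap (vv y) ^ (2 * s)) p = djap s (vv p) * pd b vv p := fun b =>
    pd_comp (hasDerivAt_jap_rpow (2 * s) (vv p)) ((contDiffAt_vv hp0).differentiableAt one_ne_zero)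
  have pfu : ∀ b, pd b (fun y => jap (uu y) ^ (2 * s)) p = djap s (uu p) * pd b uu p := fun b =>
    pd_comp (hasDerivAt_jap_rpow (2 * s) (uu p)) ((contDiffAt_uu hp0).differentiableAt one_ne_zero)
  have dP := contDiffAt_mult (γ := γ) (ε := ε) hκ hζ hθ hp0 hv hfv
  have dQ := contDiffAt_mult (γ := γ) (ε := ε) hκ hζ hθ hp0 hv hfu
  have pP := pd_mult (γ := γ) (ε := ε) hκ hζ hθ hp0 hv hfv
  have pQ := pd_mult (γ := γ) (ε := ε) hκ hζ hθ hp0 hv hfu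
  obtain ⟨u0, u1⟩ := pd_uu hp0
  obtain ⟨v0, v1⟩ := pd_vv hp0
  obtain ⟨r0, r1⟩ := pd_rr hp0
  set P := mult κ ζ θ γ ε (fun y => jap (vv y) ^ (2 * s)) with hPdef
  set Q := mult κ ζ θ γ ε (fun y => jap (uu y) ^ (2 * s)) with hQdef
  have hPp : P p = κ (rr p) * (ζ (uu p) * θ (vv p) * genW γ ε p * jap (vv p) ^ (2 * s)) := rfl
  have hQp : Q p = κ (rr p) * (ζ (uu p) * θ (vv p) * genW γ ε p * jap (uu p) ^ (2 * s)) := rfl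
  set Wu := dwIn γ ε (uu p) + dkIn γ ε (uu p) * mOut ε (vv p) with hWu
  set Wv := kIn γ ε (uu p) * dmOut ε (vv p) with hWv
  set Pr := deriv κ (rr p) * (ζ (uu p) * θ (vv p) * genW γ ε p * jap (vv p) ^ (2 * s))
    + κ (rr p) * ((-(deriv ζ (uu p) * θ (vv p) * genW γ ε p + ζ (uu p) * θ (vv p) * Wu)
      + (ζ (uu p) * deriv θ (vv p) * genW γ ε p + ζ (uu p) * θ (vv p) * Wv)) * jap (vv p) ^ (2 * s)
      + ζ (uu p) * θ (vv p) * genW γ ε p * djap s (vv p)) with hPr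
  set Qr := deriv κ (rr p) * (ζ (uu p) * θ (vv p) * genW γ ε p * jap (uu p) ^ (2 * s))
    + κ (rr p) * ((-(deriv ζ (uu p) * θ (vv p) * genW γ ε p + ζ (uu p) * θ (vv p) * Wu)
      + (ζ (uu p) * deriv θ (vv p) * genW γ ε p + ζ (uu p) * θ (vv p) * Wv)) * jap (uu p) ^ (2 * s)
      - ζ (uu p) * θ (vv p) * genW γ ε p * djap s (uu p)) with hQr
  have hPx : ∀ k : Fin 3, pd k.succ P p = Pr * omega p k := by
    intro k
    rw [pP, pfv, r1, u1, v1]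
    ring
  have hQx : ∀ k : Fin 3, pd k.succ Q p = Qr * omega p k := by
    intro k
    rw [pQ, pfu, r1, u1, v1]
    ring
  have key := div_current (e := fun i y => el (G y) i) (h := fun i y => mg (G y) i)
    (w := fun i y => omega y i) (P := P) (Q := Q) (p := p) (ri := (rr p)⁻¹) (Pr := Pr) (Qr := Qr)
    (j := fun a => jj (basisVec a))
    (fun i => (de i).differentiableAt one_ne_zero) (fun i => (dm i).differentiableAt one_ne_zero)
    (fun i => (contDiffAt_omega hp0 i).differentiableAt one_ne_zero)
    (dP.differentiableAt one_ne_zero) (dQ.differentiableAt one_ne_zero)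
    (omega_sq hp0) (fun i => (pd_omega hp0 i).1) (fun i => (pd_omega hp0 i).2) rfl hPx rfl hQx
    m0 m1 m2 m3 n0 n1 n2 n3 (rho_eq (G p)) (sigma_eq (G p) hp0) rfl (alphaSq_eq (G p) hp0)
    (alphaBarSq_eq (G p) hp0)
  have hse := source_eq (G p) jj hp0 (P p) (Q p)
  obtain ⟨k1, -, k3, k4, k5⟩ := hK (uu p) (vv p) _ (genW γ ε p) _ huv rfl rfl rfl
  set x := χ (-uu p) with hx
  set w' := x * jap (uu p) ^ (2 * γ - 1) + (1 - x) * jap (uu p) ^ (-2 * ε - 1) with hw'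
  have tm0 := jap_pos (uu p)
  have tp0 := jap_pos (vv p)
  have hx0 : 0 ≤ x := hχ.nonneg _
  have hx1 : 0 ≤ 1 - x := by have : x ≤ 1 := hχ.le_one _; linarith
  have hw'0 : 0 ≤ w' := by positivity
  have hW0 : 0 ≤ genW γ ε p := le_trans (by positivity) k1
  have hm0 := mOut_nonneg ε hv
  have hdk := dkIn_nonpos hγ hε (uu p)
  have hdw := neg_dwIn_nonneg hγ hε (uu p)
  have hWu0 : -dwIn γ ε (uu p) ≤ -Wu := by
    have := mul_nonpos_of_nonpos_of_nonneg hdk hm0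
    rw [hWu]; linarith
  have hα : 0 ≤ alphaSq (G p) p := Finset.sum_nonneg fun _ _ => sq_nonneg _
  have hβ : 0 ≤ alphaBarSq (G p) p := Finset.sum_nonneg fun _ _ => sq_nonneg _
  have hR : 0 ≤ rho (G p) p ^ 2 + sigma (G p) p ^ 2 := by positivity
  have hr : 0 < rr p := norm_pos_iff.mpr hp0
  -- The trapezoidal rule with `v - u = 2r`: this is what makes the undifferentiated term `(P - Q) /
  -- r` beat the derivatives of `τ₊^{2s}` and `τ₋^{2s}`.
  have htrap : djap s (vv p) + djap s (uu p)
      ≤ (jap (vv p) ^ (2 * s) - jap (uu p) ^ (2 * s)) * (rr p)⁻¹ := by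
    have := trapezoid hs hs1 huv
    have e : vv p - uu p = 2 * rr p := by simp only [vv, uu, rr]; ring
    rw [e] at this
    rw [← div_eq_mul_inv, le_div_iff₀ hr]
    linarith
  have hbulk := bulk_ge (κ := κ (rr p)) (κ' := deriv κ (rr p)) (ζ := ζ (uu p))
    (ζ' := deriv ζ (uu p)) (θ := θ (vv p)) (θ' := deriv θ (vv p)) (W := genW γ ε p) (Wu := Wu)
    (Wv := Wv) (Pt := pd 0 P p) (Qt := pd 0 Q p) (P := P p) (Q := Q p) (Pr := Pr) (Qr := Qr)
    (by positivity) (by positivity) htrap (hκ0 _) (hκ' _) (hζ0 _) (hζ' _) (hθ0 _) (hθ' _)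
    hW0 hα hβ hR (by linarith) hPp hQp (by rw [pP, pfv, r0, u0, v0]; ring) hPr
    (by rw [pQ, pfu, r0, u0, v0]; ring) hQr
  have htm : jap (uu p) ≤ jap (vv p) := jap_le_jap (huv.trans (le_abs_self _))
  have hsrc := source_le (s := s) (ε := ε) (tp := jap (vv p)) (tm := jap (uu p)) (W := genW γ ε p)
    (w' := w') (wE := x * jap (uu p) ^ (2 * γ) + (1 - x) * jap (uu p) ^ (2 * ε)) (K := K)
    hεs (one_le_jap _) htm hw'0 (by positivity) hK0 k5
    (a := fun i => G p ![vecL p, angVec p i]) (b := fun i => G p ![vecLbar p, angVec p i])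
    (j := fun i => jj (angVec p i)) (ρ := rho (G p) p) (σ := sigma (G p) p) (jL := jj (vecL p))
    (jB := jj (vecLbar p))
  have hxe : χ (‖p.2‖ - p.1) = x := by rw [hx, uu, neg_sub]
  have eB : bulkDensity χ s γ ε G p = (jap (vv p) ^ (2 * s) * alphaSq (G p) p
      + (jap (uu p) / jap (vv p)) ^ (1 + 2 * ε) * (jap (uu p) ^ (2 * s) * alphaBarSq (G p) p
        + jap (vv p) ^ (2 * s) * rho (G p) p ^ 2 + jap (vv p) ^ (2 * s) * sigma (G p) p ^ 2)) * w' := by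
    rw [hw', ← hxe]; rfl
  have eC : coneDensity χ s γ G p = (jap (vv p) ^ (2 * s) * alphaSq (G p) p
      + jap (uu p) ^ (2 * s) * (rho (G p) p ^ 2 + sigma (G p) p ^ 2))
      * (x * jap (uu p) ^ (2 * γ) + (1 - x)) := by
    rw [← hxe]; rfl
  have eJ : currentDensity χ s γ ε (fun p => J p - chargeCurrent χ (charge J) p) p =
      (jap (vv p) ^ (2 * s + 1 + 2 * ε) * jap (uu p) ^ (-2 * ε) * jj (vecL p) ^ 2
        + jap (vv p) ^ (1 + 2 * ε - 2 * s) * jap (uu p) ^ (4 * s - 2 * ε) * jj (vecLbar p) ^ 2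
        + jap (vv p) ^ (2 * s) * jap (uu p) * (jj (angVec p 0) ^ 2 + jj (angVec p 1) ^ 2
          + jj (angVec p 2) ^ 2)) * (x * jap (uu p) ^ (2 * γ) + (1 - x) * jap (uu p) ^ (2 * ε)) := by
    have eA : angSq jj p = jj (angVec p 0) ^ 2 + jj (angVec p 1) ^ 2 + jj (angVec p 2) ^ 2 :=
      Fin.sum_univ_three _
    rw [← hxe, ← sq_abs (jj (vecL p)), ← sq_abs (jj (vecLbar p)), ← eA]; rfl
  have eα : alphaSq (G p) p = G p ![vecL p, angVec p 0] ^ 2 + G p ![vecL p, angVec p 1] ^ 2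
      + G p ![vecL p, angVec p 2] ^ 2 := Fin.sum_univ_three _
  have eβ : alphaBarSq (G p) p = G p ![vecLbar p, angVec p 0] ^ 2
      + G p ![vecLbar p, angVec p 1] ^ 2 + G p ![vecLbar p, angVec p 2] ^ 2 := Fin.sum_univ_three _
  rw [← eα, ← eβ, ← eB, ← eJ] at hsrc
  have hκζθ : 0 ≤ κ (rr p) * (ζ (uu p) * θ (vv p)) := mul_nonneg (hκ0 _) (mul_nonneg (hζ0 _) (hθ0 _))
  have f1 : bulkDensity χ s γ ε G p ≤ K * (-Wu * jap (vv p) ^ (2 * s) * alphaSq (G p) p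
      + -Wv * (jap (uu p) ^ (2 * s) * alphaBarSq (G p) p
        + jap (vv p) ^ (2 * s) * (rho (G p) p ^ 2 + sigma (G p) p ^ 2))) := by
    -- The `u`-derivative of `W` pays for the term in `α`; the `v`-derivative, through `k4`, pays
    -- for the components carrying the factor `τ₀^{1+2ε}`.
    have g1 : w' ≤ K * -Wu := k3.trans (mul_le_mul_of_nonneg_left hWu0 hK0.le)
    have g2 : 0 ≤ jap (vv p) ^ (2 * s) * alphaSq (G p) p := by positivity
    have g3 : 0 ≤ jap (uu p) ^ (2 * s) * alphaBarSq (G p) p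
        + jap (vv p) ^ (2 * s) * (rho (G p) p ^ 2 + sigma (G p) p ^ 2) := by positivity
    have g4 := mul_le_mul_of_nonneg_right g1 g2
    have g5 := mul_le_mul_of_nonneg_right k4 g3
    rw [eB]
    linarith
  have f2 : coneDensity χ s γ G p ≤ genW γ ε p * (jap (vv p) ^ (2 * s) * alphaSq (G p) p
      + jap (uu p) ^ (2 * s) * (rho (G p) p ^ 2 + sigma (G p) p ^ 2)) := by
    rw [eC, mul_comm]
    exact mul_le_mul_of_nonneg_right k1 (by positivity)
  have f3 := mul_le_mul_of_nonneg_left f1 hκζθ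
  have f4 : 0 ≤ κ (rr p) * (-deriv ζ (uu p) * θ (vv p)) :=
    mul_nonneg (hκ0 _) (mul_nonneg (by linarith [hζ' (uu p)]) (hθ0 _))
  have f5 := mul_le_mul_of_nonneg_left f2 f4
  have f6 := mul_le_mul_of_nonneg_left hsrc hκζθ
  have hdiv : pd 0 (V 0) p - (pd 1 (V 1) p + pd 2 (V 2) p + pd 3 (V 3) p) =
      pd 0 (fun y => currentT (P y) (Q y) (fun i => omega y i) (fun i => el (G y) i)
        (fun i => mg (G y) i)) p
      - (pd 1 (fun y => currentX (P y) (Q y) (fun i => omega y i) (fun i => el (G y) i)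
          (fun i => mg (G y) i) 0) p
        + pd 2 (fun y => currentX (P y) (Q y) (fun i => omega y i) (fun i => el (G y) i)
          (fun i => mg (G y) i) 1) p
        + pd 3 (fun y => currentX (P y) (Q y) (fun i => omega y i) (fun i => el (G y) i)
          (fun i => mg (G y) i) 2) p) := by
    rw [hV]; rfl
  rw [hdiv, key, hse]
  have hc : 1 / (2 * K) * K = 1 / 2 := by field_simp
  -- The multiplier controls `1 / K` times the bulk density. It is split into two halves: one
  -- absorbs the source, the other is the gain in the conclusion.
  have f7 := mul_le_mul_of_nonneg_left f3 (by positivity : 0 ≤ 1 / K)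
  have hKK : ∀ a b : ℝ, 1 / K * (a * (K * b)) = a * b := by intro a b; field_simp
  rw [hKK] at f7
  have h2K : 1 / K = 2 * (1 / (2 * K)) := by field_simp
  rw [h2K] at f7
  rw [hPp, hQp] at hbulk ⊢
  linarith

/-! ### Regularity of the densities off the axis -/

/-- The slab with the axis removed. -/
def slabOff (T : ℝ) : Set Spacetime := {p | p ∈ slab T ∧ p.2 ≠ 0}

theorem measurableSet_slabOff (T : ℝ) : MeasurableSet (slabOff T) :=
  (measurableSet_slab T).inter (measurable_snd (measurableSet_singleton (0 : Space)).compl)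

theorem slabOff_ae_eq (T : ℝ) : (slabOff T : Set Spacetime) =ᵐ[volume] slab T := by
  have h0 : (volume : Measure Spacetime) {p : Spacetime | p.2 = 0} = 0 := by
    have : {p : Spacetime | p.2 = 0} = (univ : Set ℝ) ×ˢ ({0} : Set Space) := by ext p; simp
    rw [this, Measure.volume_eq_prod, Measure.prod_prod]
    simp
  have h1 : ∀ᵐ p : Spacetime, p.2 ≠ 0 := by
    rw [ae_iff]; simpa using h0
  filter_upwards [h1] with p hp
  exact propext ⟨fun h => h.1, fun h => ⟨h, hp⟩⟩

/-- The densities involve `ω` and `F̄`, which need not be continuous on the axis; the axis is a null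
set, so continuity off it suffices. -/
theorem aemeasurable_slab {f : Spacetime → ℝ} {T : ℝ} (hf : ContinuousOn f (slabOff T)) :
    AEMeasurable f (volume.restrict (slab T)) := by
  rw [← Measure.restrict_congr_set (slabOff_ae_eq T)]
  exact hf.aemeasurable (measurableSet_slabOff T)

theorem aemeasurable_slice {f : Spacetime → ℝ} {T t : ℝ} (hf : ContinuousOn f (slabOff T))
    (ht : t ∈ Icc 0 T) : AEMeasurable (fun x : Space => f (t, x)) volume := by
  have hm : MeasurableSet ({0}ᶜ : Set Space) := (measurableSet_singleton _).compl
  have h1 : ContinuousOn (fun x : Space => f (t, x)) ({0}ᶜ : Set Space) :=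
    hf.comp (by fun_prop) fun x hx => ⟨ht, hx⟩
  have h2 : (volume : Measure Space).restrict {0}ᶜ = volume := by
    rw [restrict_compl_singleton]
  rw [← h2]
  exact h1.aemeasurable hm

theorem ae_snd_ne_zero (T : ℝ) : ∀ᵐ p ∂(volume.restrict (slab T)), p ∈ slabOff T := by
  rw [← Measure.restrict_congr_set (slabOff_ae_eq T)]
  exact ae_restrict_mem (measurableSet_slabOff T)

section Continuity

variable {χ : ℝ → ℝ} {F : Spacetime → TwoForm} {J : Spacetime → OneForm} {T : ℝ}

theorem IsSmoothStep.contDiff (hχ : IsSmoothStep χ) : ContDiff ℝ 1 χ :=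
  hχ.smooth.of_le (by exact_mod_cast le_top)

theorem continuous_rr : Continuous rr := continuous_snd.norm

theorem continuous_uu : Continuous uu := continuous_fst.sub continuous_snd.norm

theorem continuous_vv : Continuous vv := continuous_fst.add continuous_snd.norm

theorem continuous_tauPlus_rpow (a : ℝ) : Continuous fun p => tauPlus p ^ a :=
  (contDiff_jap_rpow a).continuous.comp continuous_vv

theorem continuous_tauMinus_rpow (a : ℝ) : Continuous fun p => tauMinus p ^ a :=
  (contDiff_jap_rpow a).continuous.comp continuous_uu

theorem continuous_step (hχ : IsSmoothStep χ) :
    Continuous fun p : Spacetime => χ (‖p.2‖ - p.1) :=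
  hχ.contDiff.continuous.comp (by fun_prop)

theorem continuous_weight (hχ : IsSmoothStep χ) (γ : ℝ) : Continuous (weight χ γ) :=
  ((continuous_step hχ).mul (continuous_tauMinus_rpow _)).add
    (continuous_const.sub (continuous_step hχ))

theorem continuous_weightEps (hχ : IsSmoothStep χ) (γ ε : ℝ) : Continuous (weightEps χ γ ε) :=
  ((continuous_step hχ).mul (continuous_tauMinus_rpow _)).add
    ((continuous_const.sub (continuous_step hχ)).mul (continuous_tauMinus_rpow _))

theorem continuous_weightPrime (hχ : IsSmoothStep χ) (γ ε : ℝ) :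
    Continuous (weightPrime χ γ ε) :=
  ((continuous_step hχ).mul (continuous_tauMinus_rpow _)).add
    ((continuous_const.sub (continuous_step hχ)).mul (continuous_tauMinus_rpow _))

theorem continuous_tauZero_rpow (a : ℝ) : Continuous fun p => tauZero p ^ a := by
  have : (fun p => tauZero p ^ a) = fun p => tauMinus p ^ a / tauPlus p ^ a := by
    ext p
    exact Real.div_rpow (jap_pos (uu p)).le (jap_pos (vv p)).le a
  rw [this]
  refine (continuous_tauMinus_rpow a).div (continuous_tauPlus_rpow a) fun p => ?_
  exact (Real.rpow_pos_of_pos (jap_pos (vv p)) a).ne'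

theorem continuousOn_omega (i : Fin 3) : ContinuousOn (fun p => omega p i) (slabOff T) :=
  fun _ hp => (contDiffAt_omega hp.2 i).continuousAt.continuousWithinAt

theorem continuousOn_el (hχ : IsSmoothStep χ) (hF : ∀ p ∈ slab T, ContDiffAt ℝ 1 F p)
    (h : MaxwellOn F J (slab T)) (i : Fin 3) :
    ContinuousOn (fun p => el (remainder χ F J p) i) (slabOff T) := fun _ hp =>
  ((maxwell_remainder hχ hF h hp.1 hp.2 rfl rfl rfl).1 i).continuousAt.continuousWithinAt

theorem continuousOn_mg (hχ : IsSmoothStep χ) (hF : ∀ p ∈ slab T, ContDiffAt ℝ 1 F p)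
    (h : MaxwellOn F J (slab T)) (i : Fin 3) :
    ContinuousOn (fun p => mg (remainder χ F J p) i) (slabOff T) := fun _ hp =>
  ((maxwell_remainder hχ hF h hp.1 hp.2 rfl rfl rfl).2.1 i).continuousAt.continuousWithinAt

theorem continuousOn_components (hχ : IsSmoothStep χ) (hF : ∀ p ∈ slab T, ContDiffAt ℝ 1 F p)
    (h : MaxwellOn F J (slab T)) :
    ContinuousOn (fun p => alphaSq (remainder χ F J p) p) (slabOff T) ∧
    ContinuousOn (fun p => alphaBarSq (remainder χ F J p) p) (slabOff T) ∧
    ContinuousOn (fun p => rho (remainder χ F J p) p) (slabOff T) ∧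
    ContinuousOn (fun p => sigma (remainder χ F J p) p) (slabOff T) := by
  have e0 := continuousOn_el hχ hF h 0
  have e1 := continuousOn_el hχ hF h 1
  have e2 := continuousOn_el hχ hF h 2
  have m0 := continuousOn_mg hχ hF h 0
  have m1 := continuousOn_mg hχ hF h 1
  have m2 := continuousOn_mg hχ hF h 2
  have w0 := continuousOn_omega (T := T) 0
  have w1 := continuousOn_omega (T := T) 1
  have w2 := continuousOn_omega (T := T) 2
  have hr : ContinuousOn (fun p => rho (remainder χ F J p) p) (slabOff T) := by
    simp only [rho_eq]
    exact ((e0.mul w0).add (e1.mul w1)).add (e2.mul w2)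
  have hs : ContinuousOn (fun p => sigma (remainder χ F J p) p) (slabOff T) :=
    (((m0.mul w0).add (m1.mul w1)).add (m2.mul w2)).congr fun p hp => sigma_eq _ hp.2
  have hd := ((((e0.pow 2).add (e1.pow 2)).add (e2.pow 2)).add
    (((m0.pow 2).add (m1.pow 2)).add (m2.pow 2))).sub ((hr.pow 2).add (hs.pow 2))
  have hc := (continuousOn_const (c := (2 : ℝ))).mul
    (((e0.mul ((w1.mul m2).sub (w2.mul m1))).add (e1.mul ((w2.mul m0).sub (w0.mul m2)))).add
      (e2.mul ((w0.mul m1).sub (w1.mul m0))))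
  exact ⟨(hd.add hc).congr fun p hp => alphaSq_eq _ hp.2,
    (hd.sub hc).congr fun p hp => alphaBarSq_eq _ hp.2, hr, hs⟩

theorem continuousOn_fixedTimeDensity (hχ : IsSmoothStep χ)
    (hF : ∀ p ∈ slab T, ContDiffAt ℝ 1 F p) (h : MaxwellOn F J (slab T)) (s γ : ℝ) :
    ContinuousOn (fixedTimeDensity χ s γ (remainder χ F J)) (slabOff T) := by
  obtain ⟨a, b, r, g⟩ := continuousOn_components hχ hF h
  have t1 := (continuous_tauPlus_rpow (2 * s)).continuousOn (s := slabOff T)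
  have t2 := (continuous_tauMinus_rpow (2 * s)).continuousOn (s := slabOff T)
  have w := (continuous_weight hχ γ).continuousOn (s := slabOff T)
  unfold fixedTimeDensity
  fun_prop

theorem continuousOn_coneDensity (hχ : IsSmoothStep χ)
    (hF : ∀ p ∈ slab T, ContDiffAt ℝ 1 F p) (h : MaxwellOn F J (slab T)) (s γ : ℝ) :
    ContinuousOn (coneDensity χ s γ (remainder χ F J)) (slabOff T) := by
  obtain ⟨a, b, r, g⟩ := continuousOn_components hχ hF h
  have t1 := (continuous_tauPlus_rpow (2 * s)).continuousOn (s := slabOff T)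
  have t2 := (continuous_tauMinus_rpow (2 * s)).continuousOn (s := slabOff T)
  have w := (continuous_weight hχ γ).continuousOn (s := slabOff T)
  unfold coneDensity
  fun_prop

theorem continuousOn_bulkDensity (hχ : IsSmoothStep χ)
    (hF : ∀ p ∈ slab T, ContDiffAt ℝ 1 F p) (h : MaxwellOn F J (slab T)) (s γ ε : ℝ) :
    ContinuousOn (bulkDensity χ s γ ε (remainder χ F J)) (slabOff T) := by
  obtain ⟨a, b, r, g⟩ := continuousOn_components hχ hF h
  have t1 := (continuous_tauPlus_rpow (2 * s)).continuousOn (s := slabOff T)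
  have t2 := (continuous_tauMinus_rpow (2 * s)).continuousOn (s := slabOff T)
  have t3 := (continuous_tauZero_rpow (1 + 2 * ε)).continuousOn (s := slabOff T)
  have w := (continuous_weightPrime hχ γ ε).continuousOn (s := slabOff T)
  unfold bulkDensity
  fun_prop

/-- No regularity of `J` is assumed. It is inherited from Maxwell's equations, which express `J`
through first derivatives of the `C¹` field `F`. -/
theorem continuousOn_current (hF : ∀ p ∈ slab T, ContDiffAt ℝ 1 F p)
    (h : MaxwellOn F J (slab T)) (a : Fin 4) :
    ContinuousOn (fun p => J p (basisVec a)) (slab T) := by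
  have happ : ∀ a b : Fin 4, ∀ p ∈ slab T, ContDiffAt ℝ 1 (fun y => comp (F y) a b) p := by
    intro a b p hp
    exact (ContinuousAlternatingMap.apply ℝ Spacetime ℝ
      ![basisVec a, basisVec b]).contDiff.contDiffAt.comp p (hF p hp)
  refine ContinuousOn.congr ?_ fun p hp => ((h p hp a).1).symm
  unfold tensorDiv
  refine continuousOn_finsetSum _ fun b _ => continuousOn_const.mul ?_
  exact continuousOn_pd (happ a b) b

theorem continuousOn_currentDensity (hχ : IsSmoothStep χ) {j : Spacetime → OneForm}
    (hj : ∀ a, ContinuousOn (fun p => j p (basisVec a)) (slabOff T)) (s γ ε : ℝ) :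
    ContinuousOn (currentDensity χ s γ ε j) (slabOff T) := by
  have w := fun i => continuousOn_omega (T := T) i
  have hv : ∀ v : Spacetime → Spacetime, ContinuousOn (fun p => (v p).1) (slabOff T) →
      (∀ i, ContinuousOn (fun p => (v p).2 i) (slabOff T)) →
      ContinuousOn (fun p => j p (v p)) (slabOff T) := by
    intro v h0 h1
    refine ContinuousOn.congr ?_ fun p _ => oneForm_apply (j p) (v p)
    have a0 := hj 0
    have a1 := hj 1
    have a2 := hj 2
    have a3 := hj 3
    have b0 := h1 0
    have b1 := h1 1
    have b2 := h1 2
    fun_prop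
  have hL : ContinuousOn (fun p => j p (vecL p)) (slabOff T) := hv _ continuousOn_const w
  have hB : ContinuousOn (fun p => j p (vecLbar p)) (slabOff T) :=
    hv _ continuousOn_const fun i => (w i).neg
  have hA : ∀ i, ContinuousOn (fun p => j p (angVec p i)) (slabOff T) := by
    intro i
    refine hv _ continuousOn_const fun k => ?_
    simp only [angVec_snd]
    exact continuousOn_const.sub ((w i).mul (w k))
  have hA2 : ContinuousOn (fun p => angSq (j p) p) (slabOff T) :=
    continuousOn_finsetSum _ fun i _ => (hA i).pow 2
  have t1 := (continuous_tauPlus_rpow (2 * s + 1 + 2 * ε)).continuousOn (s := slabOff T)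
  have t2 := (continuous_tauMinus_rpow (-2 * ε)).continuousOn (s := slabOff T)
  have t3 := (continuous_tauPlus_rpow (1 + 2 * ε - 2 * s)).continuousOn (s := slabOff T)
  have t4 := (continuous_tauMinus_rpow (4 * s - 2 * ε)).continuousOn (s := slabOff T)
  have t5 := (continuous_tauPlus_rpow (2 * s)).continuousOn (s := slabOff T)
  have t6 : ContinuousOn tauMinus (slabOff T) :=
    (contDiff_jap.continuous.comp continuous_uu).continuousOn
  have w := (continuous_weightEps hχ γ ε).continuousOn (s := slabOff T)
  unfold currentDensity
  exact ((((t1.mul t2).mul (hL.abs.pow 2)).add ((t3.mul t4).mul (hB.abs.pow 2))).add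
    ((t5.mul t6).mul hA2)).mul w

theorem continuousOn_chargeCurrent (hχ : IsSmoothStep χ) (q : ℝ) (a : Fin 4) :
    ContinuousOn (fun p => chargeCurrent χ q p (basisVec a)) (slabOff T) := by
  have hd : ContinuousOn (dprofile χ q) (slabOff T) := by
    have h1 : Continuous (deriv χ) := hχ.contDiff.continuous_deriv le_rfl
    unfold dprofile
    refine ContinuousOn.mul (continuousOn_const.div (by fun_prop) ?_)
      (h1.comp (by fun_prop)).continuousOn
    intro p hp
    have := norm_ne_zero_iff.mpr hp.2
    positivity
  refine Fin.cases ?_ (fun k => ?_) a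
  · simpa [chargeCurrent, basisVec_zero] using hd
  · refine (hd.mul (continuousOn_omega k)).neg.congr fun p _ => ?_
    have : basisVec k.succ = (0, EuclideanSpace.single k 1) := rfl
    simp [chargeCurrent, this, EuclideanSpace.inner_single_right]

theorem continuousOn_modifiedCurrent (hχ : IsSmoothStep χ)
    (hF : ∀ p ∈ slab T, ContDiffAt ℝ 1 F p) (h : MaxwellOn F J (slab T)) (q : ℝ) (a : Fin 4) :
    ContinuousOn (fun p => (J p - chargeCurrent χ q p) (basisVec a)) (slabOff T) :=
  ((continuousOn_current hF h a).mono fun _ hp => hp.1).sub (continuousOn_chargeCurrent hχ q a)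

end Continuity

/-! ### Nonnegativity -/

theorem weight_nonneg {χ : ℝ → ℝ} (hχ : IsSmoothStep χ) (γ : ℝ) (p : Spacetime) :
    0 ≤ weight χ γ p := by
  have h1 := hχ.nonneg (‖p.2‖ - p.1)
  have h2 := hχ.le_one (‖p.2‖ - p.1)
  have h3 : 0 < tauMinus p := jap_pos (uu p)
  exact add_nonneg (by positivity) (by linarith)

theorem weightEps_nonneg {χ : ℝ → ℝ} (hχ : IsSmoothStep χ) (γ ε : ℝ) (p : Spacetime) :
    0 ≤ weightEps χ γ ε p := by
  have h1 := hχ.nonneg (‖p.2‖ - p.1)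
  have h2 := hχ.le_one (‖p.2‖ - p.1)
  have h3 : 0 < tauMinus p := jap_pos (uu p)
  exact add_nonneg (by positivity) (mul_nonneg (by linarith) (by positivity))

theorem weightPrime_nonneg {χ : ℝ → ℝ} (hχ : IsSmoothStep χ) (γ ε : ℝ) (p : Spacetime) :
    0 ≤ weightPrime χ γ ε p := by
  have h1 := hχ.nonneg (‖p.2‖ - p.1)
  have h2 := hχ.le_one (‖p.2‖ - p.1)
  have h3 : 0 < tauMinus p := jap_pos (uu p)
  exact add_nonneg (by positivity) (mul_nonneg (by linarith) (by positivity))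

theorem alphaSq_nonneg (G : TwoForm) (p : Spacetime) : 0 ≤ alphaSq G p :=
  Finset.sum_nonneg fun _ _ => sq_nonneg _

theorem alphaBarSq_nonneg (G : TwoForm) (p : Spacetime) : 0 ≤ alphaBarSq G p :=
  Finset.sum_nonneg fun _ _ => sq_nonneg _

theorem angSq_nonneg (j : OneForm) (p : Spacetime) : 0 ≤ angSq j p :=
  Finset.sum_nonneg fun _ _ => sq_nonneg _

theorem tauPlus_pos (p : Spacetime) : 0 < tauPlus p := jap_pos (vv p)

theorem tauMinus_pos (p : Spacetime) : 0 < tauMinus p := jap_pos (uu p)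

theorem fixedTimeDensity_nonneg {χ : ℝ → ℝ} (hχ : IsSmoothStep χ) (s γ : ℝ)
    (G : Spacetime → TwoForm) (p : Spacetime) : 0 ≤ fixedTimeDensity χ s γ G p := by
  have := weight_nonneg hχ γ p
  have := alphaSq_nonneg (G p) p
  have := alphaBarSq_nonneg (G p) p
  have := tauPlus_pos p
  have := tauMinus_pos p
  unfold fixedTimeDensity
  positivity

theorem coneDensity_nonneg {χ : ℝ → ℝ} (hχ : IsSmoothStep χ) (s γ : ℝ)
    (G : Spacetime → TwoForm) (p : Spacetime) : 0 ≤ coneDensity χ s γ G p := by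
  have := weight_nonneg hχ γ p
  have := alphaSq_nonneg (G p) p
  have := tauPlus_pos p
  have := tauMinus_pos p
  unfold coneDensity
  positivity

theorem bulkDensity_nonneg {χ : ℝ → ℝ} (hχ : IsSmoothStep χ) (s γ ε : ℝ)
    (G : Spacetime → TwoForm) (p : Spacetime) : 0 ≤ bulkDensity χ s γ ε G p := by
  have := weightPrime_nonneg hχ γ ε p
  have := alphaSq_nonneg (G p) p
  have := alphaBarSq_nonneg (G p) p
  have := tauPlus_pos p
  have := tauMinus_pos p
  unfold bulkDensity tauZero
  positivity

theorem currentDensity_nonneg {χ : ℝ → ℝ} (hχ : IsSmoothStep χ) (s γ ε : ℝ)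
    (J : Spacetime → OneForm) (p : Spacetime) : 0 ≤ currentDensity χ s γ ε J p := by
  have := weightEps_nonneg hχ γ ε p
  have := angSq_nonneg (J p) p
  have := tauPlus_pos p
  have := tauMinus_pos p
  unfold currentDensity
  positivity

/-! ### The integrated energy inequality with cutoffs -/

/-- The cutoff excising the ball of radius `η`. -/
def cutIn (χ : ℝ → ℝ) (η r : ℝ) : ℝ := χ (η⁻¹ * r - 1)

/-- The cutoff at `v = R`. -/
def cutOut (χ : ℝ → ℝ) (R v : ℝ) : ℝ := 1 - χ (v - R)

theorem IsSmoothStep.deriv_nonneg {χ : ℝ → ℝ} (hχ : IsSmoothStep χ) (y : ℝ) : 0 ≤ deriv χ y :=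
  hχ.mono.deriv_nonneg

theorem IsSmoothStep.hasDerivAt {χ : ℝ → ℝ} (hχ : IsSmoothStep χ) (y : ℝ) :
    HasDerivAt χ (deriv χ y) y :=
  ((hχ.contDiff.differentiable one_ne_zero) y).hasDerivAt

theorem IsSmoothStep.deriv_eq_zero {χ : ℝ → ℝ} (hχ : IsSmoothStep χ) {y : ℝ} (hy : y < 0 ∨ 1 < y) :
    deriv χ y = 0 := by
  rcases hy with hy | hy
  · have : χ =ᶠ[nhds y] fun _ => 0 := by
      filter_upwards [eventually_lt_nhds hy] with z hz using hχ.eq_zero z hz.le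
    rw [this.deriv_eq, deriv_const]
  · have : χ =ᶠ[nhds y] fun _ => 1 := by
      filter_upwards [eventually_gt_nhds hy] with z hz using hχ.eq_one z hz.le
    rw [this.deriv_eq, deriv_const]

theorem IsSmoothStep.exists_deriv_le {χ : ℝ → ℝ} (hχ : IsSmoothStep χ) :
    ∃ M, 0 < M ∧ ∀ y, deriv χ y ≤ M := by
  have hc : Continuous (deriv χ) := hχ.contDiff.continuous_deriv le_rfl
  obtain ⟨M, hM⟩ := (isCompact_Icc (a := (0 : ℝ)) (b := 1)).exists_bound_of_continuousOn
    hc.continuousOn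
  refine ⟨max M 1, by positivity, fun y => ?_⟩
  by_cases hy : y ∈ Icc (0 : ℝ) 1
  · exact (le_abs_self _).trans ((hM y hy).trans (le_max_left _ _))
  · rw [hχ.deriv_eq_zero (by simp only [mem_Icc, not_and_or, not_le] at hy; exact hy)]
    positivity

section Cutoffs

variable {χ : ℝ → ℝ} {η R : ℝ}

theorem contDiff_cutIn (hχ : IsSmoothStep χ) : ContDiff ℝ 1 (cutIn χ η) :=
  hχ.contDiff.comp (by fun_prop)

theorem contDiff_cutOut (hχ : IsSmoothStep χ) : ContDiff ℝ 1 (cutOut χ R) :=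
  contDiff_const.sub (hχ.contDiff.comp (by fun_prop))

theorem deriv_cutIn (hχ : IsSmoothStep χ) (r : ℝ) :
    deriv (cutIn χ η) r = deriv χ (η⁻¹ * r - 1) * η⁻¹ := by
  have h1 : HasDerivAt (fun r : ℝ => η⁻¹ * r - 1) (η⁻¹) r := by
    simpa using ((hasDerivAt_id r).const_mul η⁻¹).sub_const 1
  exact ((hχ.hasDerivAt (η⁻¹ * r - 1)).comp r h1).deriv

theorem deriv_cutOut_nonpos (hχ : IsSmoothStep χ) (v : ℝ) : deriv (cutOut χ R) v ≤ 0 := by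
  have h1 : HasDerivAt (fun v : ℝ => v - R) 1 v := (hasDerivAt_id v).sub_const R
  have h2 : deriv (cutOut χ R) v = -(deriv χ (v - R) * 1) :=
    (((hχ.hasDerivAt (v - R)).comp v h1).const_sub 1).deriv
  rw [h2]
  linarith [hχ.deriv_nonneg (v - R)]

theorem cutIn_nonneg (hχ : IsSmoothStep χ) (r : ℝ) : 0 ≤ cutIn χ η r := hχ.nonneg _

theorem cutIn_le_one (hχ : IsSmoothStep χ) (r : ℝ) : cutIn χ η r ≤ 1 := hχ.le_one _

theorem cutOut_nonneg (hχ : IsSmoothStep χ) (v : ℝ) : 0 ≤ cutOut χ R v :=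
  sub_nonneg.mpr (hχ.le_one _)

theorem cutOut_le_one (hχ : IsSmoothStep χ) (v : ℝ) : cutOut χ R v ≤ 1 :=
  sub_le_self _ (hχ.nonneg _)

theorem cutIn_eq_zero (hχ : IsSmoothStep χ) (hη : 0 < η) {r : ℝ} (hr : r ≤ η) :
    cutIn χ η r = 0 := by
  refine hχ.eq_zero _ ?_
  have := mul_le_mul_of_nonneg_left hr (inv_nonneg.mpr hη.le)
  rw [inv_mul_cancel₀ hη.ne'] at this
  linarith

theorem cutOut_eq_zero (hχ : IsSmoothStep χ) {v : ℝ} (hv : R + 1 ≤ v) : cutOut χ R v = 0 := by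
  rw [cutOut, hχ.eq_one _ (by linarith), sub_self]

end Cutoffs

theorem currentT_eq (G : TwoForm) {p : Spacetime} (hp : p.2 ≠ 0) (P Q : ℝ) :
    currentT P Q (fun i => omega p i) (fun i => el G i) (fun i => mg G i) =
      (P * alphaSq G p + Q * alphaBarSq G p + (P + Q) * (rho G p ^ 2 + sigma G p ^ 2)) / 2 := by
  rw [currentT, alphaSq_eq G hp, alphaBarSq_eq G hp]
  ring

/-- Passing from an integral identity with a signed integrand to an inequality between
integrals of nonnegative functions. -/
theorem ofReal_add_lintegral_le {X : Type*} [MeasurableSpace X] {μ : Measure X} {D a b : X → ℝ}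
    {v₁ v₀ : ℝ} (hD : Integrable D μ) (hv : v₁ = v₀ + ∫ x, D x ∂μ) (h₁ : 0 ≤ v₁) (h₀ : 0 ≤ v₀)
    (ha : ∀ᵐ x ∂μ, 0 ≤ a x) (hb : ∀ᵐ x ∂μ, 0 ≤ b x) (hbm : AEMeasurable b μ)
    (hab : ∀ᵐ x ∂μ, D x ≤ -a x + b x) :
    ENNReal.ofReal v₁ + ∫⁻ x, ENNReal.ofReal (a x) ∂μ ≤
      ENNReal.ofReal v₀ + ∫⁻ x, ENNReal.ofReal (b x) ∂μ := by
  -- If the upper bound is infinite nothing is to be shown; otherwise `b` is integrable, and so is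
  -- the nonnegative difference `b - D ≥ a`.
  by_cases hfin : ∫⁻ x, ENNReal.ofReal (b x) ∂μ = ⊤
  · rw [hfin]; simp
  have hbi : Integrable b μ := by
    refine ⟨hbm.aestronglyMeasurable, ?_⟩
    rw [hasFiniteIntegral_iff_ofReal hb]
    exact lt_top_iff_ne_top.mpr hfin
  have hbD : ∀ᵐ x ∂μ, 0 ≤ b x - D x := by
    filter_upwards [ha, hab] with x h1 h2 using by linarith
  have h1 : ∫⁻ x, ENNReal.ofReal (a x) ∂μ ≤ ENNReal.ofReal (∫ x, (b x - D x) ∂μ) := by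
    rw [ofReal_integral_eq_lintegral_ofReal (f := fun x => b x - D x) (hbi.sub hD) hbD]
    refine lintegral_mono_ae ?_
    filter_upwards [hab] with x hx using ENNReal.ofReal_le_ofReal (by linarith)
  have h2 : 0 ≤ ∫ x, (b x - D x) ∂μ := integral_nonneg_of_ae hbD
  calc _ ≤ ENNReal.ofReal v₁ + ENNReal.ofReal (∫ x, (b x - D x) ∂μ) := by gcongr
    _ = ENNReal.ofReal v₀ + ENNReal.ofReal (∫ x, b x ∂μ) := by
        rw [← ENNReal.ofReal_add h₁ h2, ← ENNReal.ofReal_add h₀ (integral_nonneg_of_ae hb),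
          integral_sub hbi hD, hv]
        congr 1; ring
    _ = _ := by rw [ofReal_integral_eq_lintegral_ofReal hbi hb]

/-- The product of the three cutoffs. -/
def cutoff (κ ζ θ : ℝ → ℝ) (p : Spacetime) : ℝ := κ (rr p) * (ζ (uu p) * θ (vv p))

/-- The error density produced by excising the axis. -/
def axisError (κ ζ θ : ℝ → ℝ) (s γ ε : ℝ) (G : Spacetime → TwoForm) (p : Spacetime) : ℝ :=
  deriv κ (rr p) * (ζ (uu p) * θ (vv p) * genW γ ε p *
    (jap (uu p) ^ (2 * s) * alphaBarSq (G p) p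
      + jap (vv p) ^ (2 * s) * (rho (G p) p ^ 2 + sigma (G p) p ^ 2)))

section Inequality

variable {χ : ℝ → ℝ} {s γ ε K T : ℝ} {F : Spacetime → TwoForm} {J : Spacetime → OneForm}

theorem weight_le_genW (hK : WeightBounds χ γ ε K) {p : Spacetime} (hp : 0 ≤ p.1) :
    weight χ γ p ≤ genW γ ε p ∧ genW γ ε p ≤ K * weight χ γ p := by
  obtain ⟨k1, k2, -⟩ := hK (uu p) (vv p) _ (genW γ ε p) _ (abs_uu_le hp) rfl rfl rfl
  have : weight χ γ p = χ (-uu p) * jap (uu p) ^ (2 * γ) + (1 - χ (-uu p)) := by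
    rw [uu, neg_sub]; rfl
  rw [this]
  exact ⟨k1, k2⟩

/-- The time component is half of `W (τ₊^{2s} |α|² + τ₋^{2s} |αbar|² + (τ₊^{2s} + τ₋^{2s}) (ρ² +
σ²))` times the cutoffs. The bounds follow from `τ₋ ≤ τ₊` and the comparability of `W` with `w_γ`.
-/
theorem energyCurrent_zero_bounds (hχ : IsSmoothStep χ) (hs : 0 ≤ s) (hK : WeightBounds χ γ ε K)
    {κ ζ θ : ℝ → ℝ} (hκ0 : ∀ y, 0 ≤ κ y) (hζ0 : ∀ y, 0 ≤ ζ y) (hθ0 : ∀ y, 0 ≤ θ y)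
    {p : Spacetime} (hp : 0 ≤ p.1) (hp0 : p.2 ≠ 0) (G : Spacetime → TwoForm) :
    cutoff κ ζ θ p * (fixedTimeDensity χ s γ G p / 2) ≤ energyCurrent κ ζ θ s γ ε G 0 p ∧
    energyCurrent κ ζ θ s γ ε G 0 p ≤ cutoff κ ζ θ p * (K * fixedTimeDensity χ s γ G p) := by
  obtain ⟨k1, k2⟩ := weight_le_genW hK hp
  have hw := weight_nonneg hχ γ p
  have hα := alphaSq_nonneg (G p) p
  have hβ := alphaBarSq_nonneg (G p) p
  have hR : 0 ≤ rho (G p) p ^ 2 + sigma (G p) p ^ 2 := by positivity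
  have tm := jap_pos (uu p)
  have tp := jap_pos (vv p)
  have hle : jap (uu p) ^ (2 * s) ≤ jap (vv p) ^ (2 * s) :=
    Real.rpow_le_rpow tm.le (jap_le_jap ((abs_uu_le hp).trans (le_abs_self _))) (by linarith)
  set fu := jap (uu p) ^ (2 * s) with hfu
  set fv := jap (vv p) ^ (2 * s) with hfv
  have hfu0 : 0 ≤ fu := by positivity
  have hfv0 : 0 ≤ fv := by positivity
  have hf : fixedTimeDensity χ s γ G p = (fv * alphaSq (G p) p + fu * alphaBarSq (G p) p
    + fv * (rho (G p) p ^ 2 + sigma (G p) p ^ 2)) * weight χ γ p := rfl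
  have hV : energyCurrent κ ζ θ s γ ε G 0 p = cutoff κ ζ θ p * (genW γ ε p *
      ((fv * alphaSq (G p) p + fu * alphaBarSq (G p) p
        + (fv + fu) * (rho (G p) p ^ 2 + sigma (G p) p ^ 2)) / 2)) := by
    change currentT _ _ _ _ _ = _
    rw [currentT_eq _ hp0]
    simp only [mult, cutoff]
    ring
  have hc : 0 ≤ cutoff κ ζ θ p := mul_nonneg (hκ0 _) (mul_nonneg (hζ0 _) (hθ0 _))
  rw [hV, hf]
  have hfR := mul_le_mul_of_nonneg_right hle hR
  have g1 : 0 ≤ fu * (rho (G p) p ^ 2 + sigma (G p) p ^ 2) := by positivity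
  have g2 : 0 ≤ fv * alphaSq (G p) p := by positivity
  have g3 : 0 ≤ fu * alphaBarSq (G p) p := by positivity
  have g4 : 0 ≤ fv * (rho (G p) p ^ 2 + sigma (G p) p ^ 2) := by positivity
  constructor
  · refine mul_le_mul_of_nonneg_left ?_ hc
    rw [mul_comm _ (weight χ γ p), mul_div_assoc]
    exact mul_le_mul k1 (by linarith) (by positivity) (hw.trans k1)
  · refine mul_le_mul_of_nonneg_left ?_ hc
    rw [mul_comm _ (weight χ γ p), ← mul_assoc]
    exact mul_le_mul k2 (by linarith) (by positivity) (hw.trans k1 |>.trans k2)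

/-- Off the axis everything is a product of `C¹` functions. On the axis the frame is singular, but
there the radial cutoff makes the current vanish identically nearby. -/
theorem contDiffAt_energyCurrent (hχ : IsSmoothStep χ) (hF : ∀ p ∈ slab T, ContDiffAt ℝ 1 F p)
    (h : MaxwellOn F J (slab T)) {κ ζ θ : ℝ → ℝ} (hκ : ContDiff ℝ 1 κ) (hζ : ContDiff ℝ 1 ζ)
    (hθ : ContDiff ℝ 1 θ) {η : ℝ} (hη : 0 < η) (hκη : ∀ r, r < η → κ r = 0) (a : Fin 4)
    {p : Spacetime} (hp : p ∈ slab T) :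
    ContDiffAt ℝ 1 (energyCurrent κ ζ θ s γ ε (remainder χ F J) a) p := by
  by_cases hp0 : p.2 = 0
  · have hev : ∀ᶠ y : Spacetime in nhds p, ‖y.2‖ < η :=
      continuous_snd.norm.continuousAt.eventually_lt_const (by simpa [hp0] using hη)
    have : energyCurrent κ ζ θ s γ ε (remainder χ F J) a =ᶠ[nhds p] fun _ => 0 := by
      filter_upwards [hev] with y hy
      have hz : ∀ f : Spacetime → ℝ, mult κ ζ θ γ ε f y = 0 := fun f => by
        rw [mult, show κ (rr y) = 0 from hκη _ hy, zero_mul]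
      refine Fin.cases ?_ (fun i => ?_) a
      · simp [energyCurrent, currentT, hz]
      · simp [energyCurrent, currentX, hz]
    exact contDiffAt_const.congr_of_eventuallyEq this
  · have hv := vv_nonneg hp.1
    obtain ⟨de, dm, -⟩ := maxwell_remainder hχ hF h hp hp0 rfl rfl rfl
    have dw := fun i => contDiffAt_omega hp0 i
    have hfv : ContDiffAt ℝ 1 (fun y => jap (vv y) ^ (2 * s)) p :=
      (contDiff_jap_rpow (2 * s)).contDiffAt.comp p (contDiffAt_vv hp0)
    have hfu : ContDiffAt ℝ 1 (fun y => jap (uu y) ^ (2 * s)) p :=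
      (contDiff_jap_rpow (2 * s)).contDiffAt.comp p (contDiffAt_uu hp0)
    have dP := contDiffAt_mult (γ := γ) (ε := ε) hκ hζ hθ hp0 hv hfv
    have dQ := contDiffAt_mult (γ := γ) (ε := ε) hκ hζ hθ hp0 hv hfu
    have dE := (((((de 0).mul (de 0)).add ((de 1).mul (de 1))).add ((de 2).mul (de 2))).add
      ((((dm 0).mul (dm 0)).add ((dm 1).mul (dm 1))).add ((dm 2).mul (dm 2)))).div_const 2
    refine Fin.cases ?_ (fun i => ?_) a
    · exact ((dP.add dQ).mul dE).add ((dP.sub dQ).mul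
        ((((de 0).mul (((dw 1).mul (dm 2)).sub ((dw 2).mul (dm 1)))).add
          ((de 1).mul (((dw 2).mul (dm 0)).sub ((dw 0).mul (dm 2))))).add
          ((de 2).mul (((dw 0).mul (dm 1)).sub ((dw 1).mul (dm 0))))))
    · exact ((dP.add dQ).mul (((de (i + 2)).mul (dm (i + 1))).sub
        ((de (i + 1)).mul (dm (i + 2))))).add ((dP.sub dQ).mul
        ((((dw i).mul dE).sub ((de i).mul
          ((((de 0).mul (dw 0)).add ((de 1).mul (dw 1))).add ((de 2).mul (dw 2))))).sub
          ((dm i).mul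
          ((((dm 0).mul (dw 0)).add ((dm 1).mul (dw 1))).add ((dm 2).mul (dw 2))))))

theorem continuousOn_genW : ContinuousOn (genW γ ε) {p | 0 ≤ p.1} := by
  have hm : ContinuousOn (fun p => mOut ε (vv p)) {p : Spacetime | 0 ≤ p.1} := fun p hp =>
    ((contDiffAt_mOut ε (by linarith [vv_nonneg hp])).continuousAt.comp
      continuous_vv.continuousAt).continuousWithinAt
  exact ((contDiff_wIn γ ε).continuous.comp continuous_uu).continuousOn.add
    (((contDiff_kIn γ ε).continuous.comp continuous_uu).continuousOn.mul hm)

theorem genW_nonneg (hχ : IsSmoothStep χ) (hK : WeightBounds χ γ ε K) {p : Spacetime}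
    (hp : 0 ≤ p.1) : 0 ≤ genW γ ε p :=
  (weight_nonneg hχ γ p).trans (weight_le_genW hK hp).1

/-- The energy inequality with cutoffs. -/
theorem energy_inequality_cutoff (hχ : IsSmoothStep χ) (hγ : 0 < γ) (hε : 0 < ε)
    (hεs : ε ≤ s - 1 / 2) (hs1 : s ≤ 1) (hK0 : 0 < K) (hK : WeightBounds χ γ ε K) (hT : 0 ≤ T)
    (hF : ∀ p ∈ slab T, ContDiffAt ℝ 1 F p) (h : MaxwellOn F J (slab T))
    {κ ζ θ : ℝ → ℝ} (hκ : ContDiff ℝ 1 κ) (hζ : ContDiff ℝ 1 ζ) (hθ : ContDiff ℝ 1 θ)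
    (hκ0 : ∀ y, 0 ≤ κ y) (hζ0 : ∀ y, 0 ≤ ζ y) (hθ0 : ∀ y, 0 ≤ θ y)
    (hκ1 : ∀ y, κ y ≤ 1) (hζ1 : ∀ y, ζ y ≤ 1) (hθ1 : ∀ y, θ y ≤ 1)
    (hκ' : ∀ y, 0 ≤ deriv κ y) (hζ' : ∀ y, deriv ζ y ≤ 0) (hθ' : ∀ y, deriv θ y ≤ 0)
    {η R : ℝ} (hη : 0 < η) (hκη : ∀ r, r < η → κ r = 0) (hθR : ∀ v, R < v → θ v = 0)
    {G : Spacetime → TwoForm} (hG : G = remainder χ F J) :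
    (∫⁻ x : Space, ENNReal.ofReal (cutoff κ ζ θ (T, x) * (fixedTimeDensity χ s γ G (T, x) / 2)))
      + ∫⁻ p in slab T, ENNReal.ofReal
          (1 / (2 * K) * (cutoff κ ζ θ p * bulkDensity χ s γ ε G p)
          + κ (rr p) * (-deriv ζ (uu p) * θ (vv p)) * coneDensity χ s γ G p) ≤
    ((∫⁻ x : Space, ENNReal.ofReal (K * fixedTimeDensity χ s γ G (0, x)))
      + ∫⁻ p in slab T, ENNReal.ofReal
          (2 * K ^ 2 * currentDensity χ s γ ε (fun p => J p - chargeCurrent χ (charge J) p) p))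
      + ∫⁻ p in slab T, ENNReal.ofReal (axisError κ ζ θ s γ ε G p) := by
  set V := energyCurrent κ ζ θ s γ ε G with hV
  have hs0 : 0 ≤ s := by linarith
  have hVc : ∀ a, ∀ p ∈ slab T, ContDiffAt ℝ 1 (V a) p := fun a p hp => by
    rw [hV, hG]
    exact contDiffAt_energyCurrent hχ hF h hκ hζ hθ hη hκη a hp
  -- The cutoff acts in `v` while the divergence theorem needs support bounded in `r`; for `t > -1`,
  -- `r > R + 1` forces `v > R`.
  have hVR : ∀ a, ∀ p : Spacetime, -1 < p.1 → R + 1 < ‖p.2‖ → V a p = 0 := by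
    intro a p hp hp2
    have hz : ∀ f : Spacetime → ℝ, mult κ ζ θ γ ε f p = 0 := fun f => by
      rw [mult, hθR (vv p) (by simp only [vv]; linarith)]; ring
    refine Fin.cases ?_ (fun i => ?_) a
    · simp [hV, energyCurrent, currentT, hz]
    · simp [hV, energyCurrent, currentX, hz]
  obtain ⟨hDi, hDe⟩ := slab_divergence hT hVc hVR
  have hslice : ∀ t ∈ Icc 0 T, Integrable (fun x : Space => V 0 (t, x)) := by
    intro t ht
    have hc : Continuous fun x : Space => V 0 (t, x) := by
      rw [continuous_iff_continuousAt]
      intro x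
      exact ((hVc 0 (t, x) ht).continuousAt).comp (f := fun x : Space => (t, x)) (by fun_prop)
    refine hc.integrable_of_hasCompactSupport
      (HasCompactSupport.intro (isCompact_closedBall (0 : Space) (R + 1)) fun x hx => ?_)
    exact hVR 0 (t, x) (by linarith [ht.1]) (by simpa using hx)
  have hb0 := fun t (ht : t ∈ Icc 0 T) (x : Space) (hx : x ≠ 0) =>
    energyCurrent_zero_bounds (p := (t, x)) hχ hs0 hK hκ0 hζ0 hθ0 ht.1 hx G
  have hae : ∀ᵐ x : Space, x ≠ 0 := by simp [ae_iff]
  have hc0 : ∀ p, 0 ≤ cutoff κ ζ θ p := fun p => mul_nonneg (hκ0 _) (mul_nonneg (hζ0 _) (hθ0 _))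
  have hc1 : ∀ p, cutoff κ ζ θ p ≤ 1 := fun p =>
    mul_le_one₀ (hκ1 _) (mul_nonneg (hζ0 _) (hθ0 _)) (mul_le_one₀ (hζ1 _) (hθ0 _) (hθ1 _))
  have hfix := fixedTimeDensity_nonneg hχ s γ G
  have hVnn : ∀ t ∈ Icc 0 T, ∀ᵐ x : Space, 0 ≤ V 0 (t, x) := by
    intro t ht
    filter_upwards [hae] with x hx
    refine le_trans ?_ (hb0 t ht x hx).1
    have := hfix (t, x)
    have := hc0 (t, x)
    positivity
  set jj := fun p => J p - chargeCurrent χ (charge J) p with hjj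
  set b₁ := fun p => 2 * K ^ 2 * (cutoff κ ζ θ p * currentDensity χ s γ ε jj p) with hb₁
  have hcut : ContinuousOn (cutoff κ ζ θ) (slabOff T) :=
    ((hκ.continuous.comp continuous_rr).mul
      ((hζ.continuous.comp continuous_uu).mul (hθ.continuous.comp continuous_vv))).continuousOn
  have hb₁c : ContinuousOn b₁ (slabOff T) := continuousOn_const.mul (hcut.mul
    (continuousOn_currentDensity hχ (fun a => continuousOn_modifiedCurrent hχ hF h _ a) s γ ε))
  have hgen : ContinuousOn (genW γ ε) (slabOff T) := continuousOn_genW.mono fun p hp => hp.1.1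
  have hec : ContinuousOn (axisError κ ζ θ s γ ε G) (slabOff T) := by
    obtain ⟨-, cb, cr, cs⟩ := continuousOn_components hχ hF h
    rw [← hG] at cb cr cs
    exact ((hκ.continuous_deriv le_rfl).comp continuous_rr).continuousOn.mul
      (((((hζ.continuous.comp continuous_uu).mul
        (hθ.continuous.comp continuous_vv)).continuousOn.mul hgen)).mul
        (((continuous_tauMinus_rpow (2 * s)).continuousOn.mul cb).add
          ((continuous_tauPlus_rpow (2 * s)).continuousOn.mul ((cr.pow 2).add (cs.pow 2)))))
  have he0 : ∀ p ∈ slab T, 0 ≤ axisError κ ζ θ s γ ε G p := by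
    intro p hp
    have h1 := alphaBarSq_nonneg (G p) p
    have h2 := jap_pos (uu p)
    have h3 := jap_pos (vv p)
    exact mul_nonneg (hκ' _) (mul_nonneg (mul_nonneg (mul_nonneg (hζ0 _) (hθ0 _))
      (genW_nonneg hχ hK hp.1)) (by positivity))
  have hb₁0 : ∀ p, 0 ≤ b₁ p := fun p => mul_nonneg (by positivity)
    (mul_nonneg (hc0 p) (currentDensity_nonneg hχ s γ ε jj p))
  have main := ofReal_add_lintegral_le (μ := volume.restrict (slab T))
    (a := fun p => 1 / (2 * K) * (cutoff κ ζ θ p * bulkDensity χ s γ ε G p)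
          + κ (rr p) * (-deriv ζ (uu p) * θ (vv p)) * coneDensity χ s γ G p)
    (b := fun p => b₁ p + axisError κ ζ θ s γ ε G p)
    hDi hDe (integral_nonneg_of_ae (hVnn T ⟨hT, le_rfl⟩))
    (integral_nonneg_of_ae (hVnn 0 ⟨le_rfl, hT⟩)) ?_ ?_ ?_ ?_
  · rw [ofReal_integral_eq_lintegral_ofReal (hslice T ⟨hT, le_rfl⟩) (hVnn T ⟨hT, le_rfl⟩),
      ofReal_integral_eq_lintegral_ofReal (hslice 0 ⟨le_rfl, hT⟩) (hVnn 0 ⟨le_rfl, hT⟩)] at main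
    have e1 : ∫⁻ x : Space, ENNReal.ofReal
        (cutoff κ ζ θ (T, x) * (fixedTimeDensity χ s γ G (T, x) / 2)) ≤
        ∫⁻ x : Space, ENNReal.ofReal (V 0 (T, x)) := by
      refine lintegral_mono_ae ?_
      filter_upwards [hae] with x hx using
        ENNReal.ofReal_le_ofReal (hb0 T ⟨hT, le_rfl⟩ x hx).1
    have e2 : ∫⁻ x : Space, ENNReal.ofReal (V 0 (0, x)) ≤
        ∫⁻ x : Space, ENNReal.ofReal (K * fixedTimeDensity χ s γ G (0, x)) := by
      refine lintegral_mono_ae ?_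
      filter_upwards [hae] with x hx
      refine ENNReal.ofReal_le_ofReal ((hb0 0 ⟨le_rfl, hT⟩ x hx).2.trans ?_)
      exact mul_le_of_le_one_left (mul_nonneg hK0.le (hfix _)) (hc1 _)
    have e3 : ∫⁻ p in slab T, ENNReal.ofReal (b₁ p + axisError κ ζ θ s γ ε G p) ≤
        (∫⁻ p in slab T, ENNReal.ofReal (2 * K ^ 2 * currentDensity χ s γ ε jj p)) +
        ∫⁻ p in slab T, ENNReal.ofReal (axisError κ ζ θ s γ ε G p) := by
      rw [← lintegral_add_right' _ (aemeasurable_slab hec).ennreal_ofReal]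
      refine lintegral_mono fun p => ENNReal.ofReal_add_le.trans ?_
      gcongr
      exact mul_le_mul_of_nonneg_left
        (mul_le_of_le_one_left (currentDensity_nonneg hχ s γ ε jj p) (hc1 p)) (by positivity)
    rw [add_assoc]
    exact (add_le_add_left e1 _).trans (main.trans (add_le_add e2 e3))
  · refine Filter.Eventually.of_forall fun p => ?_
    have h1 := bulkDensity_nonneg hχ s γ ε G p
    have h2 := coneDensity_nonneg hχ s γ G p
    have h3 := hc0 p
    have h4 : 0 ≤ κ (rr p) * (-deriv ζ (uu p) * θ (vv p)) :=
      mul_nonneg (hκ0 _) (mul_nonneg (by linarith [hζ' (uu p)]) (hθ0 _))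
    positivity
  · filter_upwards [ae_snd_ne_zero T] with p hp using add_nonneg (hb₁0 p) (he0 p hp.1)
  · exact aemeasurable_slab (hb₁c.add hec)
  · filter_upwards [ae_snd_ne_zero T] with p hp
    refine (energy_divergence_le hχ hγ hε hεs hs1 hK0 hK hF h hκ hζ hθ hκ0 hζ0 hθ0 hκ' hζ' hθ'
      hp.1 hp.2 hG hV).trans (le_of_eq ?_)
    simp only [hb₁, cutoff, axisError, hjj]
    ring

/-- The error from excising the axis is quadratic in the radius of the excised ball. -/
theorem exists_axisError_le (hχ : IsSmoothStep χ) (hK : WeightBounds χ γ ε K)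
    (hF : ∀ p ∈ slab T, ContDiffAt ℝ 1 F p) :
    ∃ C : ℝ, 0 ≤ C ∧ ∀ η : ℝ, 0 < η → η ≤ 1 / 2 → ∀ ζ θ : ℝ → ℝ, (∀ y, 0 ≤ ζ y) → (∀ y, 0 ≤ θ y) →
      (∀ y, ζ y ≤ 1) → (∀ y, θ y ≤ 1) →
      ∫⁻ p in slab T, ENNReal.ofReal
        (axisError (cutIn χ η) ζ θ s γ ε (remainder χ F J) p) ≤ ENNReal.ofReal (C * η ^ 2) := by
  obtain ⟨M, hM0, hM⟩ := hχ.exists_deriv_le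
  have happ : ∀ v w : Spacetime, ContinuousOn (fun y => F y ![v, w]) (slab T) := fun v w p hp =>
    ((ContinuousAlternatingMap.apply ℝ Spacetime ℝ ![v, w]).contDiff.contDiffAt.comp p
      (hF p hp)).continuousAt.continuousWithinAt
  have ce : ∀ i, ContinuousOn (fun y => el (F y) i) (slab T) := fun i => happ _ _
  have cm : ∀ i, ContinuousOn (fun y => mg (F y) i) (slab T) := by
    intro i
    unfold mg hodge
    exact continuousOn_const.mul (continuousOn_finsetSum _ fun c _ =>
      continuousOn_finsetSum _ fun d _ => continuousOn_const.mul (happ _ _))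
  set S := fun p => el (F p) 0 ^ 2 + el (F p) 1 ^ 2 + el (F p) 2 ^ 2
    + (mg (F p) 0 ^ 2 + mg (F p) 1 ^ 2 + mg (F p) 2 ^ 2) with hS
  have cS : ContinuousOn S (slab T) :=
    ((((ce 0).pow 2).add ((ce 1).pow 2)).add ((ce 2).pow 2)).add
      ((((cm 0).pow 2).add ((cm 1).pow 2)).add ((cm 2).pow 2))
  set B := fun p => genW γ ε p * (jap (uu p) ^ (2 * s) * (2 * S p) + jap (vv p) ^ (2 * s) * S p)
    with hB
  have cB : ContinuousOn B (slab T) :=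
    (continuousOn_genW.mono fun p hp => hp.1).mul
      (((continuous_tauMinus_rpow (2 * s)).continuousOn.mul (continuousOn_const.mul cS)).add
        ((continuous_tauPlus_rpow (2 * s)).continuousOn.mul cS))
  have hKc : IsCompact (Icc (0 : ℝ) T ×ˢ Metric.closedBall (0 : Space) 1) :=
    isCompact_Icc.prod (isCompact_closedBall 0 1)
  have hsub : Icc (0 : ℝ) T ×ˢ Metric.closedBall (0 : Space) 1 ⊆ slab T := fun p hp => hp.1
  obtain ⟨C, hC⟩ := hKc.exists_bound_of_continuousOn (cB.mono hsub)
  set C' := max C 0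
  set vol := (volume : Measure Space).real (Metric.ball 0 1)
  -- The slope of the cutoff is at most `M / η`, it lives in a ball of volume `(2η)³ vol`, and `C'`
  -- bounds the energy factor on `r ≤ 1`. The product over the time interval is of order `η²`.
  refine ⟨M * C' * (8 * vol) * max T 0, by positivity, fun η hη hη2 ζ θ hζ0 hθ0 hζ1 hθ1 => ?_⟩
  have hpt : ∀ p ∈ slabOff T, axisError (cutIn χ η) ζ θ s γ ε (remainder χ F J) p ≤
      ((univ : Set ℝ) ×ˢ Metric.closedBall (0 : Space) (2 * η)).indicator
        (fun _ => M * η⁻¹ * C') p := by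
    intro p hp
    have hr0 := norm_nonneg p.2
    by_cases hr : ‖p.2‖ ≤ 2 * η
    · have hmem : p ∈ (univ : Set ℝ) ×ˢ Metric.closedBall (0 : Space) (2 * η) :=
        ⟨mem_univ _, by simpa using hr⟩
      rw [indicator_of_mem hmem]
      have hp1 : p ∈ Icc (0 : ℝ) T ×ˢ Metric.closedBall (0 : Space) 1 :=
        ⟨hp.1, by simp only [Metric.mem_closedBall, dist_zero_right]; linarith⟩
      have hBp : B p ≤ C' := (le_abs_self _).trans ((hC p hp1).trans (le_max_left _ _))
      -- Near the axis, for `t ≥ 0`, the pure-charge field is switched off, so the remainder is the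
      -- field `F` itself, which is bounded there.
      have hG : remainder χ F J p = F p := by
        have : χ (‖p.2‖ - p.1 - 2) = 0 := hχ.eq_zero _ (by linarith [hp.1.1])
        simp [remainder, chargeField, this]
      have hα := alphaSq_nonneg (F p) p
      have hβ := alphaBarSq_nonneg (F p) p
      have hR : 0 ≤ rho (F p) p ^ 2 + sigma (F p) p ^ 2 := by positivity
      have e1 := alphaSq_eq (F p) hp.2
      have e2 := alphaBarSq_eq (F p) hp.2
      have g1 : alphaBarSq (F p) p ≤ 2 * S p := by simp only [hS]; linarith
      have g2 : rho (F p) p ^ 2 + sigma (F p) p ^ 2 ≤ S p := by simp only [hS]; linarith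
      have h2 := jap_pos (uu p)
      have h3 := jap_pos (vv p)
      have hW := genW_nonneg hχ hK hp.1.1
      have hS0 : 0 ≤ S p := by positivity
      have hB0 : 0 ≤ B p := by positivity
      have hinner : ζ (uu p) * θ (vv p) * genW γ ε p *
          (jap (uu p) ^ (2 * s) * alphaBarSq (F p) p
          + jap (vv p) ^ (2 * s) * (rho (F p) p ^ 2 + sigma (F p) p ^ 2)) ≤ B p := by
        rw [mul_assoc]
        have hb : genW γ ε p * (jap (uu p) ^ (2 * s) * alphaBarSq (F p) p
          + jap (vv p) ^ (2 * s) * (rho (F p) p ^ 2 + sigma (F p) p ^ 2)) ≤ B p := by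
          simp only [hB]
          gcongr
        refine le_trans (mul_le_of_le_one_left (by positivity) ?_) hb
        exact mul_le_one₀ (hζ1 _) (hθ0 _) (hθ1 _)
      rw [axisError, hG, deriv_cutIn hχ]
      have hd0 := hχ.deriv_nonneg (η⁻¹ * rr p - 1)
      calc _ ≤ deriv χ (η⁻¹ * rr p - 1) * η⁻¹ * C' :=
            mul_le_mul_of_nonneg_left (hinner.trans hBp) (by positivity)
        _ ≤ _ := by gcongr; exact hM _
    · rw [indicator_of_notMem (by simp only [mem_prod, Metric.mem_closedBall, dist_zero_right]; tauto)]
      have : deriv (cutIn χ η) (rr p) = 0 := by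
        rw [deriv_cutIn hχ, hχ.deriv_eq_zero (Or.inr ?_), zero_mul]
        have h1 := mul_lt_mul_of_pos_left (not_le.mp hr) (inv_pos.mpr hη)
        have h2 : η⁻¹ * (2 * η) = 2 := by field_simp
        rw [h2] at h1
        change 1 < η⁻¹ * ‖p.2‖ - 1
        linarith
      rw [axisError, this, zero_mul]
  have hms : MeasurableSet ((univ : Set ℝ) ×ˢ Metric.closedBall (0 : Space) (2 * η)) :=
    MeasurableSet.univ.prod Metric.isClosed_closedBall.measurableSet
  calc _ ≤ ∫⁻ p in slab T, ((univ : Set ℝ) ×ˢ Metric.closedBall (0 : Space) (2 * η)).indicator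
        (fun _ => ENNReal.ofReal (M * η⁻¹ * C')) p := by
        refine lintegral_mono_ae ?_
        filter_upwards [ae_snd_ne_zero T] with p hp
        refine (ENNReal.ofReal_le_ofReal (hpt p hp)).trans (le_of_eq ?_)
        simp only [indicator]
        split_ifs <;> simp
    _ = ENNReal.ofReal (M * η⁻¹ * C') *
        (ENNReal.ofReal (max T 0) * (ENNReal.ofReal ((2 * η) ^ 3) * ENNReal.ofReal vol)) := by
        rw [lintegral_indicator_const hms, volume_restrict_slab, Measure.prod_prod,
          Measure.restrict_apply_univ, Real.volume_Icc, Measure.addHaar_closedBall _ _ (by positivity)]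
        simp [vol, ENNReal.ofReal_toReal, Measure.real]
    _ = ENNReal.ofReal (M * C' * (8 * vol) * max T 0 * η ^ 2) := by
        rw [← ENNReal.ofReal_mul (by positivity), ← ENNReal.ofReal_mul (by positivity),
          ← ENNReal.ofReal_mul (by positivity)]
        congr 1
        field_simp
        ring

end Inequality

/-! ### Removing the cutoffs -/

open Filter Topology in
/-- A form of Fatou's lemma for eventually constant sequences. -/
theorem lintegral_le_of_eventuallyEq {X : Type*} [MeasurableSpace X] {μ : Measure X}
    {f : X → ℝ≥0∞} {g : ℕ → X → ℝ≥0∞} {e : ℕ → ℝ≥0∞} {M : ℝ≥0∞}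
    (hg : ∀ n, AEMeasurable (g n) μ) (hfg : ∀ᵐ x ∂μ, ∀ᶠ n in atTop, g n x = f x)
    (he : Tendsto e atTop (𝓝 0)) (hle : ∀ n, ∫⁻ x, g n x ∂μ ≤ M + e n) : ∫⁻ x, f x ∂μ ≤ M := by
  have h1 : ∫⁻ x, f x ∂μ = ∫⁻ x, liminf (fun n => g n x) atTop ∂μ := by
    refine lintegral_congr_ae ?_
    filter_upwards [hfg] with x hx
    exact (Tendsto.liminf_eq (tendsto_const_nhds.congr' (hx.mono fun n hn => hn.symm))).symm
  have h2 : Tendsto (fun n => M + e n) atTop (𝓝 M) := by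
    simpa using (tendsto_const_nhds (x := M)).add he
  rw [h1, ← h2.liminf_eq]
  exact (lintegral_liminf_le' hg).trans (liminf_le_liminf (Eventually.of_forall hle))

/-- The bound for the energy obtained from the energy inequality: initial energy and current. -/
def energyBound (χ : ℝ → ℝ) (s γ ε K T : ℝ) (F : Spacetime → TwoForm)
    (J : Spacetime → OneForm) : ℝ≥0∞ :=
  (∫⁻ x : Space, ENNReal.ofReal (K * fixedTimeDensity χ s γ (remainder χ F J) (0, x)))
    + ∫⁻ p in slab T, ENNReal.ofReal
      (2 * K ^ 2 * currentDensity χ s γ ε (fun p => J p - chargeCurrent χ (charge J) p) p)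

theorem energyBound_mono {χ : ℝ → ℝ} {s γ ε K T T' : ℝ} {F : Spacetime → TwoForm}
    {J : Spacetime → OneForm} (h : T ≤ T') :
    energyBound χ s γ ε K T F J ≤ energyBound χ s γ ε K T' F J := by
  refine add_le_add le_rfl (lintegral_mono_set fun p hp => ⟨hp.1, hp.2.trans h⟩)

section Limit

variable {χ : ℝ → ℝ} {s γ ε K T : ℝ} {F : Spacetime → TwoForm} {J : Spacetime → OneForm}

-- Limit of the inequality with cutoffs as the excised ball shrinks and the outer cutoff recedes. At
-- each point off the axis the cutoffs are eventually `1`, so Fatou's lemma removes them, while the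
-- axis error tends to zero. The `u`-cutoff `ζ` stays free: it is constant for the energies and a
-- steep step for the cones.
open Filter Topology in
theorem energy_inequality (hχ : IsSmoothStep χ) (hγ : 0 < γ) (hε : 0 < ε)
    (hεs : ε ≤ s - 1 / 2) (hs1 : s ≤ 1) (hK0 : 0 < K) (hK : WeightBounds χ γ ε K) (hT : 0 ≤ T)
    (hF : ∀ p ∈ slab T, ContDiffAt ℝ 1 F p) (h : MaxwellOn F J (slab T))
    {ζ : ℝ → ℝ} (hζ : ContDiff ℝ 1 ζ) (hζ0 : ∀ y, 0 ≤ ζ y) (hζ1 : ∀ y, ζ y ≤ 1)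
    (hζ' : ∀ y, deriv ζ y ≤ 0) :
    (∫⁻ x : Space, ENNReal.ofReal
      (ζ (uu (T, x)) * (fixedTimeDensity χ s γ (remainder χ F J) (T, x) / 2)) ≤
        energyBound χ s γ ε K T F J) ∧
    (∫⁻ p in slab T, ENNReal.ofReal
      (1 / (2 * K) * (ζ (uu p) * bulkDensity χ s γ ε (remainder χ F J) p)
        + -deriv ζ (uu p) * coneDensity χ s γ (remainder χ F J) p) ≤
        energyBound χ s γ ε K T F J) := by
  set G := remainder χ F J with hG
  obtain ⟨C, hC0, hC⟩ := exists_axisError_le (s := s) (J := J) hχ hK hF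
  -- The shift by `2` keeps `η n ≤ 1/2`, so that the transition region `r ≤ 2η` lies in the unit
  -- ball, as the axis estimate requires.
  set η : ℕ → ℝ := fun n => ((n : ℝ) + 2)⁻¹ with hη
  have hη0 : ∀ n, 0 < η n := fun n => by positivity
  have hη2 : ∀ n, η n ≤ 1 / 2 := fun n => by
    rw [hη, one_div]
    exact inv_anti₀ two_pos (by linarith [n.cast_nonneg (α := ℝ)])
  set κ : ℕ → ℝ → ℝ := fun n => cutIn χ (η n)
  set θ : ℕ → ℝ → ℝ := fun n => cutOut χ n
  have hmain : ∀ n, _ := fun n => energy_inequality_cutoff (κ := κ n) (ζ := ζ) (θ := θ n)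
    hχ hγ hε hεs hs1 hK0 hK hT hF h (contDiff_cutIn hχ) hζ (contDiff_cutOut hχ)
    (cutIn_nonneg hχ) hζ0 (cutOut_nonneg hχ) (cutIn_le_one hχ) hζ1 (cutOut_le_one hχ)
    (fun y => by
      rw [deriv_cutIn hχ]; exact mul_nonneg (hχ.deriv_nonneg _) (inv_nonneg.mpr (hη0 n).le)) hζ'
    (deriv_cutOut_nonpos hχ) (hη0 n) (fun r hr => cutIn_eq_zero hχ (hη0 n) hr.le)
    (R := n + 1) (fun v hv => cutOut_eq_zero hχ hv.le) hG
  have he : ∀ n, ∫⁻ p in slab T, ENNReal.ofReal (axisError (κ n) ζ (θ n) s γ ε G p) ≤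
      ENNReal.ofReal (C * η n ^ 2) := fun n =>
    hC (η n) (hη0 n) (hη2 n) ζ (θ n) hζ0 (cutOut_nonneg hχ) hζ1 (cutOut_le_one hχ)
  have hη_lim : Tendsto η atTop (𝓝 0) :=
    tendsto_inv_atTop_zero.comp (tendsto_atTop_add_const_right _ _ tendsto_natCast_atTop_atTop)
  have he_lim : Tendsto (fun n => ENNReal.ofReal (C * η n ^ 2)) atTop (𝓝 0) := by
    have : Tendsto (fun n => C * η n ^ 2) atTop (𝓝 0) := by
      simpa using (hη_lim.pow 2).const_mul C
    simpa using ENNReal.tendsto_ofReal this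
  have hsum : ∀ n, _ := fun n => (hmain n).trans (add_le_add le_rfl (he n))
  have hκ1 : ∀ p : Spacetime, p.2 ≠ 0 → ∀ᶠ n in atTop, κ n (rr p) = 1 := by
    intro p hp
    have hr : 0 < rr p := norm_pos_iff.mpr hp
    have : Tendsto (fun n : ℕ => ((n : ℝ) + 2) * rr p) atTop atTop :=
      (tendsto_atTop_add_const_right _ _ tendsto_natCast_atTop_atTop).atTop_mul_const hr
    filter_upwards [this.eventually_ge_atTop 2] with n hn
    refine hχ.eq_one _ ?_
    simp only [hη, inv_inv]
    linarith
  have hθ1 : ∀ p : Spacetime, ∀ᶠ n in atTop, θ n (vv p) = 1 := by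
    intro p
    filter_upwards [tendsto_natCast_atTop_atTop.eventually_ge_atTop (vv p)] with n hn
    change 1 - χ (vv p - n) = 1
    rw [hχ.eq_zero _ (by linarith), sub_zero]
  have hae : ∀ᵐ x : Space, x ≠ 0 := by simp [ae_iff]
  have hκc : ∀ n, Continuous fun p => κ n (rr p) := fun n =>
    (contDiff_cutIn hχ).continuous.comp continuous_rr
  have hθc : ∀ n, Continuous fun p => θ n (vv p) := fun n =>
    (contDiff_cutOut hχ).continuous.comp continuous_vv
  have hζc : Continuous fun p => ζ (uu p) := hζ.continuous.comp continuous_uu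
  have hζ'c : Continuous fun p => deriv ζ (uu p) :=
    (hζ.continuous_deriv le_rfl).comp continuous_uu
  have hcut : ∀ n, Continuous (cutoff (κ n) ζ (θ n)) := fun n => (hκc n).mul (hζc.mul (hθc n))
  have hfc := continuousOn_fixedTimeDensity hχ hF h s γ
  have hbc := continuousOn_bulkDensity hχ hF h s γ ε
  have hcc := continuousOn_coneDensity hχ hF h s γ
  constructor
  · refine lintegral_le_of_eventuallyEq (fun n => ?_) ?_ he_lim
      (fun n => le_self_add.trans (hsum n))
    · exact (aemeasurable_slice ((hcut n).continuousOn.mul (hfc.div_const 2))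
        ⟨hT, le_rfl⟩).ennreal_ofReal
    · filter_upwards [hae] with x hx
      filter_upwards [hκ1 (T, x) hx, hθ1 (T, x)] with n h1 h2
      rw [cutoff, h1, h2, one_mul, mul_one]
  · refine lintegral_le_of_eventuallyEq (fun n => ?_) ?_ he_lim
      (fun n => le_add_self.trans (hsum n))
    · refine (aemeasurable_slab ?_).ennreal_ofReal
      exact (continuousOn_const.mul ((hcut n).continuousOn.mul hbc)).add
        (((hκc n).mul (hζ'c.neg.mul (hθc n))).continuousOn.mul hcc)
    · filter_upwards [ae_snd_ne_zero T] with p hp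
      filter_upwards [hκ1 p hp.2, hθ1 p] with n h1 h2
      rw [cutoff, h1, h2, one_mul, mul_one, one_mul, mul_one]

open Filter Topology in
/-- The derivatives of the scaled steps form a one-sided approximate identity. -/
theorem ofReal_le_liminf_lintegral_step (hχ : IsSmoothStep χ) {f : ℝ → ℝ} {a : ℝ}
    (hf : ContinuousAt f a) (ha : a ∈ Ioo 0 T) :
    ENNReal.ofReal (f a) ≤ liminf (fun n : ℕ => ∫⁻ t in Icc 0 T,
      ENNReal.ofReal ((n : ℝ) * deriv χ (n * (t - a)) * f t)) atTop := by
  -- It suffices to reach every `c < f a`. For large `n` the kernel `n χ'(n (t - a))` has mass one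
  -- on `[a, a + 1/n]`, where `f > c` by continuity.
  refine le_of_forall_lt_imp_le_of_dense fun c hc => ?_
  lift c to NNReal using hc.ne_top
  have hc' : (c : ℝ) < f a := by
    rw [← ENNReal.ofReal_coe_nnreal] at hc
    exact (ENNReal.ofReal_lt_ofReal_iff_of_nonneg c.2).mp hc
  have hev : ∀ᶠ t in 𝓝 a, (c : ℝ) < f t ∧ t ∈ Ioo 0 T :=
    (hf.eventually_const_lt hc').and (isOpen_Ioo.mem_nhds ha)
  obtain ⟨d, hd, hball⟩ := Metric.eventually_nhds_iff.mp hev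
  have hN : ∀ᶠ n : ℕ in atTop, d⁻¹ < n := tendsto_natCast_atTop_atTop.eventually_gt_atTop _
  refine le_liminf_of_le (by isBoundedDefault) ?_
  filter_upwards [hN] with n hn
  have hn0 : (0 : ℝ) < n := (inv_pos.mpr hd).trans hn
  have hnd : (n : ℝ)⁻¹ < d := (inv_lt_comm₀ hd hn0).mp hn
  have hle : a ≤ a + (n : ℝ)⁻¹ := by linarith [inv_pos.mpr hn0]
  have hin : ∀ t ∈ Icc a (a + (n : ℝ)⁻¹), (c : ℝ) < f t ∧ t ∈ Ioo 0 T := by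
    intro t ht
    refine hball ?_
    rw [Real.dist_eq, abs_of_nonneg (by linarith [ht.1])]
    linarith [ht.2]
  have hder : ∀ t, HasDerivAt (fun t => χ (n * (t - a))) ((n : ℝ) * deriv χ (n * (t - a))) t := by
    intro t
    have h1 : HasDerivAt (fun t : ℝ => (n : ℝ) * (t - a)) (n : ℝ) t := by
      simpa using ((hasDerivAt_id t).sub_const a).const_mul (n : ℝ)
    rw [mul_comm (n : ℝ) (deriv χ _)]
    exact (hχ.hasDerivAt (n * (t - a))).comp t h1
  have hcd : Continuous fun t => (n : ℝ) * deriv χ (n * (t - a)) :=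
    continuous_const.mul ((hχ.contDiff.continuous_deriv le_rfl).comp (by fun_prop))
  have hnn : ∀ t, 0 ≤ (n : ℝ) * deriv χ (n * (t - a)) := fun t =>
    mul_nonneg hn0.le (hχ.deriv_nonneg _)
  have hI : ∫⁻ t in Icc a (a + (n : ℝ)⁻¹), ENNReal.ofReal ((n : ℝ) * deriv χ (n * (t - a))) = 1 := by
    rw [← ofReal_integral_eq_lintegral_ofReal (hcd.integrableOn_Icc) (Eventually.of_forall hnn),
      integral_Icc_eq_integral_Ioc, ← intervalIntegral.integral_of_le hle,
      intervalIntegral.integral_eq_sub_of_hasDerivAt (fun t _ => hder t)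
        (hcd.intervalIntegrable _ _)]
    have e1 : (n : ℝ) * (a + (n : ℝ)⁻¹ - a) = 1 := by field_simp; ring
    rw [e1, sub_self, mul_zero, hχ.eq_one 1 le_rfl, hχ.eq_zero 0 le_rfl]
    simp
  calc (c : ℝ≥0∞) = ∫⁻ t in Icc a (a + (n : ℝ)⁻¹),
        ENNReal.ofReal ((n : ℝ) * deriv χ (n * (t - a))) * c := by
        rw [lintegral_mul_const _ (hcd.measurable.ennreal_ofReal), hI, one_mul]
    _ ≤ ∫⁻ t in Icc a (a + (n : ℝ)⁻¹),
        ENNReal.ofReal ((n : ℝ) * deriv χ (n * (t - a)) * f t) := by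
        refine setLIntegral_mono' measurableSet_Icc fun t ht => ?_
        rw [ENNReal.ofReal_mul (hnn t), ← ENNReal.ofReal_coe_nnreal]
        gcongr
        exact (hin t ht).1.le
    _ ≤ _ := lintegral_mono_set fun t ht => Ioo_subset_Icc_self (hin t ht).2

-- With `ζ(y) = 1 - χ(n (y - u))` the flux density `-ζ'` is an approximate identity at the cone
-- `C(u)`. After Tonelli the inner time integrals have lower limit at least the density at `(u +
-- |x|, x)`, and Fatou in `x` gives the bound. The factor `√2` is the surface element.
open Filter Topology in
theorem coneIntegral_le (hχ : IsSmoothStep χ) (hγ : 0 < γ) (hε : 0 < ε)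
    (hεs : ε ≤ s - 1 / 2) (hs1 : s ≤ 1) (hK0 : 0 < K) (hK : WeightBounds χ γ ε K) (hT : 0 ≤ T)
    (hF : ∀ p ∈ slab T, ContDiffAt ℝ 1 F p) (h : MaxwellOn F J (slab T))
    (u : ℝ) :
    coneIntegral u T (coneDensity χ s γ (remainder χ F J)) ≤
      ENNReal.ofReal (Real.sqrt 2) * energyBound χ s γ ε K T F J := by
  set G := remainder χ F J
  set f := coneDensity χ s γ G
  refine mul_le_mul_right ?_ _
  have hfc : ContinuousOn f (slabOff T) := continuousOn_coneDensity hχ hF h s γ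
  set k : ℕ → Spacetime → ℝ := fun n p => (n : ℝ) * deriv χ (n * (p.1 - (u + ‖p.2‖))) with hk
  have hkc : ∀ n, Continuous (k n) := fun n =>
    continuous_const.mul ((hχ.contDiff.continuous_deriv le_rfl).comp (by fun_prop))
  have hk0 : ∀ n p, 0 ≤ k n p := fun n p => mul_nonneg n.cast_nonneg (hχ.deriv_nonneg _)
  have hbound : ∀ n : ℕ, ∫⁻ p in slab T, ENNReal.ofReal (k n p * f p) ≤
      energyBound χ s γ ε K T F J := by
    intro n
    set ζ : ℝ → ℝ := fun y => 1 - χ (n * (y - u)) with hζ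
    have hder : ∀ y, deriv ζ y = -((n : ℝ) * deriv χ (n * (y - u))) := by
      intro y
      have h1 : HasDerivAt (fun t : ℝ => (n : ℝ) * (t - u)) (n : ℝ) y := by
        simpa using ((hasDerivAt_id y).sub_const u).const_mul (n : ℝ)
      have h2 := ((hχ.hasDerivAt (n * (y - u))).comp y h1).const_sub 1
      rw [mul_comm] at h2
      exact h2.deriv
    refine le_trans (lintegral_mono fun p => ENNReal.ofReal_le_ofReal ?_)
      (energy_inequality (ζ := ζ) hχ hγ hε hεs hs1 hK0 hK hT hF h
      (contDiff_const.sub (hχ.contDiff.comp (by fun_prop)))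
      (fun y => sub_nonneg.mpr (hχ.le_one _)) (fun y => sub_le_self _ (hχ.nonneg _)) ?_).2
    · have h1 : -deriv ζ (uu p) = k n p := by
        rw [hder, neg_neg, hk, uu]
        ring_nf
      rw [h1]
      have h2 := bulkDensity_nonneg hχ s γ ε G p
      have h3 : 0 ≤ ζ (uu p) := sub_nonneg.mpr (hχ.le_one _)
      have : 0 ≤ 1 / (2 * K) * (ζ (uu p) * bulkDensity χ s γ ε G p) := by positivity
      linarith
    · intro y
      rw [hder, neg_nonpos]
      exact mul_nonneg n.cast_nonneg (hχ.deriv_nonneg _)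
  set g : ℕ → Space → ℝ≥0∞ := fun n x => ∫⁻ t in Icc 0 T, ENNReal.ofReal (k n (t, x) * f (t, x))
  have hmeas : ∀ n, AEMeasurable (fun p => ENNReal.ofReal (k n p * f p))
      (((volume : Measure ℝ).restrict (Icc 0 T)).prod (volume : Measure Space)) := fun n => by
    rw [← volume_restrict_slab]
    exact (aemeasurable_slab ((hkc n).continuousOn.mul hfc)).ennreal_ofReal
  have hgm : ∀ n, AEMeasurable (g n) := fun n => (hmeas n).lintegral_prod_left'
  have hgI : ∀ n, ∫⁻ x, g n x ≤ energyBound χ s γ ε K T F J := by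
    intro n
    refine le_trans (le_of_eq ?_) (hbound n)
    rw [volume_restrict_slab, lintegral_prod_symm _ (hmeas n)]
  set S : Set Space := {x | 0 ≤ u + ‖x‖ ∧ u + ‖x‖ ≤ T}
  have hS : MeasurableSet S :=
    (measurableSet_Icc (a := (0 : ℝ)) (b := T)).preimage (f := fun x : Space => u + ‖x‖)
      (by fun_prop)
  -- The approximate identity needs `u + |x|` in the open interval `(0, T)`; the excluded points lie
  -- on two spheres, which are null.
  have hsph : ∀ r : ℝ, ∀ᵐ x : Space, ‖x‖ ≠ r := by
    intro r
    rw [ae_iff]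
    have : {x : Space | ¬ ‖x‖ ≠ r} = Metric.sphere 0 r := by ext x; simp
    rw [this, Measure.addHaar_sphere]
  have hae : ∀ᵐ x : Space, x ≠ 0 := by simp [ae_iff]
  calc ∫⁻ x in S, ENNReal.ofReal (f (u + ‖x‖, x))
      ≤ ∫⁻ x in S, liminf (fun n => g n x) atTop := by
        refine lintegral_mono_ae ?_
        filter_upwards [ae_restrict_mem hS, ae_restrict_of_ae (hsph (-u)),
          ae_restrict_of_ae (hsph (T - u)), ae_restrict_of_ae hae] with x hx h1 h2 h3
        have hIoo : u + ‖x‖ ∈ Ioo 0 T :=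
          ⟨lt_of_le_of_ne hx.1 fun he => h1 (by linarith),
            lt_of_le_of_ne hx.2 fun he => h2 (by linarith)⟩
        refine ofReal_le_liminf_lintegral_step hχ (f := fun t => f (t, x)) ?_ hIoo
        have hc : ContinuousOn (fun t => f (t, x)) (Icc 0 T) :=
          hfc.comp (by fun_prop) fun t ht => ⟨ht, h3⟩
        exact hc.continuousAt (Icc_mem_nhds hIoo.1 hIoo.2)
    _ ≤ ∫⁻ x, liminf (fun n => g n x) atTop := lintegral_mono' Measure.restrict_le_self le_rfl
    _ ≤ liminf (fun n => ∫⁻ x, g n x) atTop := lintegral_liminf_le' hgm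
    _ ≤ liminf (fun _ : ℕ => energyBound χ s γ ε K T F J) atTop :=
        liminf_le_liminf (Eventually.of_forall hgI)
    _ = _ := liminf_const _

/-- The energy is controlled by the charge, the initial energy and the modified current. -/
theorem morawetzEnergy_le (hχ : IsSmoothStep χ) (hγ : 0 < γ) (hε : 0 < ε)
    (hεs : ε ≤ s - 1 / 2) (hs1 : s ≤ 1) (hK0 : 0 < K) (hK : WeightBounds χ γ ε K) (hT : 0 ≤ T)
    (hF : ∀ p ∈ slab T, ContDiffAt ℝ 1 F p) (h : MaxwellOn F J (slab T)) :
    morawetzEnergy χ s γ ε T F J ≤ ENNReal.ofReal (|charge J| ^ 2)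
      + ENNReal.ofReal (2 + Real.sqrt 2 + 2 * K) * energyBound χ s γ ε K T F J := by
  set G := remainder χ F J with hG
  set M := energyBound χ s γ ε K T F J with hM
  -- The inequality is applied on the shorter slab up to time `t`. The factor `2` undoes the half in
  -- the lower bound for the time component of the current.
  have h1 : ∀ t ∈ Icc 0 T, ∫⁻ x : Space, ENNReal.ofReal (fixedTimeDensity χ s γ G (t, x)) ≤
      ENNReal.ofReal 2 * M := by
    intro t ht
    have hsub : slab t ⊆ slab T := fun p hp => ⟨hp.1, hp.2.trans ht.2⟩
    have hle : energyBound χ s γ ε K t F J ≤ M := energyBound_mono ht.2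
    have hb := (energy_inequality (ζ := fun _ => 1) hχ hγ hε hεs hs1 hK0 hK ht.1
      (fun p hp => hF p (hsub hp)) (fun p hp => h p (hsub hp))
      contDiff_const (by simp) (by simp) (by simp)).1
    have hb2 := mul_le_mul_right (hb.trans hle) (ENNReal.ofReal 2)
    rw [← lintegral_const_mul' _ _ ENNReal.ofReal_ne_top] at hb2
    refine le_trans (le_of_eq (lintegral_congr fun x => ?_)) hb2
    rw [← ENNReal.ofReal_mul two_pos.le]
    congr 1; ring
  have h2 : ∀ u, coneIntegral u T (coneDensity χ s γ G) ≤ ENNReal.ofReal (Real.sqrt 2) * M :=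
    coneIntegral_le hχ hγ hε hεs hs1 hK0 hK hT hF h
  have h3 : ∫⁻ t in Icc (0 : ℝ) T, ∫⁻ x : Space, ENNReal.ofReal (bulkDensity χ s γ ε G (t, x)) ≤
      ENNReal.ofReal (2 * K) * M := by
    have hb := (energy_inequality (ζ := fun _ => 1) hχ hγ hε hεs hs1 hK0 hK hT
      hF h contDiff_const (by simp) (by simp) (by simp)).2
    have hb2 := mul_le_mul_right hb (ENNReal.ofReal (2 * K))
    rw [← lintegral_const_mul' _ _ ENNReal.ofReal_ne_top] at hb2
    refine le_trans (le_of_eq ?_) hb2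
    have hm : AEMeasurable (fun p => ENNReal.ofReal (bulkDensity χ s γ ε G p))
        (((volume : Measure ℝ).restrict (Icc 0 T)).prod (volume : Measure Space)) := by
      rw [← volume_restrict_slab]
      exact (aemeasurable_slab (continuousOn_bulkDensity hχ hF h s γ ε)).ennreal_ofReal
    rw [← lintegral_prod _ hm, ← volume_restrict_slab]
    refine lintegral_congr fun p => ?_
    rw [← ENNReal.ofReal_mul (by positivity)]
    congr 1
    rw [deriv_const, neg_zero, zero_mul, add_zero, one_mul]
    field_simp
    rfl
  rw [ENNReal.ofReal_add (by positivity) (by positivity), ENNReal.ofReal_add (by positivity)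
    (by positivity), add_mul, add_mul, ← add_assoc, ← add_assoc]
  exact add_le_add (add_le_add (add_le_add le_rfl (iSup₂_le h1)) (iSup_le h2)) h3

end Limit

/-! ### Integrals of radial powers -/

/-- The area of the unit sphere. -/
def sphereArea : ℝ := 3 * (volume : Measure Space).real (Metric.ball 0 1)

theorem sphereArea_nonneg : 0 ≤ sphereArea := by unfold sphereArea; positivity

theorem lintegral_radial {f : ℝ → ℝ} (hf : IntegrableOn (fun r => r ^ 2 * f r) (Ioi 0))
    (hf0 : ∀ r, 0 ≤ f r) :
    ∫⁻ z : Space, ENNReal.ofReal (f ‖z‖) =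
      ENNReal.ofReal (sphereArea * ∫ r in Ioi (0 : ℝ), r ^ 2 * f r) := by
  have hd : Module.finrank ℝ Space = 3 := by simp
  have h1 : Integrable (fun z : Space => f ‖z‖) := by
    rw [integrable_fun_norm_addHaar, hd]
    simpa using hf
  rw [← ofReal_integral_eq_lintegral_ofReal h1 (Filter.Eventually.of_forall fun z => hf0 _),
    integral_fun_norm_addHaar, hd, sphereArea, smul_eq_mul, nsmul_eq_mul, Nat.cast_ofNat, mul_assoc]
  rfl

theorem sq_mul_rpow {b r : ℝ} (hr : 0 < r) : r ^ 2 * r ^ (-b) = r ^ (2 - b) := by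
  rw [sub_eq_add_neg, Real.rpow_add hr, Real.rpow_two]

theorem lintegral_radial_rpow {S : Set ℝ} (hS : MeasurableSet S) {b : ℝ}
    (hi : IntegrableOn (fun r : ℝ => r ^ (2 - b)) (S ∩ Ioi 0)) :
    ∫⁻ z in {z : Space | ‖z‖ ∈ S}, ENNReal.ofReal (‖z‖ ^ (-b)) =
      ENNReal.ofReal (sphereArea * ∫ r in S ∩ Ioi 0, r ^ (2 - b)) := by
  have hSm : MeasurableSet {z : Space | ‖z‖ ∈ S} := measurable_norm hS
  -- The profile is written with `|r|` because `lintegral_radial` asks for nonnegativity at all real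
  -- `r`, including negative ones.
  have e : ∀ r ∈ Ioi (0 : ℝ), r ^ 2 * S.indicator (fun r => |r| ^ (-b)) r =
      S.indicator (fun r => r ^ (2 - b)) r := by
    intro r hr
    by_cases h : r ∈ S
    · rw [indicator_of_mem h, indicator_of_mem h, abs_of_pos hr, sq_mul_rpow hr]
    · rw [indicator_of_notMem h, indicator_of_notMem h, mul_zero]
  have hint : IntegrableOn (fun r => r ^ 2 * S.indicator (fun r => |r| ^ (-b)) r) (Ioi 0) := by
    refine IntegrableOn.congr_fun ?_ (fun r hr => (e r hr).symm) measurableSet_Ioi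
    rw [IntegrableOn, integrable_indicator_iff hS, IntegrableOn, Measure.restrict_restrict hS]
    exact hi
  have key := lintegral_radial hint fun r => indicator_nonneg (fun r _ => by positivity) r
  rw [setIntegral_congr_fun measurableSet_Ioi e, setIntegral_indicator hS, inter_comm] at key
  rw [← key, ← lintegral_indicator hSm]
  refine lintegral_congr fun z => ?_
  by_cases h : ‖z‖ ∈ S
  · rw [indicator_of_mem h, indicator_of_mem (show z ∈ {z : Space | ‖z‖ ∈ S} from h), abs_norm]
  · rw [indicator_of_notMem h, indicator_of_notMem (show z ∉ {z : Space | ‖z‖ ∈ S} from h),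
      ENNReal.ofReal_zero]

theorem lintegral_closedBall_rpow {b ρ : ℝ} (hb : b < 3) (hρ : 0 ≤ ρ) :
    ∫⁻ z in {z : Space | ‖z‖ ≤ ρ}, ENNReal.ofReal (‖z‖ ^ (-b)) =
      ENNReal.ofReal (sphereArea * (ρ ^ (3 - b) / (3 - b))) := by
  have hi : IntervalIntegrable (fun r : ℝ => r ^ (2 - b)) volume 0 ρ :=
    intervalIntegral.intervalIntegrable_rpow' (by linarith)
  have hset : Iic ρ ∩ Ioi 0 = Ioc 0 ρ := by ext r; simp [and_comm]
  have := lintegral_radial_rpow (S := Iic ρ) (b := b) measurableSet_Iic (by rw [hset]; exact hi.1)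
  rw [hset, ← intervalIntegral.integral_of_le hρ, integral_rpow (Or.inl (by linarith)),
    show 2 - b + 1 = 3 - b by ring, Real.zero_rpow (by linarith), sub_zero] at this
  exact this

theorem lintegral_compl_closedBall_rpow {b ρ : ℝ} (hb : 3 < b) (hρ : 0 < ρ) :
    ∫⁻ z in {z : Space | ρ < ‖z‖}, ENNReal.ofReal (‖z‖ ^ (-b)) =
      ENNReal.ofReal (sphereArea * (ρ ^ (3 - b) / (b - 3))) := by
  have hset : Ioi ρ ∩ Ioi 0 = Ioi ρ := inter_eq_left.mpr fun r hr => hρ.trans hr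
  have := lintegral_radial_rpow (S := Ioi ρ) (b := b) measurableSet_Ioi
    (by rw [hset]; exact integrableOn_Ioi_rpow_of_lt (by linarith) hρ)
  rw [hset, integral_Ioi_rpow_of_lt (by linarith) hρ, show 2 - b + 1 = 3 - b by ring,
    neg_div, ← div_neg, neg_sub] at this
  exact this

/-- The measure with density `|x|^{-3}` on a dyadic annulus, in integrated form. -/
theorem lintegral_annuli_le {δ Y : ℝ} (hδ : 0 < δ) (hδ3 : δ < 3) (hY : 0 < Y) :
    ∫⁻ x : Space, ENNReal.ofReal ((1 + ‖x‖) ^ (-3 : ℝ) *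
      min (((1 + ‖x‖) / Y) ^ δ) ((Y / (1 + ‖x‖)) ^ δ)) ≤ ENNReal.ofReal (2 * sphereArea / δ) := by
  have hA := sphereArea_nonneg
  have hae : ∀ᵐ x : Space, x ≠ 0 := by simp [ae_iff]
  have hS : MeasurableSet {x : Space | ‖x‖ ≤ Y} := measurable_norm measurableSet_Iic
  have hc : {x : Space | ‖x‖ ≤ Y}ᶜ = {x | Y < ‖x‖} := by ext x; simp
  -- Inside `|x| ≤ Y` the factor `((1 + |x|) / Y)^δ` makes the inverse cube integrable; outside, the
  -- reciprocal factor makes it decay fast enough. Each half contributes `sphereArea / δ`,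
  -- independently of `Y`.
  have h1 : ∫⁻ x in {x : Space | ‖x‖ ≤ Y}, ENNReal.ofReal ((1 + ‖x‖) ^ (-3 : ℝ) *
      min (((1 + ‖x‖) / Y) ^ δ) ((Y / (1 + ‖x‖)) ^ δ)) ≤ ENNReal.ofReal (sphereArea / δ) := by
    calc _ ≤ ∫⁻ x in {x : Space | ‖x‖ ≤ Y}, ENNReal.ofReal (Y ^ (-δ)) *
          ENNReal.ofReal (‖x‖ ^ (-(3 - δ))) := by
          refine lintegral_mono_ae ?_
          filter_upwards [ae_restrict_of_ae hae] with x hx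
          have hx0 : 0 < ‖x‖ := norm_pos_iff.mpr hx
          rw [← ENNReal.ofReal_mul (by positivity)]
          refine ENNReal.ofReal_le_ofReal ?_
          calc _ ≤ (1 + ‖x‖) ^ (-3 : ℝ) * ((1 + ‖x‖) / Y) ^ δ := by gcongr; exact min_le_left _ _
            _ = Y ^ (-δ) * (1 + ‖x‖) ^ (-(3 - δ)) := by
                rw [Real.div_rpow (by positivity) hY.le, Real.rpow_neg hY.le,
                  show -(3 - δ) = -3 + δ by ring, Real.rpow_add (by positivity)]
                ring
            _ ≤ _ := by
                gcongr 1
                exact Real.rpow_le_rpow_of_nonpos hx0 (by linarith) (by linarith)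
      _ = _ := by
          rw [lintegral_const_mul' _ _ ENNReal.ofReal_ne_top,
            lintegral_closedBall_rpow (by linarith) hY.le, ← ENNReal.ofReal_mul (by positivity)]
          congr 1
          rw [show 3 - (3 - δ) = δ by ring, Real.rpow_neg hY.le]
          field_simp
  have h2 : ∫⁻ x in {x : Space | Y < ‖x‖}, ENNReal.ofReal ((1 + ‖x‖) ^ (-3 : ℝ) *
      min (((1 + ‖x‖) / Y) ^ δ) ((Y / (1 + ‖x‖)) ^ δ)) ≤ ENNReal.ofReal (sphereArea / δ) := by
    calc _ ≤ ∫⁻ x in {x : Space | Y < ‖x‖}, ENNReal.ofReal (Y ^ δ) *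
          ENNReal.ofReal (‖x‖ ^ (-(3 + δ))) := by
          refine lintegral_mono_ae ?_
          filter_upwards [ae_restrict_of_ae hae] with x hx
          have hx0 : 0 < ‖x‖ := norm_pos_iff.mpr hx
          rw [← ENNReal.ofReal_mul (by positivity)]
          refine ENNReal.ofReal_le_ofReal ?_
          calc _ ≤ (1 + ‖x‖) ^ (-3 : ℝ) * (Y / (1 + ‖x‖)) ^ δ := by gcongr; exact min_le_right _ _
            _ = Y ^ δ * (1 + ‖x‖) ^ (-(3 + δ)) := by
                rw [Real.div_rpow hY.le (by positivity), show -(3 + δ) = -3 + -δ by ring,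
                  Real.rpow_add (by positivity), Real.rpow_neg (by positivity) δ]
                ring
            _ ≤ _ := by
                gcongr 1
                exact Real.rpow_le_rpow_of_nonpos hx0 (by linarith) (by linarith)
      _ = _ := by
          rw [lintegral_const_mul' _ _ ENNReal.ofReal_ne_top,
            lintegral_compl_closedBall_rpow (by linarith) hY, ← ENNReal.ofReal_mul (by positivity)]
          congr 1
          rw [show 3 - (3 + δ) = -δ by ring, Real.rpow_neg hY.le, add_sub_cancel_left]
          field_simp
  rw [← lintegral_add_compl _ hS, hc]
  refine (add_le_add h1 h2).trans (le_of_eq ?_)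
  rw [← ENNReal.ofReal_add (by positivity) (by positivity)]
  congr 1; ring

/-- The composition of two Riesz kernels. -/
theorem lintegral_riesz_comp_le {w : Space} (hw : w ≠ 0) :
    ∫⁻ x : Space, ENNReal.ofReal (‖x‖ ^ (-2 : ℝ)) * ENNReal.ofReal (‖x - w‖ ^ (-2 : ℝ)) ≤
      ENNReal.ofReal (8 * sphereArea) * ENNReal.ofReal (‖w‖ ^ (-1 : ℝ)) := by
  have hA := sphereArea_nonneg
  set d := ‖w‖ / 2 with hd
  have hd0 : 0 < d := by have := norm_pos_iff.mpr hw; positivity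
  -- A common majorant: of the two points `x` and `x - w`, the one with the larger norm has norm at
  -- least `|w| / 2` and at least that of the other, so the product of kernels is at most `m x` or
  -- `m (x - w)`.
  set m : Space → ℝ≥0∞ := fun z =>
    ENNReal.ofReal (‖z‖ ^ (-2 : ℝ)) * ENNReal.ofReal (max ‖z‖ d ^ (-2 : ℝ)) with hm
  have hmm : Measurable m := by fun_prop
  have hS : MeasurableSet {x : Space | ‖x‖ ≤ d} := measurable_norm measurableSet_Iic
  have hS' : MeasurableSet {x : Space | d < ‖x‖} := measurable_norm measurableSet_Ioi
  have hc : {x : Space | ‖x‖ ≤ d}ᶜ = {x | d < ‖x‖} := by ext x; simp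
  have hmI : ∫⁻ z, m z = ENNReal.ofReal (4 * sphereArea / ‖w‖) := by
    have h1 : ∫⁻ z in {x : Space | ‖x‖ ≤ d}, m z = ENNReal.ofReal (sphereArea / d) := by
      have : ∀ z ∈ {x : Space | ‖x‖ ≤ d}, m z =
          ENNReal.ofReal (d ^ (-2 : ℝ)) * ENNReal.ofReal (‖z‖ ^ (-2 : ℝ)) := by
        intro z hz
        simp only [hm]
        rw [max_eq_right hz, mul_comm]
      rw [setLIntegral_congr_fun hS this, lintegral_const_mul' _ _ ENNReal.ofReal_ne_top,
        lintegral_closedBall_rpow (by norm_num) hd0.le, ← ENNReal.ofReal_mul (by positivity)]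
      congr 1
      rw [show (3 : ℝ) - 2 = 1 by norm_num, Real.rpow_one, Real.rpow_neg hd0.le, Real.rpow_two]
      field_simp
    have h2 : ∫⁻ z in {x : Space | d < ‖x‖}, m z = ENNReal.ofReal (sphereArea / d) := by
      have : ∀ z ∈ {x : Space | d < ‖x‖}, m z = ENNReal.ofReal (‖z‖ ^ (-4 : ℝ)) := by
        intro z hz
        have hz0 : 0 < ‖z‖ := hd0.trans hz
        simp only [hm]
        rw [max_eq_left hz.le, ← ENNReal.ofReal_mul (by positivity), ← Real.rpow_add hz0]
        norm_num
      rw [setLIntegral_congr_fun hS' this, lintegral_compl_closedBall_rpow (by norm_num) hd0]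
      congr 1
      rw [show (3 : ℝ) - 4 = -1 by norm_num, Real.rpow_neg hd0.le, Real.rpow_one]
      norm_num
      rfl
    rw [← lintegral_add_compl _ hS, hc, h1, h2, ← ENNReal.ofReal_add (by positivity) (by positivity)]
    congr 1
    rw [hd]
    have := norm_pos_iff.mpr hw
    field_simp
    ring
  have hpt : ∀ x : Space, ENNReal.ofReal (‖x‖ ^ (-2 : ℝ)) * ENNReal.ofReal (‖x - w‖ ^ (-2 : ℝ)) ≤
      m x + m (x - w) := by
    intro x
    have htri : ‖w‖ ≤ ‖x‖ + ‖x - w‖ := by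
      have := norm_sub_le x (x - w)
      rwa [sub_sub_cancel] at this
    rcases le_total ‖x‖ ‖x - w‖ with h | h
    · refine le_add_right (mul_le_mul_right (ENNReal.ofReal_le_ofReal ?_) _)
      exact Real.rpow_le_rpow_of_nonpos (lt_max_of_lt_right hd0) (max_le h (by linarith)) (by norm_num)
    · refine le_add_left ?_
      rw [mul_comm]
      refine mul_le_mul_right (ENNReal.ofReal_le_ofReal ?_) _
      exact Real.rpow_le_rpow_of_nonpos (lt_max_of_lt_right hd0) (max_le h (by linarith)) (by norm_num)
  calc _ ≤ ∫⁻ x, (m x + m (x - w)) := lintegral_mono hpt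
    _ = ENNReal.ofReal (4 * sphereArea / ‖w‖) + ENNReal.ofReal (4 * sphereArea / ‖w‖) := by
        rw [lintegral_add_left hmm, lintegral_sub_right_eq_self, hmI]
    _ = _ := by
        rw [← ENNReal.ofReal_add (by positivity) (by positivity),
          ← ENNReal.ofReal_mul (by positivity), Real.rpow_neg (norm_nonneg _), Real.rpow_one]
        congr 1
        ring

/-- The Newtonian potential of a set is largest for a ball. -/
theorem setLIntegral_newton_le (A : Set Space) (y : Space) :
    ∫⁻ z in A, ENNReal.ofReal (‖z - y‖ ^ (-1 : ℝ)) ≤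
      ENNReal.ofReal (sphereArea / 2 + 1) * volume A ^ (2 / 3 : ℝ) := by
  have hS0 := sphereArea_nonneg
  rcases eq_or_ne (volume A) 0 with h0 | h0
  · rw [setLIntegral_measure_zero _ _ h0]; exact bot_le
  rcases eq_or_ne (volume A) ⊤ with h1 | h1
  · rw [h1, ENNReal.top_rpow_of_pos (by norm_num), ENNReal.mul_top (by simp; positivity)]
    exact le_top
  set v := (volume A).toReal with hv
  have hv0 : 0 < v := ENNReal.toReal_pos h0 h1
  have hvA : volume A = ENNReal.ofReal v := (ENNReal.ofReal_toReal h1).symm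
  -- The radius at which a ball has volume comparable to that of `A`: inside it the kernel
  -- integrates to order `ρ²`, outside it is at most `1/ρ` on a set of measure `ρ³`.
  set ρ := v ^ (1 / 3 : ℝ) with hρ
  have hρ0 : 0 < ρ := by positivity
  have hpt : ∀ z, ENNReal.ofReal (‖z - y‖ ^ (-1 : ℝ)) ≤
      ({x : Space | ‖x‖ ≤ ρ}.indicator (fun z => ENNReal.ofReal (‖z‖ ^ (-1 : ℝ)))) (z - y)
        + ENNReal.ofReal (ρ ^ (-1 : ℝ)) := by
    intro z
    by_cases h : ‖z - y‖ ≤ ρ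
    · rw [indicator_of_mem (show z - y ∈ {x : Space | ‖x‖ ≤ ρ} from h)]
      exact le_self_add
    · refine le_add_left (ENNReal.ofReal_le_ofReal ?_)
      exact Real.rpow_le_rpow_of_nonpos hρ0 (not_le.mp h).le (by norm_num)
  have hS : MeasurableSet {x : Space | ‖x‖ ≤ ρ} := measurable_norm measurableSet_Iic
  calc _ ≤ ∫⁻ z in A, (({x : Space | ‖x‖ ≤ ρ}.indicator
          (fun z => ENNReal.ofReal (‖z‖ ^ (-1 : ℝ)))) (z - y) + ENNReal.ofReal (ρ ^ (-1 : ℝ))) :=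
        lintegral_mono hpt
    _ = (∫⁻ z in A, ({x : Space | ‖x‖ ≤ ρ}.indicator
          (fun z => ENNReal.ofReal (‖z‖ ^ (-1 : ℝ)))) (z - y))
          + ENNReal.ofReal (ρ ^ (-1 : ℝ)) * volume A := by
        rw [lintegral_add_right _ measurable_const, lintegral_const, Measure.restrict_apply_univ]
    _ ≤ (∫⁻ z, ({x : Space | ‖x‖ ≤ ρ}.indicator
          (fun z => ENNReal.ofReal (‖z‖ ^ (-1 : ℝ)))) (z - y))
          + ENNReal.ofReal (ρ ^ (-1 : ℝ)) * volume A := by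
        gcongr
        exact Measure.restrict_le_self
    _ = _ := by
        rw [lintegral_sub_right_eq_self (f := {x : Space | ‖x‖ ≤ ρ}.indicator
          (fun z => ENNReal.ofReal (‖z‖ ^ (-1 : ℝ)))), lintegral_indicator hS,
          lintegral_closedBall_rpow (by norm_num) hρ0.le, hvA,
          ENNReal.ofReal_rpow_of_pos hv0, ← ENNReal.ofReal_mul (by positivity),
          ← ENNReal.ofReal_mul (by positivity), ← ENNReal.ofReal_add (by positivity) (by positivity)]
        congr 1
        have e1 : ρ ^ (3 - 1 : ℝ) = v ^ (2 / 3 : ℝ) := by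
          rw [hρ, ← Real.rpow_mul hv0.le]; norm_num
        have e2 : ρ ^ (-1 : ℝ) * v = v ^ (2 / 3 : ℝ) := by
          rw [hρ, ← Real.rpow_mul hv0.le]
          nth_rewrite 2 [← Real.rpow_one v]
          rw [← Real.rpow_add hv0]; norm_num
        rw [e1, e2]
        ring

/-! ### The Hardy–Littlewood–Sobolev inequality from `L^{6/5}` to `L²` -/

theorem rpow_five_thirds (N : ℝ≥0∞) : N ^ (5 / 3 : ℝ) = N * N ^ (2 / 3 : ℝ) := by
  rw [show (5 / 3 : ℝ) = 1 + 2 / 3 by norm_num,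
    ENNReal.rpow_add_of_nonneg _ _ (by norm_num) (by norm_num), ENNReal.rpow_one]

section HLS

variable {g : Space → ℝ}

theorem measure_superlevel_le (hg : Measurable g) {a : ℝ} (ha : 0 < a) :
    volume {z | a < g z} ≤
      (∫⁻ y, ENNReal.ofReal (g y ^ (6 / 5 : ℝ))) * ENNReal.ofReal (a ^ (-(6 / 5) : ℝ)) := by
  have hm : Measurable fun y => ENNReal.ofReal (g y ^ (6 / 5 : ℝ)) := by fun_prop
  have ha' : 0 < a ^ (6 / 5 : ℝ) := Real.rpow_pos_of_pos ha _
  have h1 := mul_meas_ge_le_lintegral (μ := (volume : Measure Space)) hm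
    (ENNReal.ofReal (a ^ (6 / 5 : ℝ)))
  have h2 : volume {z | a < g z} ≤
      volume {x | ENNReal.ofReal (a ^ (6 / 5 : ℝ)) ≤ ENNReal.ofReal (g x ^ (6 / 5 : ℝ))} := by
    refine measure_mono fun z (hz : a < g z) => ?_
    exact ENNReal.ofReal_le_ofReal (Real.rpow_le_rpow ha.le hz.le (by norm_num))
  rw [Real.rpow_neg ha.le, ENNReal.ofReal_inv_of_pos ha', ← div_eq_mul_inv]
  rw [ENNReal.le_div_iff_mul_le (Or.inl (by simpa using ha')) (Or.inl ENNReal.ofReal_ne_top), mul_comm]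
  exact (mul_le_mul_right h2 _).trans h1

theorem lintegral_Ioo_rpow {m : ℝ} (hm : 0 ≤ m) :
    ∫⁻ a in Ioo 0 m, ENNReal.ofReal (a ^ (-(4 / 5) : ℝ)) = ENNReal.ofReal (5 * m ^ (1 / 5 : ℝ)) := by
  have hi : IntervalIntegrable (fun r : ℝ => r ^ (-(4 / 5) : ℝ)) volume 0 m :=
    intervalIntegral.intervalIntegrable_rpow' (by norm_num)
  rw [Measure.restrict_congr_set Ioo_ae_eq_Ioc]
  rw [← ofReal_integral_eq_lintegral_ofReal hi.1, ← intervalIntegral.integral_of_le hm,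
    integral_rpow (Or.inl (by norm_num))]
  · congr 1
    rw [Real.zero_rpow (by norm_num)]
    norm_num
    ring
  · filter_upwards [ae_restrict_mem measurableSet_Ioc] with r hr using Real.rpow_nonneg hr.1.le _

/-- Layer cake decomposition. The level set `{g > a}` has measure at most `N a^{-6/5}`, hence
Newtonian potential of order `N^{2/3} a^{-4/5}`. This is integrable at `a = 0`, and the truncation
at level `g y` turns the integral into `5 (g y)^{1/5}`. -/
theorem newton_truncated_le (hg0 : ∀ y, 0 ≤ g y) (hg : Measurable g) (y : Space) :
    ∫⁻ z, (if g z ≤ g y then ENNReal.ofReal (g z) else 0) * ENNReal.ofReal (‖z - y‖ ^ (-1 : ℝ)) ≤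
      ENNReal.ofReal (5 * (sphereArea / 2 + 1)) *
        (∫⁻ y, ENNReal.ofReal (g y ^ (6 / 5 : ℝ))) ^ (2 / 3 : ℝ)
        * ENNReal.ofReal (g y ^ (1 / 5 : ℝ)) := by
  set N := ∫⁻ y, ENNReal.ofReal (g y ^ (6 / 5 : ℝ))
  set c := sphereArea / 2 + 1 with hc
  have hc0 : 0 ≤ c := by have := sphereArea_nonneg; positivity
  set k : Space → ℝ≥0∞ := fun z => ENNReal.ofReal (‖z - y‖ ^ (-1 : ℝ)) with hk
  have hkm : Measurable k := by fun_prop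
  have hlayer : ∀ z, (if g z ≤ g y then ENNReal.ofReal (g z) else 0) ≤
      ∫⁻ a in Ioo 0 (g y), {z | a < g z}.indicator (fun _ => 1) z := by
    intro z
    split_ifs with hz
    · have hsub : Ioo 0 (g z) ⊆ Ioo 0 (g y) := Ioo_subset_Ioo_right hz
      calc ENNReal.ofReal (g z) = ∫⁻ _ in Ioo 0 (g z), 1 := by simp
        _ ≤ ∫⁻ a in Ioo 0 (g z), {z | a < g z}.indicator (fun _ => 1) z := by
            refine setLIntegral_mono' measurableSet_Ioo fun a ha => ?_
            rw [indicator_of_mem (show z ∈ {z | a < g z} from ha.2)]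
        _ ≤ _ := lintegral_mono_set hsub
    · exact bot_le
  have hjm : Measurable fun q : Space × ℝ => {z | q.2 < g z}.indicator (fun _ => (1 : ℝ≥0∞)) q.1 := by
    have : MeasurableSet {q : Space × ℝ | q.2 < g q.1} :=
      measurableSet_lt measurable_snd (hg.comp measurable_fst)
    exact (measurable_const (a := (1 : ℝ≥0∞))).indicator this
  calc _ ≤ ∫⁻ z, (∫⁻ a in Ioo 0 (g y), {z | a < g z}.indicator (fun _ => 1) z) * k z :=
        lintegral_mono fun z => mul_le_mul_left (hlayer z) _
    _ = ∫⁻ z, ∫⁻ a in Ioo 0 (g y), {z | a < g z}.indicator (fun _ => 1) z * k z := by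
        refine lintegral_congr fun z => ?_
        rw [lintegral_mul_const]
        exact hjm.comp measurable_prodMk_left
    _ = ∫⁻ a in Ioo 0 (g y), ∫⁻ z, {z | a < g z}.indicator (fun _ => 1) z * k z := by
        refine lintegral_lintegral_swap (Measurable.aemeasurable ?_)
        exact hjm.mul (hkm.comp measurable_fst)
    _ ≤ ∫⁻ a in Ioo 0 (g y), (ENNReal.ofReal c * N ^ (2 / 3 : ℝ)) *
          ENNReal.ofReal (a ^ (-(4 / 5) : ℝ)) := by
        refine setLIntegral_mono' measurableSet_Ioo fun a ha => ?_
        have hA : MeasurableSet {z | a < g z} := measurableSet_lt measurable_const hg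
        have e1 : ∫⁻ z, {z | a < g z}.indicator (fun _ => 1) z * k z = ∫⁻ z in {z | a < g z}, k z := by
          rw [← lintegral_indicator hA]
          refine lintegral_congr fun z => ?_
          by_cases hz : z ∈ {z | a < g z}
          · rw [indicator_of_mem hz, indicator_of_mem hz, one_mul]
          · rw [indicator_of_notMem hz, indicator_of_notMem hz, zero_mul]
        rw [e1, mul_assoc]
        refine (setLIntegral_newton_le _ y).trans (mul_le_mul_right ?_ _)
        calc _ ≤ (N * ENNReal.ofReal (a ^ (-(6 / 5) : ℝ))) ^ (2 / 3 : ℝ) :=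
              ENNReal.rpow_le_rpow (measure_superlevel_le hg ha.1) (by norm_num)
          _ = _ := by
              rw [ENNReal.mul_rpow_of_nonneg _ _ (by norm_num),
                ENNReal.ofReal_rpow_of_pos (Real.rpow_pos_of_pos ha.1 _), ← Real.rpow_mul ha.1.le]
              norm_num
    _ = _ := by
        rw [lintegral_const_mul _ (by fun_prop), lintegral_Ioo_rpow (hg0 y),
          ENNReal.ofReal_mul (by norm_num : (0 : ℝ) ≤ 5), ENNReal.ofReal_mul (by norm_num : (0 : ℝ) ≤ 5)]
        ring

/-- By symmetry of the kernel one may assume `g z ≤ g y`, at the price of a factor `2`. The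
truncated bound then gives `g y · (g y)^{1/5} = (g y)^{6/5}`, which integrates to `N`. -/
theorem newton_energy_le (hg0 : ∀ y, 0 ≤ g y) (hg : Measurable g) :
    ∫⁻ y, ∫⁻ z, ENNReal.ofReal (g y) * ENNReal.ofReal (g z) * ENNReal.ofReal (‖z - y‖ ^ (-1 : ℝ)) ≤
      ENNReal.ofReal (10 * (sphereArea / 2 + 1)) *
        (∫⁻ y, ENNReal.ofReal (g y ^ (6 / 5 : ℝ))) ^ (5 / 3 : ℝ) := by
  set N := ∫⁻ y, ENNReal.ofReal (g y ^ (6 / 5 : ℝ))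
  set c := sphereArea / 2 + 1 with hc
  have hc0 : 0 ≤ c := by have := sphereArea_nonneg; positivity
  set T : Space → Space → ℝ≥0∞ := fun y z => ENNReal.ofReal (g y) *
    ((if g z ≤ g y then ENNReal.ofReal (g z) else 0) * ENNReal.ofReal (‖z - y‖ ^ (-1 : ℝ))) with hT
  have hTm : Measurable (Function.uncurry T) := by
    have h1 : Measurable fun q : Space × Space => if g q.2 ≤ g q.1 then ENNReal.ofReal (g q.2) else 0 :=
      Measurable.ite (measurableSet_le (hg.comp measurable_snd) (hg.comp measurable_fst))
        (by fun_prop) measurable_const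
    have h2 : Measurable fun q : Space × Space => ENNReal.ofReal (g q.1) := by fun_prop
    have h3 : Measurable fun q : Space × Space => ENNReal.ofReal (‖q.2 - q.1‖ ^ (-1 : ℝ)) := by fun_prop
    exact h2.mul (h1.mul h3)
  have hpt : ∀ y z, ENNReal.ofReal (g y) * ENNReal.ofReal (g z) *
      ENNReal.ofReal (‖z - y‖ ^ (-1 : ℝ)) ≤ T y z + T z y := by
    intro y z
    rcases le_total (g z) (g y) with h | h
    · refine le_add_right (le_of_eq ?_)
      simp only [hT]
      rw [if_pos h, mul_assoc]
    · refine le_add_left (le_of_eq ?_)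
      simp only [hT]
      rw [if_pos h, norm_sub_rev, mul_comm (ENNReal.ofReal (g y)), mul_assoc]
  have hTI : ∫⁻ y, ∫⁻ z, T y z ≤ ENNReal.ofReal (5 * c) * N ^ (5 / 3 : ℝ) := by
    calc _ ≤ ∫⁻ y, ENNReal.ofReal (5 * c) * N ^ (2 / 3 : ℝ) * ENNReal.ofReal (g y ^ (6 / 5 : ℝ)) := by
          refine lintegral_mono fun y => ?_
          rw [lintegral_const_mul' _ _ ENNReal.ofReal_ne_top]
          refine (mul_le_mul_right (newton_truncated_le hg0 hg y) _).trans (le_of_eq ?_)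
          have : g y ^ (6 / 5 : ℝ) = g y * g y ^ (1 / 5 : ℝ) := by
            nth_rewrite 2 [← Real.rpow_one (g y)]
            rw [← Real.rpow_add_of_nonneg (hg0 y) (by norm_num) (by norm_num)]
            norm_num
          rw [this, ENNReal.ofReal_mul (hg0 y)]
          ring
      _ = _ := by
          rw [lintegral_const_mul _ (by fun_prop), mul_assoc, rpow_five_thirds, mul_comm N]
  calc _ ≤ ∫⁻ y, ∫⁻ z, (T y z + T z y) := lintegral_mono fun y => lintegral_mono fun z => hpt y z
    _ = (∫⁻ y, ∫⁻ z, T y z) + ∫⁻ y, ∫⁻ z, T z y := by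
        rw [← lintegral_add_left]
        · refine lintegral_congr fun y => ?_
          exact lintegral_add_left (hTm.comp measurable_prodMk_left) _
        · exact hTm.lintegral_prod_right'
    _ = (∫⁻ y, ∫⁻ z, T y z) + ∫⁻ y, ∫⁻ z, T y z := by
        congr 1
        exact lintegral_lintegral_swap (hTm.comp measurable_swap).aemeasurable
    _ ≤ ENNReal.ofReal (5 * c) * N ^ (5 / 3 : ℝ) + ENNReal.ofReal (5 * c) * N ^ (5 / 3 : ℝ) :=
        add_le_add hTI hTI
    _ = _ := by
        rw [← add_mul, ← ENNReal.ofReal_add (by positivity) (by positivity)]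
        congr 2; ring

/-- The Hardy–Littlewood–Sobolev inequality for the Riesz potential of order one. -/
theorem riesz_le (hg0 : ∀ y, 0 ≤ g y) (hg : Measurable g) :
    ∫⁻ x : Space, (∫⁻ y, ENNReal.ofReal (‖x - y‖ ^ (-2 : ℝ)) * ENNReal.ofReal (g y)) ^ 2 ≤
      ENNReal.ofReal (80 * sphereArea * (sphereArea / 2 + 1)) *
        (∫⁻ y, ENNReal.ofReal (g y ^ (6 / 5 : ℝ))) ^ (5 / 3 : ℝ) := by
  have hS := sphereArea_nonneg
  set k : Space → ℝ≥0∞ := fun z => ENNReal.ofReal (‖z‖ ^ (-2 : ℝ)) with hk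
  set G : Space → ℝ≥0∞ := fun y => ENNReal.ofReal (g y) with hG
  have hkm : Measurable k := by fun_prop
  have hGm : Measurable G := by fun_prop
  have hae : ∀ y : Space, ∀ᵐ z : Space, z ≠ y := fun y => by simp [ae_iff]
  -- The square is expanded into a double integral and `x` is integrated first; two Riesz kernels of
  -- order one compose to the Newton kernel, and the claim becomes the Newtonian energy bound.
  calc _ = ∫⁻ x : Space, ∫⁻ y, ∫⁻ z, k (x - y) * G y * (k (x - z) * G z) := by
        refine lintegral_congr fun x => ?_
        rw [sq, ← lintegral_mul_const _ (by fun_prop)]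
        refine lintegral_congr fun y => ?_
        rw [lintegral_const_mul _ (by fun_prop)]
    _ = ∫⁻ y, ∫⁻ x : Space, ∫⁻ z, k (x - y) * G y * (k (x - z) * G z) := by
        refine lintegral_lintegral_swap (Measurable.aemeasurable ?_)
        refine Measurable.lintegral_prod_right'
          (f := fun q : (Space × Space) × Space => k (q.1.1 - q.1.2) * G q.1.2 *
            (k (q.1.1 - q.2) * G q.2)) ?_
        fun_prop
    _ = ∫⁻ y, ∫⁻ z, ∫⁻ x : Space, k (x - y) * G y * (k (x - z) * G z) := by
        refine lintegral_congr fun y => ?_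
        refine lintegral_lintegral_swap (Measurable.aemeasurable ?_)
        unfold Function.uncurry
        fun_prop
    _ ≤ ∫⁻ y, ∫⁻ z, ENNReal.ofReal (8 * sphereArea) *
          (G y * G z * ENNReal.ofReal (‖z - y‖ ^ (-1 : ℝ))) := by
        refine lintegral_mono fun y => lintegral_mono_ae ?_
        filter_upwards [hae y] with z hz
        calc ∫⁻ x : Space, k (x - y) * G y * (k (x - z) * G z)
            = ∫⁻ x : Space, (G y * G z) * (k (x - y) * k ((x - y) - (z - y))) := by
              refine lintegral_congr fun x => ?_
              rw [sub_sub_sub_cancel_right]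
              ring
          _ = (G y * G z) * ∫⁻ x : Space, k x * k (x - (z - y)) := by
              rw [lintegral_const_mul _ (by fun_prop),
                lintegral_sub_right_eq_self (fun x => k x * k (x - (z - y))) y]
          _ ≤ (G y * G z) * (ENNReal.ofReal (8 * sphereArea) *
                ENNReal.ofReal (‖z - y‖ ^ (-1 : ℝ))) :=
              mul_le_mul_right (lintegral_riesz_comp_le (sub_ne_zero.mpr hz)) _
          _ = _ := by ring
    _ = ENNReal.ofReal (8 * sphereArea) *
          ∫⁻ y, ∫⁻ z, G y * G z * ENNReal.ofReal (‖z - y‖ ^ (-1 : ℝ)) := by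
        rw [← lintegral_const_mul' _ _ ENNReal.ofReal_ne_top]
        refine lintegral_congr fun y => ?_
        rw [lintegral_const_mul' _ _ ENNReal.ofReal_ne_top]
    _ ≤ _ := by
        refine (mul_le_mul_right (newton_energy_le hg0 hg) _).trans (le_of_eq ?_)
        rw [← mul_assoc, ← ENNReal.ofReal_mul (by positivity)]
        congr 2; ring

end HLS

/-- A Schur test from `L^{6/5}` to `L²`. -/
theorem schur_le {K₁ K₃ : Space → Space → ℝ≥0∞} (h₁ : Measurable (Function.uncurry K₁))
    (h₃ : Measurable (Function.uncurry K₃)) {A B : ℝ≥0∞} (hA : ∀ x, ∫⁻ y, K₃ x y ≤ A)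
    (hB : ∀ y, ∫⁻ x, K₁ x y ≤ B) {G : Space → ℝ≥0∞} (hG : Measurable G) :
    ∫⁻ x, (∫⁻ y, K₁ x y ^ (1 / 2 : ℝ) * K₃ x y ^ (1 / 6 : ℝ) * G y) ^ 2 ≤
      A ^ (1 / 3 : ℝ) * B * (∫⁻ y, G y ^ (6 / 5 : ℝ)) ^ (5 / 3 : ℝ) := by
  set N := ∫⁻ y, G y ^ (6 / 5 : ℝ)
  have hGm : Measurable fun y => G y ^ (6 / 5 : ℝ) := by fun_prop
  have m₁ : ∀ x, Measurable (K₁ x) := fun x => h₁.comp measurable_prodMk_left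
  have m₃ : ∀ x, Measurable (K₃ x) := fun x => h₃.comp measurable_prodMk_left
  have hpt : ∀ x, (∫⁻ y, K₁ x y ^ (1 / 2 : ℝ) * K₃ x y ^ (1 / 6 : ℝ) * G y) ^ 2 ≤
      (∫⁻ y, K₁ x y * G y ^ (6 / 5 : ℝ)) * (A ^ (1 / 3 : ℝ) * N ^ (2 / 3 : ℝ)) := by
    intro x
    -- Hölder with exponents `1/2 + 1/6 + 1/3 = 1`. The powers of `G` split as `3/5 + 2/5`, the
    -- second part going entirely into the norm `N`.
    have hh := ENNReal.lintegral_prod_norm_pow_le (μ := (volume : Measure Space)) Finset.univ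
      (f := ![fun y => K₁ x y * G y ^ (6 / 5 : ℝ), K₃ x, fun y => G y ^ (6 / 5 : ℝ)])
      (p := ![1 / 2, 1 / 6, 1 / 3]) ?_ ?_ ?_
    · simp only [Fin.prod_univ_three] at hh
      simp only [Matrix.cons_val_zero, Matrix.cons_val_one, Matrix.cons_val] at hh
      have e : ∀ y, (K₁ x y * G y ^ (6 / 5 : ℝ)) ^ (1 / 2 : ℝ) * K₃ x y ^ (1 / 6 : ℝ) *
          (G y ^ (6 / 5 : ℝ)) ^ (1 / 3 : ℝ) =
          K₁ x y ^ (1 / 2 : ℝ) * K₃ x y ^ (1 / 6 : ℝ) * G y := by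
        intro y
        have : G y = G y ^ (6 / 5 * (1 / 2) : ℝ) * G y ^ (6 / 5 * (1 / 3) : ℝ) := by
          rw [← ENNReal.rpow_add_of_nonneg _ _ (by norm_num) (by norm_num)]
          norm_num
        nth_rewrite 3 [this]
        rw [ENNReal.mul_rpow_of_nonneg _ _ (by norm_num), ← ENNReal.rpow_mul, ← ENNReal.rpow_mul]
        ring
      simp only [e] at hh
      set a := ∫⁻ y, K₁ x y * G y ^ (6 / 5 : ℝ)
      calc _ ≤ (a ^ (1 / 2 : ℝ) * (∫⁻ y, K₃ x y) ^ (1 / 6 : ℝ) * N ^ (1 / 3 : ℝ)) ^ 2 := by gcongr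
        _ ≤ (a ^ (1 / 2 : ℝ) * A ^ (1 / 6 : ℝ) * N ^ (1 / 3 : ℝ)) ^ 2 := by
            gcongr
            exact hA x
        _ = _ := by
            rw [← ENNReal.rpow_two, ENNReal.mul_rpow_of_nonneg _ _ (by norm_num),
              ENNReal.mul_rpow_of_nonneg _ _ (by norm_num), ← ENNReal.rpow_mul, ← ENNReal.rpow_mul,
              ← ENNReal.rpow_mul, mul_assoc]
            norm_num
    · intro i _
      fin_cases i
      · exact ((m₁ x).mul hGm).aemeasurable
      · exact (m₃ x).aemeasurable
      · exact hGm.aemeasurable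
    · simp [Fin.sum_univ_three]; norm_num
    · intro i _
      fin_cases i <;> simp
  calc _ ≤ ∫⁻ x, (∫⁻ y, K₁ x y * G y ^ (6 / 5 : ℝ)) * (A ^ (1 / 3 : ℝ) * N ^ (2 / 3 : ℝ)) :=
        lintegral_mono hpt
    _ = (∫⁻ x, ∫⁻ y, K₁ x y * G y ^ (6 / 5 : ℝ)) * (A ^ (1 / 3 : ℝ) * N ^ (2 / 3 : ℝ)) := by
        rw [lintegral_mul_const]
        exact (h₁.mul (hGm.comp measurable_snd)).lintegral_prod_right'
    _ = (∫⁻ y, (∫⁻ x, K₁ x y) * G y ^ (6 / 5 : ℝ)) * (A ^ (1 / 3 : ℝ) * N ^ (2 / 3 : ℝ)) := by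
        rw [lintegral_lintegral_swap (h₁.mul (hGm.comp measurable_snd)).aemeasurable]
        congr 1
        refine lintegral_congr fun y => ?_
        rw [lintegral_mul_const]
        exact h₁.comp measurable_prodMk_right
    _ ≤ (∫⁻ y, B * G y ^ (6 / 5 : ℝ)) * (A ^ (1 / 3 : ℝ) * N ^ (2 / 3 : ℝ)) := by
        gcongr with y
        exact hB y
    _ = _ := by
        rw [lintegral_const_mul _ hGm]
        rw [rpow_five_thirds]
        ring

/-! ### The weighted kernel of the curl-free field minus the pure-charge field -/

/-- The gradient field `z / |z|³` of the Newton kernel, up to sign. -/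
def coulomb (z : Space) : Space := (‖z‖ ^ 3)⁻¹ • z

theorem norm_coulomb (z : Space) : ‖coulomb z‖ = ‖z‖ ^ (-2 : ℝ) := by
  rw [coulomb, norm_smul, norm_inv, norm_pow, norm_norm, Real.rpow_neg (norm_nonneg _), Real.rpow_two]
  -- At `z = 0` both sides are `0` by the conventions for inverses.
  rcases eq_or_ne ‖z‖ 0 with h | h
  · simp [h]
  · field_simp

/-- Dipole decay of the difference. With `A = |x|` and `B = |x - y| ∈ [A/2, 3A/2]` one has `B⁻³ ≤ 8
A⁻³`, and factoring `A³ - B³` gives `(19/4) · 8 = 38` for the change of the scalar factor. The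
displacement of the vector adds `8`. -/
theorem coulomb_sub_le {x y : Space} (h : 2 * ‖y‖ ≤ ‖x‖) (hx : x ≠ 0) :
    ‖coulomb (x - y) - coulomb x‖ ≤ 46 * (‖y‖ / ‖x‖ ^ 3) := by
  set A := ‖x‖ with hA
  set B := ‖x - y‖ with hB
  have hA0 : 0 < A := norm_pos_iff.mpr hx
  have hy := norm_nonneg y
  have h1 : A - B ≤ ‖y‖ := by
    have := norm_sub_norm_le x (x - y)
    rwa [sub_sub_cancel] at this
  have h2 : B - A ≤ ‖y‖ := by
    have := norm_sub_le x y
    linarith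
  have hB0 : A / 2 ≤ B := by linarith
  have hB1 : B ≤ 3 / 2 * A := by linarith
  have hBpos : 0 < B := by linarith
  have e : coulomb (x - y) - coulomb x = ((B ^ 3)⁻¹ - (A ^ 3)⁻¹) • x - (B ^ 3)⁻¹ • y := by
    rw [coulomb, coulomb, smul_sub, sub_smul]
    abel
  have hBinv : (B ^ 3)⁻¹ ≤ 8 * (A ^ 3)⁻¹ := by
    have h8 : (8 : ℝ) * (A ^ 3)⁻¹ = ((A / 2) ^ 3)⁻¹ := by field_simp; norm_num
    rw [h8]
    gcongr
  have hdiff : |(B ^ 3)⁻¹ - (A ^ 3)⁻¹| ≤ 38 * ‖y‖ / A ^ 4 := by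
    have e2 : (B ^ 3)⁻¹ - (A ^ 3)⁻¹ = (A - B) * ((A ^ 2 + A * B + B ^ 2) * ((A ^ 3)⁻¹ * (B ^ 3)⁻¹)) := by
      field_simp
      ring
    rw [e2, abs_mul, abs_of_nonneg (a := (A ^ 2 + A * B + B ^ 2) * _) (by positivity)]
    have e3 : A ^ 2 + A * B + B ^ 2 ≤ 19 / 4 * A ^ 2 := by nlinarith
    calc |A - B| * ((A ^ 2 + A * B + B ^ 2) * ((A ^ 3)⁻¹ * (B ^ 3)⁻¹))
        ≤ ‖y‖ * ((19 / 4 * A ^ 2) * ((A ^ 3)⁻¹ * (8 * (A ^ 3)⁻¹))) := by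
          gcongr
          exact abs_le.mpr ⟨by linarith, h1⟩
      _ = _ := by field_simp; ring
  rw [e]
  calc _ ≤ ‖((B ^ 3)⁻¹ - (A ^ 3)⁻¹) • x‖ + ‖(B ^ 3)⁻¹ • y‖ := norm_sub_le _ _
    _ = |(B ^ 3)⁻¹ - (A ^ 3)⁻¹| * A + (B ^ 3)⁻¹ * ‖y‖ := by
        rw [norm_smul, norm_smul, Real.norm_eq_abs, Real.norm_eq_abs,
          abs_of_nonneg (a := (B ^ 3)⁻¹) (by positivity)]
    _ ≤ 38 * ‖y‖ / A ^ 4 * A + 8 * (A ^ 3)⁻¹ * ‖y‖ := by gcongr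
    _ = _ := by field_simp; ring

/-- The kernel of `∇φ - Ē`, up to the factor `4π`. -/
def excessKernel (χ : ℝ → ℝ) (x y : Space) : Space :=
  coulomb (x - y) - χ (‖x‖ - 2) • coulomb x

/-- A bounded comparison of two scales. -/
def scaleMin (δ r : ℝ) : ℝ := min (r ^ δ) (r⁻¹ ^ δ)

/-- The kernel concentrated on comparable scales. -/
def annulusKernel (δ X Y : ℝ) : ℝ := X ^ (-2 : ℝ) * ((X / Y) ^ (1 / 2 : ℝ) * scaleMin δ (X / Y) ^ (2 / 3 : ℝ))

theorem scaleMin_nonneg {δ r : ℝ} (hr : 0 ≤ r) : 0 ≤ scaleMin δ r := by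
  unfold scaleMin; positivity

/-- For `r ≤ 1` the surplus `a - 1/2 ≥ δ` provides the decay `r^{2δ/3}` towards small scales; this
is where the lower bound on the weight is used. For `1 ≤ r ≤ 2` only constants are lost. -/
theorem rpow_le_scaleMin_of_le_two {δ a r : ℝ} (hδ : 0 < δ) (hδ1 : δ ≤ 1) (ha : 1 / 2 + δ ≤ a)
    (ha2 : a ≤ 3 / 2) (hr : 0 < r) (hr2 : r ≤ 2) :
    r ^ a ≤ 4 * (r ^ (1 / 2 : ℝ) * scaleMin δ r ^ (2 / 3 : ℝ)) := by
  have hsplit : r ^ a = r ^ (1 / 2 : ℝ) * r ^ (a - 1 / 2) := by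
    rw [← Real.rpow_add hr]; ring_nf
  rw [hsplit, mul_left_comm]
  refine mul_le_mul_of_nonneg_left ?_ (by positivity)
  rcases le_total r 1 with h | h
  · have hm : scaleMin δ r = r ^ δ := by
      rw [scaleMin, Real.inv_rpow hr.le, min_eq_left]
      have : r ^ δ ≤ 1 := Real.rpow_le_one hr.le h hδ.le
      exact this.trans (one_le_inv_iff₀.mpr ⟨by positivity, this⟩)
    rw [hm, ← Real.rpow_mul hr.le]
    have h1 : r ^ (a - 1 / 2) ≤ r ^ (δ * (2 / 3)) :=
      Real.rpow_le_rpow_of_exponent_ge hr h (by linarith)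
    have h2 : 0 ≤ r ^ (δ * (2 / 3)) := by positivity
    linarith
  · have hm : scaleMin δ r = r ^ (-δ) := by
      rw [scaleMin, Real.inv_rpow hr.le, ← Real.rpow_neg hr.le, min_eq_right]
      exact Real.rpow_le_rpow_of_exponent_le h (by linarith)
    rw [hm, ← Real.rpow_mul hr.le]
    have h1 : r ^ (a - 1 / 2) ≤ 2 := by
      calc r ^ (a - 1 / 2) ≤ r ^ (1 : ℝ) := Real.rpow_le_rpow_of_exponent_le h (by linarith)
        _ ≤ 2 := by rwa [Real.rpow_one]
    have h2 : 1 / 2 ≤ r ^ (-δ * (2 / 3)) := by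
      calc (1 / 2 : ℝ) ≤ r ^ (-1 : ℝ) := by
            rw [Real.rpow_neg_one, one_div]; exact inv_anti₀ hr hr2
        _ ≤ _ := Real.rpow_le_rpow_of_exponent_le h (by linarith)
    linarith

/-- For large `r` the exponent `a - 1`, already reduced by one through the dipole cancellation, must
stay below `1/2 - 2δ/3`. This is where `a ≤ 3/2 - δ` is used. -/
theorem rpow_le_scaleMin_of_one_le {δ a r : ℝ} (hδ : 0 < δ) (ha2 : a ≤ 3 / 2 - δ) (hr : 1 ≤ r) :
    r ^ (a - 1) ≤ r ^ (1 / 2 : ℝ) * scaleMin δ r ^ (2 / 3 : ℝ) := by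
  have hr0 : 0 < r := by linarith
  have hm : scaleMin δ r = r ^ (-δ) := by
    rw [scaleMin, Real.inv_rpow hr0.le, ← Real.rpow_neg hr0.le, min_eq_right]
    exact Real.rpow_le_rpow_of_exponent_le hr (by linarith)
  rw [hm, ← Real.rpow_mul hr0.le, ← Real.rpow_add hr0]
  exact Real.rpow_le_rpow_of_exponent_le hr (by linarith)

/-- Three regimes. If `|x| < 2|y|`, the ratio of weights is bounded and the two parts of the kernel
are estimated separately. If `2|y| ≤ |x| < 3`, all weights are bounded and both parts are of the
order of `|x - y|^{-2}`. If `|x| ≥ 3` and `|x| ≥ 2|y|`, the step equals one, the parts cancel to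
order `Y / X³`, and `r^a Y / X³ = X^{-2} r^{a-1}` with `r = X / Y`. -/
theorem excessKernel_le {χ : ℝ → ℝ} (hχ : IsSmoothStep χ) {δ a : ℝ} (hδ : 0 < δ) (hδ1 : δ ≤ 1)
    (ha : 1 / 2 + δ ≤ a) (ha2 : a ≤ 3 / 2 - δ) {x y : Space} (hxy : x ≠ y) :
    (1 + ‖x‖) ^ a * ‖excessKernel χ x y‖ * (1 + ‖y‖) ^ (-a) ≤
      120 * (‖x - y‖ ^ (-2 : ℝ) + annulusKernel δ (1 + ‖x‖) (1 + ‖y‖)) := by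
  set X := 1 + ‖x‖ with hX
  set Y := 1 + ‖y‖ with hY
  have hX1 : 1 ≤ X := by linarith [norm_nonneg x]
  have hY1 : 1 ≤ Y := by linarith [norm_nonneg y]
  have hX0 : 0 < X := by linarith
  have hY0 : 0 < Y := by linarith
  set r := X / Y with hr
  have hr0 : 0 < r := by positivity
  set S := r ^ (1 / 2 : ℝ) * scaleMin δ r ^ (2 / 3 : ℝ) with hS
  have hS0 : 0 ≤ S := mul_nonneg (by positivity) (Real.rpow_nonneg (scaleMin_nonneg hr0.le) _)
  have hann : annulusKernel δ X Y = X ^ (-2 : ℝ) * S := rfl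
  have hra : X ^ a * Y ^ (-a) = r ^ a := by
    rw [hr, Real.div_rpow hX0.le hY0.le, Real.rpow_neg hY0.le, div_eq_mul_inv]
  have hform : (1 + ‖x‖) ^ a * ‖excessKernel χ x y‖ * (1 + ‖y‖) ^ (-a) =
      r ^ a * ‖excessKernel χ x y‖ := by rw [← hra]; ring
  have hd0 : 0 < ‖x - y‖ := norm_pos_iff.mpr (sub_ne_zero.mpr hxy)
  set D := ‖x - y‖ ^ (-2 : ℝ) with hD
  have hD0 : 0 ≤ D := by positivity
  have hXS : 0 ≤ X ^ (-2 : ℝ) * S := by positivity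
  have hχ0 := hχ.nonneg (‖x‖ - 2)
  have hχ1 := hχ.le_one (‖x‖ - 2)
  have hk : ‖excessKernel χ x y‖ ≤ D + χ (‖x‖ - 2) * ‖x‖ ^ (-2 : ℝ) := by
    refine (norm_sub_le _ _).trans (le_of_eq ?_)
    rw [norm_smul, norm_coulomb, norm_coulomb, Real.norm_eq_abs, abs_of_nonneg hχ0]
  change (1 + ‖x‖) ^ a * ‖excessKernel χ x y‖ * (1 + ‖y‖) ^ (-a) ≤ 120 * (D + annulusKernel δ X Y)
  rw [hform, hann]
  by_cases h1 : ‖x‖ < 2 * ‖y‖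
  · have hr2 : r ≤ 2 := by
      rw [hr, div_le_iff₀ hY0]; linarith
    have hrS := rpow_le_scaleMin_of_le_two hδ hδ1 ha (by linarith) hr0 hr2
    have hr4 : r ^ a ≤ 4 := by
      calc r ^ a ≤ 2 ^ a := Real.rpow_le_rpow hr0.le hr2 (by linarith)
        _ ≤ 2 ^ (2 : ℝ) := Real.rpow_le_rpow_of_exponent_le (by norm_num) (by linarith)
        _ = 4 := by norm_num
    have hra0 : 0 ≤ r ^ a := by positivity
    have h2 : χ (‖x‖ - 2) * ‖x‖ ^ (-2 : ℝ) ≤ 9 / 4 * X ^ (-2 : ℝ) := by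
      by_cases h : ‖x‖ ≤ 2
      · rw [hχ.eq_zero _ (by linarith), zero_mul]; positivity
      · have hx2 : 2 < ‖x‖ := not_le.mp h
        refine (mul_le_of_le_one_left (by positivity) hχ1).trans ?_
        rw [Real.rpow_neg (norm_nonneg _), Real.rpow_neg hX0.le, Real.rpow_two, Real.rpow_two,
          ← div_eq_mul_inv, inv_eq_one_div, div_le_div_iff₀ (by positivity) (by positivity)]
        nlinarith
    calc _ ≤ r ^ a * (D + 9 / 4 * X ^ (-2 : ℝ)) := by gcongr; linarith
      _ = r ^ a * D + r ^ a * (9 / 4 * X ^ (-2 : ℝ)) := by ring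
      _ ≤ 4 * D + (4 * S) * (9 / 4 * X ^ (-2 : ℝ)) := by gcongr
      _ ≤ _ := by linarith
  · rw [not_lt] at h1
    by_cases h3 : ‖x‖ < 3
    · have hx0 : 0 < ‖x‖ := by
        by_contra hcon
        have e1 : ‖x‖ = 0 := le_antisymm (not_lt.mp hcon) (norm_nonneg _)
        have e2 : ‖y‖ = 0 := le_antisymm (by linarith) (norm_nonneg _)
        exact hxy ((norm_eq_zero.mp e1).trans (norm_eq_zero.mp e2).symm)
      have hr4 : r ≤ 4 := by
        rw [hr, div_le_iff₀ hY0]; linarith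
      have hr16 : r ^ a ≤ 16 := by
        calc r ^ a ≤ 4 ^ a := Real.rpow_le_rpow hr0.le hr4 (by linarith)
          _ ≤ 4 ^ (2 : ℝ) := Real.rpow_le_rpow_of_exponent_le (by norm_num) (by linarith)
          _ = 16 := by norm_num
      have hxd : ‖x - y‖ ≤ 3 / 2 * ‖x‖ := by
        have := norm_sub_le x y
        linarith
      have h2 : χ (‖x‖ - 2) * ‖x‖ ^ (-2 : ℝ) ≤ 9 / 4 * D := by
        refine (mul_le_of_le_one_left (by positivity) hχ1).trans ?_
        rw [hD, Real.rpow_neg (norm_nonneg _), Real.rpow_neg hd0.le, Real.rpow_two, Real.rpow_two,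
          ← div_eq_mul_inv, inv_eq_one_div, div_le_div_iff₀ (by positivity) (by positivity)]
        nlinarith
      calc _ ≤ r ^ a * (13 / 4 * D) := by gcongr; linarith
        _ ≤ 16 * (13 / 4 * D) := by gcongr
        _ ≤ _ := by linarith
    · rw [not_lt] at h3
      have hx : x ≠ 0 := norm_pos_iff.mp (by linarith)
      have hx0 : 0 < ‖x‖ := norm_pos_iff.mpr hx
      have hr1 : 1 ≤ r := by
        rw [hr, le_div_iff₀ hY0]; linarith [norm_nonneg y]
      have hex : ‖excessKernel χ x y‖ ≤ 120 * (Y / X ^ 3) := by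
        rw [excessKernel, hχ.eq_one _ (by linarith), one_smul]
        refine (coulomb_sub_le h1 hx).trans ?_
        have hXx : X ≤ 4 / 3 * ‖x‖ := by linarith
        have hx3 : X ^ 3 ≤ 64 / 27 * ‖x‖ ^ 3 := by
          calc X ^ 3 ≤ (4 / 3 * ‖x‖) ^ 3 := by gcongr
            _ = _ := by ring
        rw [mul_div_assoc', mul_div_assoc', div_le_div_iff₀ (by positivity) (by positivity)]
        have hyY : ‖y‖ ≤ Y := by linarith
        calc 46 * ‖y‖ * X ^ 3 ≤ 46 * Y * (64 / 27 * ‖x‖ ^ 3) := by gcongr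
          _ ≤ 120 * Y * ‖x‖ ^ 3 := by
              have : 0 ≤ Y * ‖x‖ ^ 3 := by positivity
              nlinarith
      have hrS := rpow_le_scaleMin_of_one_le hδ ha2 hr1
      have e : r ^ a * (Y / X ^ 3) = X ^ (-2 : ℝ) * r ^ (a - 1) := by
        rw [Real.rpow_sub hr0, Real.rpow_one, Real.rpow_neg hX0.le, Real.rpow_two, hr]
        field_simp
      calc _ ≤ r ^ a * (120 * (Y / X ^ 3)) := by gcongr
        _ = 120 * (X ^ (-2 : ℝ) * r ^ (a - 1)) := by rw [← e]; ring
        _ ≤ 120 * (X ^ (-2 : ℝ) * S) := by gcongr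
        _ ≤ _ := by linarith

/-- The factorization required by the Schur test: `X^{-3/2} Y^{-1/2} = X^{-2} (X/Y)^{1/2}`, and `1/2
+ 1/6 = 2/3` is the exponent of the scale factor. Both factors are built on the scale-invariant
density `(1 + |x|)^{-3}`, whose integral against `scaleMin` is bounded uniformly in the other
variable. -/
theorem annulusKernel_eq {δ X Y : ℝ} (hX : 0 < X) (hY : 0 < Y) :
    ENNReal.ofReal (annulusKernel δ X Y) =
      ENNReal.ofReal (X ^ (-3 : ℝ) * scaleMin δ (X / Y)) ^ (1 / 2 : ℝ) *
      ENNReal.ofReal (Y ^ (-3 : ℝ) * scaleMin δ (X / Y)) ^ (1 / 6 : ℝ) := by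
  have hm := scaleMin_nonneg (δ := δ) (div_nonneg hX.le hY.le)
  set m := scaleMin δ (X / Y) with hmd
  rw [ENNReal.ofReal_rpow_of_nonneg (by positivity) (by norm_num),
    ENNReal.ofReal_rpow_of_nonneg (by positivity) (by norm_num), ← ENNReal.ofReal_mul (by positivity)]
  congr 1
  rw [Real.mul_rpow (by positivity) hm, Real.mul_rpow (by positivity) hm, ← Real.rpow_mul hX.le,
    ← Real.rpow_mul hY.le, annulusKernel, Real.div_rpow hX.le hY.le, ← hmd]
  have e1 : m ^ (2 / 3 : ℝ) = m ^ (1 / 2 : ℝ) * m ^ (1 / 6 : ℝ) := by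
    rw [← Real.rpow_add_of_nonneg hm (by norm_num) (by norm_num)]; norm_num
  have e2 : X ^ (-3 * (1 / 2) : ℝ) = X ^ (-2 : ℝ) * X ^ (1 / 2 : ℝ) := by
    rw [← Real.rpow_add hX]; norm_num
  have e3 : Y ^ (-3 * (1 / 6) : ℝ) = (Y ^ (1 / 2 : ℝ))⁻¹ := by
    rw [← Real.rpow_neg hY.le]; norm_num
  rw [e1, e2, e3]
  ring

theorem scaleMin_comm {δ X Y : ℝ} : scaleMin δ (X / Y) = scaleMin δ (Y / X) := by
  rw [scaleMin, scaleMin, inv_div, inv_div, min_comm]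

theorem lintegral_scaleMin_le {δ Y : ℝ} (hδ : 0 < δ) (hδ1 : δ ≤ 1) (hY : 0 < Y) :
    ∫⁻ x : Space, ENNReal.ofReal ((1 + ‖x‖) ^ (-3 : ℝ) * scaleMin δ ((1 + ‖x‖) / Y)) ≤
      ENNReal.ofReal (2 * sphereArea / δ) := by
  have := lintegral_annuli_le hδ (by linarith) hY
  simpa only [scaleMin, inv_div] using this

theorem annulusKernel_nonneg {δ X Y : ℝ} (hX : 0 ≤ X) (hY : 0 ≤ Y) : 0 ≤ annulusKernel δ X Y :=
  mul_nonneg (by positivity) (mul_nonneg (by positivity)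
    (Real.rpow_nonneg (scaleMin_nonneg (div_nonneg hX hY)) _))

/-- The weighted `L^{6/5}`–`L²` estimate for the kernel of `∇φ - Ē`. -/
theorem exists_excessKernel_bound {χ : ℝ → ℝ} (hχ : IsSmoothStep χ) {δ : ℝ} (hδ : 0 < δ)
    (hδ1 : δ ≤ 1) : ∃ C : ℝ, 0 ≤ C ∧ ∀ a : ℝ, 1 / 2 + δ ≤ a → a ≤ 3 / 2 - δ →
      ∀ g : Space → ℝ, (∀ y, 0 ≤ g y) → Measurable g →
      ∫⁻ x : Space, (∫⁻ y, ENNReal.ofReal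
          ((1 + ‖x‖) ^ a * ‖excessKernel χ x y‖ * (1 + ‖y‖) ^ (-a)) * ENNReal.ofReal (g y)) ^ 2 ≤
        ENNReal.ofReal C * (∫⁻ y, ENNReal.ofReal (g y ^ (6 / 5 : ℝ))) ^ (5 / 3 : ℝ) := by
  have hA := sphereArea_nonneg
  set C₁ := 80 * sphereArea * (sphereArea / 2 + 1) with hC₁
  set A := 2 * sphereArea / δ with hAd
  have hA0 : 0 ≤ A := by positivity
  -- `120` comes from the pointwise kernel bound, the factor `2` from `(p + h)² ≤ 2 (p² + h²)`, and
  -- the sum from Hardy–Littlewood–Sobolev for `p` and the Schur test for `h`.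
  refine ⟨120 ^ 2 * (2 * (C₁ + A ^ (1 / 3 : ℝ) * A)), by positivity, fun a ha ha2 g hg0 hg => ?_⟩
  set N := ∫⁻ y, ENNReal.ofReal (g y ^ (6 / 5 : ℝ)) with hN
  set G : Space → ℝ≥0∞ := fun y => ENNReal.ofReal (g y) with hG
  have hGm : Measurable G := by fun_prop
  have hGN : ∫⁻ y, G y ^ (6 / 5 : ℝ) = N := lintegral_congr fun y =>
    ENNReal.ofReal_rpow_of_nonneg (hg0 y) (by norm_num)
  set p : Space → ℝ≥0∞ := fun x => ∫⁻ y, ENNReal.ofReal (‖x - y‖ ^ (-2 : ℝ)) * G y with hp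
  set h : Space → ℝ≥0∞ := fun x =>
    ∫⁻ y, ENNReal.ofReal (annulusKernel δ (1 + ‖x‖) (1 + ‖y‖)) * G y with hh
  have hp2 : ∫⁻ x, p x ^ 2 ≤ ENNReal.ofReal C₁ * N ^ (5 / 3 : ℝ) := riesz_le hg0 hg
  have mS : Measurable fun q : Space × Space => scaleMin δ ((1 + ‖q.1‖) / (1 + ‖q.2‖)) := by
    unfold scaleMin
    fun_prop
  have m₁ : Measurable (Function.uncurry fun x y : Space => ENNReal.ofReal
      ((1 + ‖x‖) ^ (-3 : ℝ) * scaleMin δ ((1 + ‖x‖) / (1 + ‖y‖)))) := by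
    refine Measurable.ennreal_ofReal (Measurable.mul ?_ mS)
    fun_prop
  have m₃ : Measurable (Function.uncurry fun x y : Space => ENNReal.ofReal
      ((1 + ‖y‖) ^ (-3 : ℝ) * scaleMin δ ((1 + ‖x‖) / (1 + ‖y‖)))) := by
    refine Measurable.ennreal_ofReal (Measurable.mul ?_ mS)
    fun_prop
  have hh2 : ∫⁻ x, h x ^ 2 ≤ ENNReal.ofReal (A ^ (1 / 3 : ℝ) * A) * N ^ (5 / 3 : ℝ) := by
    have := schur_le m₁ m₃ (A := ENNReal.ofReal A) (B := ENNReal.ofReal A)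
      (fun x => by
        simp only [scaleMin_comm (X := 1 + ‖x‖)]
        exact lintegral_scaleMin_le hδ hδ1 (by positivity))
      (fun y => lintegral_scaleMin_le hδ hδ1 (by positivity)) hGm
    rw [hGN, ENNReal.ofReal_rpow_of_nonneg hA0 (by norm_num),
      ← ENNReal.ofReal_mul (by positivity)] at this
    refine le_trans (le_of_eq (lintegral_congr fun x => ?_)) this
    simp only [hh]
    congr 1
    refine lintegral_congr fun y => ?_
    rw [annulusKernel_eq (by positivity) (by positivity)]
  have hpm : Measurable p := by
    refine Measurable.lintegral_prod_right'
      (f := fun q : Space × Space => ENNReal.ofReal (‖q.1 - q.2‖ ^ (-2 : ℝ)) * G q.2) ?_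
    fun_prop
  have hpt : ∀ x, ∫⁻ y, ENNReal.ofReal
      ((1 + ‖x‖) ^ a * ‖excessKernel χ x y‖ * (1 + ‖y‖) ^ (-a)) * G y ≤
      ENNReal.ofReal 120 * (p x + h x) := by
    intro x
    have hae : ∀ᵐ y : Space, y ≠ x := by simp [ae_iff]
    rw [← lintegral_add_left (by fun_prop), ← lintegral_const_mul' _ _ ENNReal.ofReal_ne_top]
    refine lintegral_mono_ae ?_
    filter_upwards [hae] with y hy
    rw [← add_mul, ← mul_assoc]
    refine mul_le_mul_left ?_ _
    rw [← ENNReal.ofReal_add (by positivity) (annulusKernel_nonneg (by positivity) (by positivity)),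
      ← ENNReal.ofReal_mul (by norm_num)]
    exact ENNReal.ofReal_le_ofReal (excessKernel_le hχ hδ hδ1 ha ha2 hy.symm)
  calc _ ≤ ∫⁻ x, (ENNReal.ofReal 120 * (p x + h x)) ^ 2 := by
        refine lintegral_mono fun x => ?_
        gcongr
        exact hpt x
    _ ≤ ∫⁻ x, ENNReal.ofReal (120 ^ 2 * 2) * (p x ^ 2 + h x ^ 2) := by
        refine lintegral_mono fun x => ?_
        rw [mul_pow, ENNReal.ofReal_mul (by norm_num), ENNReal.ofReal_pow (by norm_num), mul_assoc]
        refine mul_le_mul_right ?_ _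
        have := ENNReal.rpow_add_le_mul_rpow_add_rpow (p x) (h x) (p := 2) (by norm_num)
        simp only [ENNReal.rpow_two] at this
        norm_num at this ⊢
        exact this
    _ = ENNReal.ofReal (120 ^ 2 * 2) * ((∫⁻ x, p x ^ 2) + ∫⁻ x, h x ^ 2) := by
        rw [lintegral_const_mul' _ _ ENNReal.ofReal_ne_top, lintegral_add_left (by fun_prop)]
    _ ≤ ENNReal.ofReal (120 ^ 2 * 2) * (ENNReal.ofReal C₁ * N ^ (5 / 3 : ℝ)
          + ENNReal.ofReal (A ^ (1 / 3 : ℝ) * A) * N ^ (5 / 3 : ℝ)) := by gcongr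
    _ = _ := by
        rw [← add_mul, ← mul_assoc, ← ENNReal.ofReal_add (by positivity) (by positivity),
          ← ENNReal.ofReal_mul (by norm_num)]
        congr 2
        ring

/-- The `L¹` norm is controlled by the weighted `L^{6/5}` norm. -/
theorem exists_lintegral_le {δ : ℝ} (hδ : 0 < δ) : ∃ C : ℝ, 0 ≤ C ∧ ∀ a : ℝ, 1 / 2 + δ ≤ a →
    ∀ g : Space → ℝ, (∀ y, 0 ≤ g y) → Measurable g →
      ∫⁻ y, ENNReal.ofReal ((1 + ‖y‖) ^ (-a) * g y) ≤
        ENNReal.ofReal C * (∫⁻ y, ENNReal.ofReal (g y ^ (6 / 5 : ℝ))) ^ (5 / 6 : ℝ) := by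
  set I := ∫⁻ y : Space, ENNReal.ofReal ((1 + ‖y‖) ^ (-(3 + 6 * δ))) with hI
  -- Hölder with exponents `6` and `6/5` requires integrability of `(1 + |y|)^{-6a}`; since `6a ≥ 3
  -- + 6δ` it is dominated by this integral, whose exponent exceeds the dimension.
  have hIfin : I < ⊤ := finite_integral_one_add_norm (by simp; linarith)
  refine ⟨(I ^ (1 / 6 : ℝ)).toReal, ENNReal.toReal_nonneg, fun a ha g hg0 hg => ?_⟩
  have hIr : I ^ (1 / 6 : ℝ) ≠ ⊤ := ENNReal.rpow_ne_top_of_nonneg (by norm_num) hIfin.ne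
  rw [ENNReal.ofReal_toReal hIr]
  have hpq : (6 : ℝ).HolderConjugate (6 / 5) := by
    rw [Real.holderConjugate_iff]; norm_num
  have hmX : Measurable fun y : Space => ENNReal.ofReal ((1 + ‖y‖) ^ (-a)) := by fun_prop
  have := ENNReal.lintegral_mul_le_Lp_mul_Lq (volume : Measure Space) hpq
    (f := fun y => ENNReal.ofReal ((1 + ‖y‖) ^ (-a))) (g := fun y => ENNReal.ofReal (g y))
    hmX.aemeasurable (by fun_prop)
  calc _ = ∫⁻ y, ENNReal.ofReal ((1 + ‖y‖) ^ (-a)) * ENNReal.ofReal (g y) :=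
        lintegral_congr fun y => ENNReal.ofReal_mul (by positivity)
    _ ≤ _ := this
    _ ≤ _ := by
        have e : ∀ y, ENNReal.ofReal (g y) ^ (6 / 5 : ℝ) = ENNReal.ofReal (g y ^ (6 / 5 : ℝ)) :=
          fun y => ENNReal.ofReal_rpow_of_nonneg (hg0 y) (by norm_num)
        simp only [e]
        have e2 : (1 : ℝ) / (6 / 5) = 5 / 6 := by norm_num
        rw [e2]
        refine mul_le_mul_left ?_ _
        refine ENNReal.rpow_le_rpow ?_ (by norm_num)
        refine lintegral_mono fun y => ?_
        have hy : 1 ≤ 1 + ‖y‖ := by linarith [norm_nonneg y]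
        rw [ENNReal.ofReal_rpow_of_nonneg (by positivity) (by norm_num), ← Real.rpow_mul (by positivity)]
        exact ENNReal.ofReal_le_ofReal (Real.rpow_le_rpow_of_exponent_le hy (by linarith))

/-! ### The gradient of the Newtonian potential -/

theorem inner_coulomb (z h : Space) : inner ℝ (coulomb z) h = (‖z‖ ^ 3)⁻¹ * inner ℝ z h := by
  rw [coulomb, real_inner_smul_left]

/-- The quadratic Taylor remainder `|h|² / |z|³` is not locally integrable in `z`. Interpolating
with the trivial bounds available for `|h| > |z| / 2` gives `|h|^{3/2}` times a power `-5/2`, which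
is locally integrable and still `o(|h|)`. -/
theorem newton_taylor {z h : Space} (hz : z ≠ 0) (hzh : z + h ≠ 0) :
    |‖z + h‖⁻¹ - ‖z‖⁻¹ + inner ℝ (coulomb z) h| ≤
      6 * ‖h‖ ^ (3 / 2 : ℝ) * (‖z‖ ^ (-(5 / 2) : ℝ) + ‖z + h‖ ^ (-(5 / 2) : ℝ)) := by
  set A := ‖z‖ with hA
  set B := ‖z + h‖ with hB
  set H := ‖h‖ with hH
  have hA0 : 0 < A := norm_pos_iff.mpr hz
  have hB0 : 0 < B := norm_pos_iff.mpr hzh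
  have hH0 : 0 ≤ H := norm_nonneg h
  have h1 : A - B ≤ H := by
    have := norm_sub_le (z + h) h
    rw [add_sub_cancel_right] at this
    linarith
  have h2 : B - A ≤ H := by
    have := norm_add_le z h
    linarith
  have hH32 : 0 ≤ H ^ (3 / 2 : ℝ) := by positivity
  have hA52 : 0 ≤ A ^ (-(5 / 2) : ℝ) := by positivity
  have hB52 : 0 ≤ B ^ (-(5 / 2) : ℝ) := by positivity
  have hinner : inner ℝ z h = (B ^ 2 - A ^ 2 - H ^ 2) / 2 := by
    have := norm_add_sq_real z h
    rw [hA, hB, hH]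
    linarith
  rw [inner_coulomb, hinner]
  -- For small `h` the Taylor expression is computed exactly and one half power of `H` is traded for
  -- one of `A`. Otherwise `A ≤ 2H` and `B ≤ 3H`, and the three terms are bounded one by one.
  by_cases hcase : H ≤ A / 2
  · have hBA : A / 2 ≤ B := by linarith
    have e : B⁻¹ - A⁻¹ + (A ^ 3)⁻¹ * ((B ^ 2 - A ^ 2 - H ^ 2) / 2) =
        ((B - A) ^ 2 * ((B + 2 * A) / B) - H ^ 2) / (2 * A ^ 3) := by
      field_simp
      ring
    have hq : (B + 2 * A) / B ≤ 5 := by rw [div_le_iff₀ hB0]; linarith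
    have hq0 : 0 ≤ (B + 2 * A) / B := by positivity
    have hsq : (B - A) ^ 2 ≤ H ^ 2 := sq_le_sq' (by linarith) h2
    have hnum : |(B - A) ^ 2 * ((B + 2 * A) / B) - H ^ 2| ≤ 5 * H ^ 2 := by
      have h3 : (B - A) ^ 2 * ((B + 2 * A) / B) ≤ H ^ 2 * 5 := by gcongr
      have h4 : 0 ≤ (B - A) ^ 2 * ((B + 2 * A) / B) := by positivity
      rw [abs_le]
      constructor <;> nlinarith [sq_nonneg H]
    have hHs : H ^ 2 = H ^ (3 / 2 : ℝ) * H ^ (1 / 2 : ℝ) := by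
      rw [← Real.rpow_add_of_nonneg hH0 (by norm_num) (by norm_num), ← Real.rpow_two]
      norm_num
    have hAs : (A ^ 3)⁻¹ * A ^ (1 / 2 : ℝ) = A ^ (-(5 / 2) : ℝ) := by
      rw [← Real.rpow_natCast, ← Real.rpow_neg hA0.le, ← Real.rpow_add hA0]
      norm_num
    have hle : H ^ (1 / 2 : ℝ) ≤ A ^ (1 / 2 : ℝ) :=
      Real.rpow_le_rpow hH0 (by linarith) (by norm_num)
    rw [e, abs_div, abs_of_pos (a := 2 * A ^ 3) (by positivity)]
    calc _ ≤ 5 * H ^ 2 / (2 * A ^ 3) := by gcongr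
      _ = 5 / 2 * H ^ (3 / 2 : ℝ) * ((A ^ 3)⁻¹ * H ^ (1 / 2 : ℝ)) := by
          rw [hHs]; field_simp
      _ ≤ 5 / 2 * H ^ (3 / 2 : ℝ) * ((A ^ 3)⁻¹ * A ^ (1 / 2 : ℝ)) := by gcongr
      _ ≤ _ := by
          rw [hAs]
          have := mul_nonneg hH32 hA52
          have := mul_nonneg hH32 hB52
          nlinarith
  · rw [not_le] at hcase
    have hHpos : 0 < H := by linarith
    have hsplit : ∀ {R : ℝ}, 0 < R → R⁻¹ = R ^ (-(5 / 2) : ℝ) * R ^ (3 / 2 : ℝ) := by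
      intro R hR
      rw [← Real.rpow_add hR, ← Real.rpow_neg_one]
      norm_num
    have hpow : ∀ {R c : ℝ}, 0 < R → 0 < c → R ≤ c * H → R⁻¹ ≤
        R ^ (-(5 / 2) : ℝ) * (c ^ (3 / 2 : ℝ) * H ^ (3 / 2 : ℝ)) := by
      intro R c hR hc h
      rw [hsplit hR, ← Real.mul_rpow hc.le hH0]
      gcongr
    have c3 : (3 : ℝ) ^ (3 / 2 : ℝ) ≤ 6 := by
      rw [show (3 / 2 : ℝ) = (1 / 2 : ℝ) * 3 by norm_num, Real.rpow_mul (by norm_num)]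
      rw [← Real.sqrt_eq_rpow]
      have h3 : Real.sqrt 3 ≤ 7 / 4 := by rw [Real.sqrt_le_left (by norm_num)]; norm_num
      calc Real.sqrt 3 ^ (3 : ℝ) ≤ (7 / 4) ^ (3 : ℝ) := by gcongr
        _ ≤ 6 := by norm_num
    have c2 : (2 : ℝ) ^ (3 / 2 : ℝ) ≤ 3 := by
      rw [show (3 / 2 : ℝ) = (1 / 2 : ℝ) * 3 by norm_num, Real.rpow_mul (by norm_num)]
      rw [← Real.sqrt_eq_rpow]
      have h3 : Real.sqrt 2 ≤ 71 / 50 := by rw [Real.sqrt_le_left (by norm_num)]; norm_num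
      calc Real.sqrt 2 ^ (3 : ℝ) ≤ (71 / 50) ^ (3 : ℝ) := by gcongr
        _ ≤ 3 := by norm_num
    have tB : B⁻¹ ≤ B ^ (-(5 / 2) : ℝ) * (6 * H ^ (3 / 2 : ℝ)) :=
      (hpow hB0 (by norm_num : (0 : ℝ) < 3) (by linarith)).trans (by gcongr)
    have tA : A⁻¹ ≤ A ^ (-(5 / 2) : ℝ) * (3 * H ^ (3 / 2 : ℝ)) :=
      (hpow hA0 (by norm_num : (0 : ℝ) < 2) (by linarith)).trans (by gcongr)
    have hI : |(A ^ 3)⁻¹ * ((B ^ 2 - A ^ 2 - H ^ 2) / 2)| ≤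
        A ^ (-(5 / 2) : ℝ) * (3 * H ^ (3 / 2 : ℝ)) := by
      have hcs : |(B ^ 2 - A ^ 2 - H ^ 2) / 2| ≤ A * H := by
        rw [← hinner]; exact abs_real_inner_le_norm z h
      rw [abs_mul, abs_of_pos (a := (A ^ 3)⁻¹) (by positivity)]
      have e1 : (A ^ 3)⁻¹ * (A * H) = A⁻¹ * (A⁻¹ * H) := by field_simp
      have e2 : A⁻¹ = A ^ (-(5 / 2) : ℝ) * (A * A ^ (1 / 2 : ℝ)) := by
        nth_rewrite 3 [← Real.rpow_one A]
        rw [← Real.rpow_add hA0, ← Real.rpow_add hA0, ← Real.rpow_neg_one]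
        norm_num
      have e3 : H ^ (3 / 2 : ℝ) = H * H ^ (1 / 2 : ℝ) := by
        nth_rewrite 2 [← Real.rpow_one H]
        rw [← Real.rpow_add hHpos]
        norm_num
      have hs : A ^ (1 / 2 : ℝ) ≤ 3 * H ^ (1 / 2 : ℝ) := by
        calc A ^ (1 / 2 : ℝ) ≤ (9 * H) ^ (1 / 2 : ℝ) := by gcongr; linarith
          _ = _ := by
            rw [Real.mul_rpow (by norm_num) hH0, ← Real.sqrt_eq_rpow 9,
              show (9 : ℝ) = 3 ^ 2 by norm_num, Real.sqrt_sq (by norm_num)]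
      calc _ ≤ (A ^ 3)⁻¹ * (A * H) := by gcongr
        _ = A ^ (-(5 / 2) : ℝ) * (A ^ (1 / 2 : ℝ) * H) := by
            rw [e1]; nth_rewrite 1 [e2]; field_simp
        _ ≤ A ^ (-(5 / 2) : ℝ) * (3 * H ^ (1 / 2 : ℝ) * H) := by gcongr
        _ = _ := by rw [e3]; ring
    have hAi : 0 ≤ A⁻¹ := by positivity
    have hBi : 0 ≤ B⁻¹ := by positivity
    rw [abs_le] at hI ⊢
    have := mul_nonneg hH32 hA52
    have := mul_nonneg hH32 hB52
    constructor <;> nlinarith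

theorem rpow_neg_le_add_one {r b c : ℝ} (hr : 0 ≤ r) (hb : 0 < b) (hbc : b ≤ c) :
    r ^ (-b) ≤ r ^ (-c) + 1 := by
  rcases hr.eq_or_lt with rfl | hr
  · rw [Real.zero_rpow (by linarith), Real.zero_rpow (by linarith)]; norm_num
  rcases le_total r 1 with h | h
  · have := Real.rpow_le_rpow_of_exponent_ge hr h (neg_le_neg hbc)
    linarith
  · have h1 := Real.rpow_le_one_of_one_le_of_nonpos h (by linarith : -b ≤ 0)
    have h2 : 0 ≤ r ^ (-c) := by positivity
    linarith

section Potential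

variable {f : Space → ℝ}

/-- Uniformity in `x` near `x₀`: within distance one of `x` the density is bounded, since all such
`y` lie in the ball of radius `2` about `x₀`, and the kernel integrates to `2 sphereArea`. Further
away the kernel is at most one and the density is integrable. -/
theorem exists_riesz_bound (hf : Continuous f) (hi : Integrable f) (x₀ : Space) :
    ∃ B : ℝ, 0 ≤ B ∧ ∀ x ∈ Metric.closedBall x₀ 1,
      Integrable (fun y => ‖x - y‖ ^ (-(5 / 2) : ℝ) * |f y|) ∧
      ∫ y, ‖x - y‖ ^ (-(5 / 2) : ℝ) * |f y| ≤ B := by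
  obtain ⟨M, hM⟩ := (isCompact_closedBall x₀ 2).exists_bound_of_continuousOn hf.continuousOn
  have hS := sphereArea_nonneg
  set M' := max M 0
  have hM'0 : 0 ≤ M' := le_max_right _ _
  refine ⟨M' * (sphereArea * 2) + ∫ y, |f y|, by positivity, fun x hx => ?_⟩
  have hmeas : AEStronglyMeasurable (fun y => ‖x - y‖ ^ (-(5 / 2) : ℝ) * |f y|) :=
    (((measurable_const.sub measurable_id).norm.pow_const _).mul hf.measurable.abs).aestronglyMeasurable
  have hS' : MeasurableSet {z : Space | ‖z‖ ≤ 1} := measurable_norm measurableSet_Iic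
  have hpt : ∀ y, ENNReal.ofReal (‖x - y‖ ^ (-(5 / 2) : ℝ) * |f y|) ≤
      ENNReal.ofReal M' * {z : Space | ‖z‖ ≤ 1}.indicator
        (fun z => ENNReal.ofReal (‖z‖ ^ (-(5 / 2) : ℝ))) (y - x) + ENNReal.ofReal |f y| := by
    intro y
    by_cases h : ‖y - x‖ ≤ 1
    · rw [indicator_of_mem (show y - x ∈ {z : Space | ‖z‖ ≤ 1} from h), norm_sub_rev x y,
        ← ENNReal.ofReal_mul hM'0]
      refine le_add_right (ENNReal.ofReal_le_ofReal ?_)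
      rw [mul_comm]
      refine mul_le_mul_of_nonneg_right ?_ (by positivity)
      refine (hM y ?_).trans (le_max_left _ _)
      rw [Metric.mem_closedBall, dist_eq_norm] at hx ⊢
      have := norm_add_le (y - x) (x - x₀)
      rw [sub_add_sub_cancel] at this
      linarith
    · refine le_add_left (ENNReal.ofReal_le_ofReal ?_)
      refine mul_le_of_le_one_left (abs_nonneg _) ?_
      rw [norm_sub_rev]
      exact Real.rpow_le_one_of_one_le_of_nonpos (not_le.mp h).le (by norm_num)
  have hI : ∫⁻ y, ENNReal.ofReal (‖x - y‖ ^ (-(5 / 2) : ℝ) * |f y|) ≤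
      ENNReal.ofReal (M' * (sphereArea * 2) + ∫ y, |f y|) := by
    refine (lintegral_mono hpt).trans (le_of_eq ?_)
    rw [lintegral_add_right _ (by fun_prop), lintegral_const_mul' _ _ ENNReal.ofReal_ne_top,
      lintegral_sub_right_eq_self (f := {z : Space | ‖z‖ ≤ 1}.indicator
        (fun z => ENNReal.ofReal (‖z‖ ^ (-(5 / 2) : ℝ)))), lintegral_indicator hS',
      lintegral_closedBall_rpow (by norm_num) zero_le_one,
      ← ofReal_integral_eq_lintegral_ofReal hi.abs (Filter.Eventually.of_forall fun _ => abs_nonneg _),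
      ← ENNReal.ofReal_mul hM'0, ← ENNReal.ofReal_add (by positivity) (by positivity)]
    norm_num
  have hnn : 0 ≤ᵐ[volume] fun y => ‖x - y‖ ^ (-(5 / 2) : ℝ) * |f y| :=
    Filter.Eventually.of_forall fun y => by positivity
  refine ⟨⟨hmeas, ?_⟩, ?_⟩
  · rw [hasFiniteIntegral_iff_ofReal hnn]
    exact hI.trans_lt ENNReal.ofReal_lt_top
  · rw [integral_eq_lintegral_of_nonneg_ae hnn hmeas]
    exact ENNReal.toReal_le_of_le_ofReal (by positivity) hI

theorem integrable_newton (hf : Continuous f) (hi : Integrable f) (x : Space) :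
    Integrable fun y => ‖x - y‖⁻¹ * f y := by
  obtain ⟨B, -, hB⟩ := exists_riesz_bound hf hi x
  obtain ⟨h1, -⟩ := hB x (Metric.mem_closedBall_self zero_le_one)
  refine (h1.add hi.abs).mono' ?_ (Filter.Eventually.of_forall fun y => ?_)
  · exact ((measurable_const.sub measurable_id).norm.inv.mul hf.measurable).aestronglyMeasurable
  · rw [norm_mul, norm_inv, norm_norm, Real.norm_eq_abs, ← Real.rpow_neg_one, Pi.add_apply]
    have := rpow_neg_le_add_one (norm_nonneg (x - y)) one_pos (by norm_num : (1 : ℝ) ≤ 5 / 2)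
    have := mul_le_mul_of_nonneg_right this (abs_nonneg (f y))
    linarith

theorem measurable_coulomb : Measurable coulomb := by
  unfold coulomb
  fun_prop

theorem integrable_coulomb (hf : Continuous f) (hi : Integrable f) (x : Space) :
    Integrable fun y => f y • coulomb (x - y) := by
  obtain ⟨B, -, hB⟩ := exists_riesz_bound hf hi x
  obtain ⟨h1, -⟩ := hB x (Metric.mem_closedBall_self zero_le_one)
  refine (h1.add hi.abs).mono' ?_ (Filter.Eventually.of_forall fun y => ?_)
  · exact (hf.measurable.smul
      (measurable_coulomb.comp (measurable_const.sub measurable_id))).aestronglyMeasurable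
  · rw [norm_smul, norm_coulomb, Real.norm_eq_abs, Pi.add_apply]
    have := rpow_neg_le_add_one (norm_nonneg (x - y)) two_pos (by norm_num : (2 : ℝ) ≤ 5 / 2)
    have := mul_le_mul_of_nonneg_right this (abs_nonneg (f y))
    linarith

/-- Integrating `newton_taylor` against `|f|` gives a remainder of at most `12 B |h|^{3/2}`, with
`B` uniform for base points `x` and `x + h`. Continuity and integrability of `f` are enough. -/
theorem hasGradientAt_newton (hf : Continuous f) (hi : Integrable f) (x : Space) :
    HasGradientAt (fun x => ∫ y, ‖x - y‖⁻¹ * f y) (-∫ y, f y • coulomb (x - y)) x := by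
  obtain ⟨B, hB0, hB⟩ := exists_riesz_bound hf hi x
  obtain ⟨i0, b0⟩ := hB x (Metric.mem_closedBall_self zero_le_one)
  have hmain : ∀ h : Space, ‖h‖ ≤ 1 →
      ‖(∫ y, ‖x + h - y‖⁻¹ * f y) - (∫ y, ‖x - y‖⁻¹ * f y)
        - inner ℝ (-∫ y, f y • coulomb (x - y)) h‖ ≤ 12 * B * ‖h‖ ^ (3 / 2 : ℝ) := by
    intro h hh
    obtain ⟨i1, b1⟩ := hB (x + h) (by simpa using hh)
    have n1 := integrable_newton hf hi (x + h)
    have n0 := integrable_newton hf hi x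
    have c0 := integrable_coulomb hf hi x
    have n2 : Integrable fun y => inner ℝ h (f y • coulomb (x - y)) := c0.const_inner h
    have e : (∫ y, ‖x + h - y‖⁻¹ * f y) - (∫ y, ‖x - y‖⁻¹ * f y)
        - inner ℝ (-∫ y, f y • coulomb (x - y)) h =
        ∫ y, (‖x + h - y‖⁻¹ * f y - ‖x - y‖⁻¹ * f y + inner ℝ h (f y • coulomb (x - y))) := by
      rw [integral_add (f := fun y => ‖x + h - y‖⁻¹ * f y - ‖x - y‖⁻¹ * f y) (n1.sub n0) n2,
        integral_sub n1 n0, integral_inner c0, inner_neg_left,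
        real_inner_comm, sub_neg_eq_add]
    rw [e]
    have hae : ∀ᵐ y : Space, y ≠ x := by simp [ae_iff]
    have hae' : ∀ᵐ y : Space, y ≠ x + h := by simp [ae_iff]
    have hdom : Integrable fun y => 6 * ‖h‖ ^ (3 / 2 : ℝ) *
        (‖x - y‖ ^ (-(5 / 2) : ℝ) * |f y| + ‖x + h - y‖ ^ (-(5 / 2) : ℝ) * |f y|) :=
      (i0.add i1).const_mul _
    refine (norm_integral_le_of_norm_le hdom ?_).trans ?_
    · filter_upwards [hae, hae'] with y hy hy'
      have hz : x - y ≠ 0 := sub_ne_zero.mpr hy.symm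
      have hz' : x - y + h ≠ 0 := by
        rw [← add_sub_right_comm]; exact sub_ne_zero.mpr hy'.symm
      have ht := newton_taylor hz hz'
      rw [show x - y + h = x + h - y by abel] at ht
      have e2 : ‖x + h - y‖⁻¹ * f y - ‖x - y‖⁻¹ * f y + inner ℝ h (f y • coulomb (x - y)) =
          (‖x + h - y‖⁻¹ - ‖x - y‖⁻¹ + inner ℝ (coulomb (x - y)) h) * f y := by
        rw [real_inner_smul_right, real_inner_comm]
        ring
      rw [e2, Real.norm_eq_abs, abs_mul]
      calc _ ≤ 6 * ‖h‖ ^ (3 / 2 : ℝ) * (‖x - y‖ ^ (-(5 / 2) : ℝ) + ‖x + h - y‖ ^ (-(5 / 2) : ℝ))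
            * |f y| := by gcongr
        _ = _ := by ring
    · rw [integral_const_mul, integral_add i0 i1]
      have : 0 ≤ ‖h‖ ^ (3 / 2 : ℝ) := by positivity
      nlinarith
  rw [hasGradientAt_iff_isLittleO_nhds_zero, Asymptotics.isLittleO_iff]
  intro c hc
  have hlim : Filter.Tendsto (fun h : Space => 12 * B * ‖h‖ ^ (1 / 2 : ℝ)) (nhds 0) (nhds 0) := by
    have : Continuous fun h : Space => 12 * B * ‖h‖ ^ (1 / 2 : ℝ) := by
      refine continuous_const.mul (continuous_norm.rpow_const fun _ => Or.inr (by norm_num))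
    simpa using this.tendsto 0
  filter_upwards [hlim.eventually_le_const hc, Metric.closedBall_mem_nhds (0 : Space) one_pos]
    with h h1 h2
  refine (hmain h (by simpa using h2)).trans ?_
  have e3 : ‖h‖ ^ (3 / 2 : ℝ) = ‖h‖ ^ (1 / 2 : ℝ) * ‖h‖ := by
    nth_rewrite 3 [← Real.rpow_one ‖h‖]
    rw [← Real.rpow_add_of_nonneg (norm_nonneg h) (by norm_num) (by norm_num)]
    norm_num
  rw [e3, ← mul_assoc]
  gcongr

end Potential

/-! ### The initial energy -/

section Initial

variable {χ : ℝ → ℝ} {s γ : ℝ} {F : Spacetime → TwoForm} {J : Spacetime → OneForm}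

/-- The charge density on the initial slice. -/
def chargeDensity (J : Spacetime → OneForm) (y : Space) : ℝ := J (0, y) (basisVec 0)

theorem chargeDensityNorm_sq (s γ : ℝ) (J : Spacetime → OneForm) :
    chargeDensityNorm s γ J ^ 2 = (∫⁻ y, ENNReal.ofReal
      (((1 + ‖y‖) ^ (s + γ) * |chargeDensity J y|) ^ (6 / 5 : ℝ))) ^ (5 / 3 : ℝ) := by
  have h65 : (6 / 5 : ℝ≥0∞) ≠ ⊤ := ENNReal.div_ne_top (by simp) (by simp)
  have h0 : (6 / 5 : ℝ≥0∞) ≠ 0 := by simp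
  have ht : (6 / 5 : ℝ≥0∞).toReal = 6 / 5 := by simp
  rw [chargeDensityNorm, eLpNorm_eq_lintegral_rpow_enorm_toReal h0 h65, ht, ← ENNReal.rpow_two,
    ← ENNReal.rpow_mul]
  congr 1
  · refine lintegral_congr fun y => ?_
    rw [← ofReal_norm, ENNReal.ofReal_rpow_of_nonneg (norm_nonneg _) (by norm_num), norm_mul,
      Real.norm_eq_abs, Real.norm_eq_abs, abs_of_nonneg (a := (1 + ‖y‖) ^ (s + γ)) (by positivity)]
    rfl
  · norm_num

/-- Hölder bounds the `L¹` norm of the charge density. Integrability ensures that `charge`, a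
Bochner integral that defaults to zero, is the actual charge; the bound on `|q|²` needs no
finiteness. -/
theorem exists_charge_bound {δ : ℝ} (hδ : 0 < δ) : ∃ C : ℝ, 0 ≤ C ∧
    ∀ s γ : ℝ, 1 / 2 + δ ≤ s + γ → ∀ J : Spacetime → OneForm, Continuous (chargeDensity J) →
      (chargeDensityNorm s γ J ^ 2 ≠ ⊤ → Integrable (chargeDensity J)) ∧
      ENNReal.ofReal (|charge J| ^ 2) ≤ ENNReal.ofReal C * chargeDensityNorm s γ J ^ 2 := by
  obtain ⟨C, hC0, hC⟩ := exists_lintegral_le hδ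
  refine ⟨C ^ 2, by positivity, fun s γ ha J hf => ?_⟩
  set f := chargeDensity J with hfd
  set g : Space → ℝ := fun y => (1 + ‖y‖) ^ (s + γ) * |f y| with hg
  set N := ∫⁻ y, ENNReal.ofReal (g y ^ (6 / 5 : ℝ)) with hN
  have hgm : Measurable g := by
    have := hf.measurable
    fun_prop
  have h1 := hC (s + γ) ha g (fun y => by positivity) hgm
  have e : ∀ y, (1 + ‖y‖) ^ (-(s + γ)) * g y = |f y| := by
    intro y
    have : 0 < 1 + ‖y‖ := by positivity
    rw [hg, ← mul_assoc, ← Real.rpow_add this, neg_add_cancel, Real.rpow_zero, one_mul]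
  simp only [e] at h1
  have hNN : chargeDensityNorm s γ J ^ 2 = N ^ (5 / 3 : ℝ) := chargeDensityNorm_sq s γ J
  have hq : ENNReal.ofReal |charge J| ≤ ∫⁻ y, ENNReal.ofReal |f y| := by
    have := enorm_integral_le_lintegral_enorm (μ := (volume : Measure Space)) f
    have hch : charge J = ∫ y, f y := rfl
    rw [hch]
    simpa only [← ofReal_norm, Real.norm_eq_abs] using this
  rw [hNN]
  constructor
  · intro hfin
    refine ⟨hf.aestronglyMeasurable, ?_⟩
    have hNfin : N ≠ ⊤ := by
      rintro h
      rw [h, ENNReal.top_rpow_of_pos (by norm_num)] at hfin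
      exact hfin rfl
    rw [HasFiniteIntegral]
    simp only [← ofReal_norm, Real.norm_eq_abs]
    exact h1.trans_lt (ENNReal.mul_lt_top ENNReal.ofReal_lt_top
      (ENNReal.rpow_lt_top_of_nonneg (by norm_num) hNfin))
  · rw [ENNReal.ofReal_pow (abs_nonneg _), ENNReal.ofReal_pow hC0]
    calc _ ≤ (ENNReal.ofReal C * N ^ (5 / 6 : ℝ)) ^ 2 := by
          gcongr
          exact hq.trans h1
      _ = _ := by
          rw [mul_pow, ← ENNReal.rpow_two (N ^ (5 / 6 : ℝ)), ← ENNReal.rpow_mul]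
          norm_num

/-- `gradient` returns zero where the potential is not differentiable, so differentiability must be
established before the curl-free field can be identified with the Coulomb integral. -/
theorem electricCF_eq (hf : Continuous (chargeDensity J)) (hi : Integrable (chargeDensity J))
    (x : Space) :
    electricCF J x = (1 / (4 * Real.pi)) • ∫ y, chargeDensity J y • coulomb (x - y) := by
  have h1 := hasGradientAt_newton hf hi x
  have h2 := (h1.hasFDerivAt.const_mul (-(1 / (4 * Real.pi))))
  have h3 : HasGradientAt (potential J)
      (-(1 / (4 * Real.pi)) • -∫ y, chargeDensity J y • coulomb (x - y)) x := by
    rw [hasGradientAt_iff_hasFDerivAt, map_smul]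
    exact h2
  rw [electricCF, h3.gradient, smul_neg, neg_smul, neg_neg]

theorem electric_chargeField (q : ℝ) (x : Space) :
    electric (chargeField χ q (0, x)) = (q / (4 * Real.pi)) • (χ (‖x‖ - 2) • coulomb x) := by
  ext i
  change el (chargeField χ q (0, x)) i = _
  rw [el_chargeField, profile]
  simp only [omega, coulomb, PiLp.smul_apply, smul_eq_mul, sub_zero]
  field_simp

/-- The curl-free part of the remainder field is an integral with the excess kernel. -/
theorem electric_remainder (hf : Continuous (chargeDensity J)) (hi : Integrable (chargeDensity J))
    (x : Space) :
    electric (remainder χ F J (0, x)) = electricDF F J x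
      + (1 / (4 * Real.pi)) • ∫ y, chargeDensity J y • excessKernel χ x y := by
  have e1 : electric (remainder χ F J (0, x)) =
      electric (F (0, x)) - electric (chargeField χ (charge J) (0, x)) := by
    ext i
    exact el_sub _ _ i
  have e2 : ∫ y, chargeDensity J y • excessKernel χ x y =
      (∫ y, chargeDensity J y • coulomb (x - y)) - charge J • (χ (‖x‖ - 2) • coulomb x) := by
    have : charge J = ∫ y, chargeDensity J y := rfl
    rw [this, ← integral_smul_const, ← integral_sub (integrable_coulomb hf hi x)
      (hi.smul_const _)]
    refine integral_congr_ae (Filter.Eventually.of_forall fun y => ?_)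
    exact smul_sub _ _ _
  rw [e1, e2, electricDF, electricCF_eq hf hi, electric_chargeField, smul_sub, smul_smul (1 / _)]
  rw [one_div_mul_eq_div]
  abel

theorem norm_electric_sq (G : TwoForm) : ‖electric G‖ ^ 2 = el G 0 ^ 2 + el G 1 ^ 2 + el G 2 ^ 2 := by
  rw [EuclideanSpace.real_norm_sq_eq, Fin.sum_univ_three]
  rfl

theorem norm_magnetic_sq (G : TwoForm) : ‖magnetic G‖ ^ 2 = mg G 0 ^ 2 + mg G 1 ^ 2 + mg G 2 ^ 2 := by
  rw [EuclideanSpace.real_norm_sq_eq, Fin.sum_univ_three]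
  rfl

/-- At `t = 0` both `τ₊` and `τ₋` equal `(1 + r²)^{1/2}`, so all components carry the same weight,
and `|α|² + |αbar|² + ρ² + σ² ≤ 2 (|E|² + |H|²)`. -/
theorem fixedTimeDensity_zero_le (hχ : IsSmoothStep χ) (hγ : 0 ≤ γ) (G : Spacetime → TwoForm)
    {x : Space} (hx : x ≠ 0) :
    fixedTimeDensity χ s γ G (0, x) ≤
      2 * ((1 + ‖x‖ ^ 2) ^ (s + γ) * (‖electric (G (0, x))‖ ^ 2 + ‖magnetic (G (0, x))‖ ^ 2)) := by
  set b := 1 + ‖x‖ ^ 2 with hb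
  have hb0 : 0 < b := by positivity
  have hb1 : 1 ≤ b := by have := sq_nonneg ‖x‖; linarith
  have hs : ∀ a : ℝ, Real.sqrt b ^ (2 * a) = b ^ a := by
    intro a
    rw [Real.sqrt_eq_rpow, ← Real.rpow_mul hb0.le]
    congr 1; ring
  have hp : tauPlus ((0, x) : Spacetime) = Real.sqrt b := by rw [tauPlus, zero_add]
  have hm : tauMinus ((0, x) : Spacetime) = Real.sqrt b := by rw [tauMinus, zero_sub, neg_sq]
  have hw : weight χ γ ((0, x) : Spacetime) ≤ b ^ γ := by
    have h0 := hχ.nonneg (‖x‖ - 0)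
    have h1 := hχ.le_one (‖x‖ - 0)
    have h2 : 1 ≤ b ^ γ := Real.one_le_rpow hb1 hγ
    change χ (‖x‖ - 0) * tauMinus ((0, x) : Spacetime) ^ (2 * γ) + (1 - χ (‖x‖ - 0)) ≤ _
    rw [hm, hs]
    nlinarith
  have hw0 := weight_nonneg hχ γ ((0, x) : Spacetime)
  have e1 := alphaSq_eq (G (0, x)) (p := (0, x)) hx
  have e2 := alphaBarSq_eq (G (0, x)) (p := (0, x)) hx
  have hR : 0 ≤ rho (G (0, x)) (0, x) ^ 2 + sigma (G (0, x)) (0, x) ^ 2 := by positivity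
  rw [fixedTimeDensity, hp, hm, hs, norm_electric_sq, norm_magnetic_sq, Real.rpow_add hb0]
  set S := el (G (0, x)) 0 ^ 2 + el (G (0, x)) 1 ^ 2 + el (G (0, x)) 2 ^ 2
    + (mg (G (0, x)) 0 ^ 2 + mg (G (0, x)) 1 ^ 2 + mg (G (0, x)) 2 ^ 2) with hS
  have hS0 : 0 ≤ S := by positivity
  have hsum : b ^ s * alphaSq (G (0, x)) (0, x) + b ^ s * alphaBarSq (G (0, x)) (0, x)
      + b ^ s * (rho (G (0, x)) (0, x) ^ 2 + sigma (G (0, x)) (0, x) ^ 2) ≤ b ^ s * (2 * S) := by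
    rw [← mul_add, ← mul_add]
    refine mul_le_mul_of_nonneg_left ?_ (by positivity)
    linarith
  calc _ ≤ b ^ s * (2 * S) * b ^ γ := mul_le_mul hsum hw hw0 (by positivity)
    _ = _ := by ring

theorem measurable_excessKernel (hχ : IsSmoothStep χ) :
    Measurable fun q : Space × Space => excessKernel χ q.1 q.2 := by
  have h1 : Measurable χ := hχ.contDiff.continuous.measurable
  have h2 := measurable_coulomb
  unfold excessKernel
  exact (h2.comp (measurable_fst.sub measurable_snd)).sub
    ((h1.comp (measurable_fst.norm.sub_const 2)).smul (h2.comp measurable_fst))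

/-- The magnetic part is unaffected by the subtraction, `E^{df}` is part of the data, and the rest
of the electric field is the excess-kernel integral, estimated in `L²` by the weighted `L^{6/5}`
norm. -/
theorem exists_initial_bound (hχ : IsSmoothStep χ) {δ : ℝ} (hδ : 0 < δ) (hδ1 : δ ≤ 1) :
    ∃ C : ℝ, 0 ≤ C ∧ ∀ s γ : ℝ, 0 ≤ γ → 1 / 2 + δ ≤ s + γ → s + γ ≤ 3 / 2 - δ →
      ∀ (F : Spacetime → TwoForm) (J : Spacetime → OneForm), Continuous (chargeDensity J) →
      Integrable (chargeDensity J) →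
      ∫⁻ x : Space, ENNReal.ofReal (fixedTimeDensity χ s γ (remainder χ F J) (0, x)) ≤
        ENNReal.ofReal C * (dataNormSq s γ F J + chargeDensityNorm s γ J ^ 2) := by
  obtain ⟨C, hC0, hC⟩ := exists_excessKernel_bound hχ hδ hδ1
  refine ⟨4 * (1 + C), by positivity, fun s γ hγ ha ha2 F J hf hi => ?_⟩
  set f := chargeDensity J with hfd
  set a := s + γ with had
  set g : Space → ℝ := fun y => (1 + ‖y‖) ^ a * |f y| with hg
  have hgm : Measurable g := by
    have := hf.measurable
    fun_prop
  have hbound := hC a ha ha2 g (fun y => by positivity) hgm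
  have hNN : chargeDensityNorm s γ J ^ 2 =
      (∫⁻ y, ENNReal.ofReal (g y ^ (6 / 5 : ℝ))) ^ (5 / 3 : ℝ) := chargeDensityNorm_sq s γ J
  rw [← hNN] at hbound
  set D : Space → ℝ≥0∞ := fun x => ∫⁻ y, ENNReal.ofReal
    ((1 + ‖x‖) ^ a * ‖excessKernel χ x y‖ * (1 + ‖y‖) ^ (-a)) * ENNReal.ofReal (g y) with hD
  have hDm : Measurable D := by
    have hk := measurable_excessKernel hχ
    refine Measurable.lintegral_prod_right' (f := fun q : Space × Space => ENNReal.ofReal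
      ((1 + ‖q.1‖) ^ a * ‖excessKernel χ q.1 q.2‖ * (1 + ‖q.2‖) ^ (-a)) * ENNReal.ofReal (g q.2)) ?_
    have hgm2 : Measurable fun q : Space × Space => ENNReal.ofReal (g q.2) :=
      (hgm.comp measurable_snd).ennreal_ofReal
    have h1 : Measurable fun q : Space × Space => (1 + ‖q.1‖) ^ a := by fun_prop
    have h2 : Measurable fun q : Space × Space => (1 + ‖q.2‖) ^ (-a) := by fun_prop
    exact ((h1.mul hk.norm).mul h2).ennreal_ofReal.mul hgm2
  set W : Space → Space := fun x => (1 / (4 * Real.pi)) • ∫ y, f y • excessKernel χ x y with hW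
  -- The density is written as `(1 + |y|)^{-a}` times its weighted version `g`, so that the weights
  -- are moved onto the kernel; the factor `1 / (4π)` is dropped.
  have hWD : ∀ x, ENNReal.ofReal ((1 + ‖x‖ ^ 2) ^ a * ‖W x‖ ^ 2) ≤ D x ^ 2 := by
    intro x
    have hx0 : 0 ≤ ‖x‖ := norm_nonneg x
    have hX : (0 : ℝ) < 1 + ‖x‖ := by positivity
    have hpi : 1 / (4 * Real.pi) ≤ 1 := by
      rw [div_le_one (by positivity)]
      linarith [Real.pi_gt_three]
    have h1 : (1 + ‖x‖ ^ 2) ^ a ≤ ((1 + ‖x‖) ^ a) ^ 2 := by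
      have : ((1 + ‖x‖) ^ a) ^ 2 = ((1 + ‖x‖) ^ 2) ^ a := by
        rw [← Real.rpow_two, ← Real.rpow_two, ← Real.rpow_mul hX.le, ← Real.rpow_mul hX.le,
          mul_comm]
      rw [this]
      exact Real.rpow_le_rpow (by positivity) (by nlinarith) (by linarith)
    have h2 : ‖W x‖ ≤ ‖∫ y, f y • excessKernel χ x y‖ := by
      rw [hW, norm_smul, Real.norm_eq_abs, abs_of_nonneg (by positivity)]
      exact mul_le_of_le_one_left (norm_nonneg _) hpi
    have h3 : ENNReal.ofReal ((1 + ‖x‖) ^ a * ‖∫ y, f y • excessKernel χ x y‖) ≤ D x := by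
      rw [ENNReal.ofReal_mul (by positivity), ofReal_norm]
      calc _ ≤ ENNReal.ofReal ((1 + ‖x‖) ^ a) * ∫⁻ y, ‖f y • excessKernel χ x y‖ₑ :=
            mul_le_mul_right (enorm_integral_le_lintegral_enorm _) _
        _ = D x := by
            rw [← lintegral_const_mul' _ _ ENNReal.ofReal_ne_top]
            refine lintegral_congr fun y => ?_
            have hY : (0 : ℝ) < 1 + ‖y‖ := by positivity
            rw [← ofReal_norm, ← ENNReal.ofReal_mul (by positivity),
              ← ENNReal.ofReal_mul (by positivity), norm_smul, Real.norm_eq_abs]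
            congr 1
            have : (1 + ‖y‖) ^ (-a) * (1 + ‖y‖) ^ a = 1 := by
              rw [← Real.rpow_add hY, neg_add_cancel, Real.rpow_zero]
            simp only [hg]
            linear_combination (-(1 + ‖x‖) ^ a * ‖excessKernel χ x y‖ * |f y|) * this
    calc _ ≤ ENNReal.ofReal (((1 + ‖x‖) ^ a * ‖∫ y, f y • excessKernel χ x y‖) ^ 2) := by
          refine ENNReal.ofReal_le_ofReal ?_
          rw [mul_pow]
          gcongr
      _ = ENNReal.ofReal ((1 + ‖x‖) ^ a * ‖∫ y, f y • excessKernel χ x y‖) ^ 2 :=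
          ENNReal.ofReal_pow (by positivity) _
      _ ≤ _ := by gcongr
  have hae : ∀ᵐ x : Space, x ≠ 0 := by simp [ae_iff]
  have hmag : ∀ x, ‖magnetic (remainder χ F J (0, x))‖ ^ 2 = ‖magnetic (F (0, x))‖ ^ 2 := by
    intro x
    have : ∀ i, mg (remainder χ F J (0, x)) i = mg (F (0, x)) i := fun i => by
      rw [remainder, mg_sub, mg_chargeField, sub_zero]
    rw [norm_magnetic_sq, norm_magnetic_sq, this, this, this]
  have hpt : ∀ x : Space, x ≠ 0 →
      ENNReal.ofReal (fixedTimeDensity χ s γ (remainder χ F J) (0, x)) ≤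
      ENNReal.ofReal 4 * (ENNReal.ofReal ((1 + ‖x‖ ^ 2) ^ (s + γ) *
        (‖electricDF F J x‖ ^ 2 + ‖magnetic (F (0, x))‖ ^ 2)) + D x ^ 2) := by
    intro x hx
    refine le_trans ?_ (mul_le_mul_right (add_le_add le_rfl (hWD x)) _)
    rw [← ENNReal.ofReal_add (by positivity) (by positivity), ← ENNReal.ofReal_mul (by norm_num)]
    refine ENNReal.ofReal_le_ofReal ((fixedTimeDensity_zero_le hχ hγ _ hx).trans ?_)
    rw [hmag, electric_remainder hf hi]
    have hb : 0 ≤ (1 + ‖x‖ ^ 2) ^ a := by positivity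
    have hn : ‖electricDF F J x + W x‖ ^ 2 ≤ 2 * ‖electricDF F J x‖ ^ 2 + 2 * ‖W x‖ ^ 2 := by
      have h1 := norm_add_le (electricDF F J x) (W x)
      have h2 : ‖electricDF F J x + W x‖ ^ 2 ≤ (‖electricDF F J x‖ + ‖W x‖) ^ 2 := by gcongr
      nlinarith [sq_nonneg (‖electricDF F J x‖ - ‖W x‖)]
    have hB : 0 ≤ ‖magnetic (F (0, x))‖ ^ 2 := by positivity
    change 2 * ((1 + ‖x‖ ^ 2) ^ a * (‖electricDF F J x + W x‖ ^ 2 + ‖magnetic (F (0, x))‖ ^ 2)) ≤ _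
    rw [← mul_add]
    have : ‖electricDF F J x + W x‖ ^ 2 + ‖magnetic (F (0, x))‖ ^ 2 ≤
        2 * (‖electricDF F J x‖ ^ 2 + ‖magnetic (F (0, x))‖ ^ 2 + ‖W x‖ ^ 2) := by linarith
    have := mul_le_mul_of_nonneg_left this hb
    linarith
  calc _ ≤ ∫⁻ x : Space, ENNReal.ofReal 4 * (ENNReal.ofReal ((1 + ‖x‖ ^ 2) ^ (s + γ) *
        (‖electricDF F J x‖ ^ 2 + ‖magnetic (F (0, x))‖ ^ 2)) + D x ^ 2) := by
        refine lintegral_mono_ae ?_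
        filter_upwards [hae] with x hx using hpt x hx
    _ = ENNReal.ofReal 4 * (dataNormSq s γ F J + ∫⁻ x, D x ^ 2) := by
        rw [lintegral_const_mul' _ _ ENNReal.ofReal_ne_top, lintegral_add_right _ (by fun_prop)]
        rfl
    _ ≤ ENNReal.ofReal 4 * (dataNormSq s γ F J
          + ENNReal.ofReal C * chargeDensityNorm s γ J ^ 2) := by gcongr
    _ ≤ ENNReal.ofReal 4 * (ENNReal.ofReal (1 + C) * (dataNormSq s γ F J
          + chargeDensityNorm s γ J ^ 2)) := by
        refine mul_le_mul_right ?_ _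
        rw [mul_add]
        refine add_le_add ?_ ?_
        · refine le_mul_of_one_le_left' ?_
          rw [← ENNReal.ofReal_one]
          exact ENNReal.ofReal_le_ofReal (by linarith)
        · refine mul_le_mul_left (ENNReal.ofReal_le_ofReal (by linarith)) _
    _ = _ := by rw [← mul_assoc, ← ENNReal.ofReal_mul (by norm_num)]

end Initial

/-! ### The current of the pure-charge field -/

section Current

variable {χ : ℝ → ℝ} {s γ ε T : ℝ} {F : Spacetime → TwoForm} {J : Spacetime → OneForm}

theorem currentDensity_sub_le (hχ : IsSmoothStep χ) (s γ ε : ℝ) (J K : Spacetime → OneForm)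
    (p : Spacetime) : currentDensity χ s γ ε (fun p => J p - K p) p ≤
      2 * currentDensity χ s γ ε J p + 2 * currentDensity χ s γ ε K p := by
  have hs : ∀ v, |(J p - K p) v| ^ 2 ≤ 2 * |J p v| ^ 2 + 2 * |K p v| ^ 2 := by
    intro v
    rw [sq_abs, sq_abs, sq_abs, sub_apply]
    nlinarith [sq_nonneg (J p v + K p v)]
  have ha : angSq (J p - K p) p ≤ 2 * angSq (J p) p + 2 * angSq (K p) p := by
    unfold angSq
    rw [Finset.mul_sum, Finset.mul_sum, ← Finset.sum_add_distrib]
    refine Finset.sum_le_sum fun i _ => ?_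
    simpa only [sq_abs] using hs (angVec p i)
  have hw := weightEps_nonneg hχ γ ε p
  have h1 := tauPlus_pos p
  have h2 := tauMinus_pos p
  unfold currentDensity
  rw [← mul_assoc, ← mul_assoc, ← add_mul]
  refine mul_le_mul_of_nonneg_right ?_ hw
  have e1 := mul_le_mul_of_nonneg_left (hs (vecL p))
    (a := tauPlus p ^ (2 * s + 1 + 2 * ε) * tauMinus p ^ (-2 * ε)) (by positivity)
  have e2 := mul_le_mul_of_nonneg_left (hs (vecLbar p))
    (a := tauPlus p ^ (1 + 2 * ε - 2 * s) * tauMinus p ^ (4 * s - 2 * ε)) (by positivity)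
  have e3 := mul_le_mul_of_nonneg_left ha (a := tauPlus p ^ (2 * s) * tauMinus p) (by positivity)
  linarith

/-- The current is a multiple of `dt - dr`, which annihilates `L` and the angular directions. Only
the `Lbar` component survives, for which the power of `τ₊` in the norm, `1 + 2ε - 2s`, is
nonpositive. -/
theorem chargeCurrent_null (χ : ℝ → ℝ) (q : ℝ) {p : Spacetime} (hp : p.2 ≠ 0) :
    chargeCurrent χ q p (vecL p) = 0 ∧ chargeCurrent χ q p (vecLbar p) = 2 * dprofile χ q p ∧
      angSq (chargeCurrent χ q p) p = 0 := by
  have hn : ‖omega p‖ = 1 := by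
    rw [omega, norm_smul, norm_inv, norm_norm, inv_mul_cancel₀ (norm_ne_zero_iff.mpr hp)]
  have hi : inner ℝ (omega p) (omega p) = 1 := by rw [real_inner_self_eq_norm_sq, hn, one_pow]
  refine ⟨?_, ?_, Finset.sum_eq_zero fun i _ => ?_⟩
  · simp [chargeCurrent, vecL, hn]
  · simp [chargeCurrent, vecLbar, hn]
    ring
  · simp [chargeCurrent, angVec, inner_sub_right, inner_smul_right, hn,
      EuclideanSpace.inner_single_right]

/-- On the support of `χ'(r - t - 2)` one has `2 ≤ r - t ≤ 3`, hence `τ₋ ≤ 4` and the weight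
`w_{γ,ε}` is bounded. The power of `τ₊` is at most one, so the density is of order `q² r^{-4}`, with
`r > 1` on the slab. -/
theorem currentDensity_chargeCurrent_le (hχ : IsSmoothStep χ) {M : ℝ} (hM : ∀ y, deriv χ y ≤ M)
    (hγ : 0 < γ) (hε : 0 < ε) (hs1 : s ≤ 1) (hεs : ε ≤ s - 1 / 2) (q : ℝ) {p : Spacetime}
    (hp : p ∈ slabOff T) :
    ENNReal.ofReal (currentDensity χ s γ ε (chargeCurrent χ q) p) ≤
      ENNReal.ofReal (4 ^ 5 * 4 ^ (2 * γ) * M ^ 2 * q ^ 2) *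
        ((Icc (-3) (-2)).indicator 1 (p.1 - ‖p.2‖) *
          {x : Space | 1 < ‖x‖}.indicator (fun x => ENNReal.ofReal (‖x‖ ^ (-4 : ℝ))) p.2) := by
  obtain ⟨hL, hB, hA⟩ := chargeCurrent_null χ q hp.2
  have e : currentDensity χ s γ ε (chargeCurrent χ q) p =
      tauPlus p ^ (1 + 2 * ε - 2 * s) * tauMinus p ^ (4 * s - 2 * ε) * (2 * dprofile χ q p) ^ 2
        * weightEps χ γ ε p := by
    rw [currentDensity, hL, hB, hA, abs_zero, sq_abs]
    ring
  by_cases hy : ‖p.2‖ - p.1 - 2 < 0 ∨ 1 < ‖p.2‖ - p.1 - 2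
  · rw [e, dprofile, hχ.deriv_eq_zero hy]
    simp
  · push Not at hy
    have ht := hp.1.1
    have hr : 1 < ‖p.2‖ := by linarith
    have h1 : p.1 - ‖p.2‖ ∈ Icc (-3 : ℝ) (-2) := ⟨by linarith, by linarith⟩
    rw [indicator_of_mem h1, indicator_of_mem (show p.2 ∈ {x : Space | 1 < ‖x‖} from hr),
      Pi.one_apply, one_mul, ← ENNReal.ofReal_mul (by positivity), e]
    refine ENNReal.ofReal_le_ofReal ?_
    have hp1 : 1 ≤ tauPlus p := one_le_jap (vv p)
    have hm1 : 1 ≤ tauMinus p := one_le_jap (uu p)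
    have hm4 : tauMinus p ≤ 4 := by
      refine (jap_le (uu p)).trans ?_
      have : |uu p| ≤ 3 := abs_le.mpr ⟨h1.1, by have := h1.2; change p.1 - ‖p.2‖ ≤ 3; linarith⟩
      linarith
    have hw : weightEps χ γ ε p ≤ 4 ^ (2 * γ) := by
      rw [weightEps, hχ.eq_one _ (by linarith), one_mul, sub_self, zero_mul, add_zero]
      exact Real.rpow_le_rpow (by linarith) hm4 (by linarith)
    have ha : tauPlus p ^ (1 + 2 * ε - 2 * s) ≤ 1 :=
      Real.rpow_le_one_of_one_le_of_nonpos hp1 (by linarith)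
    have hb : tauMinus p ^ (4 * s - 2 * ε) ≤ 4 ^ 4 := by
      calc tauMinus p ^ (4 * s - 2 * ε) ≤ tauMinus p ^ (4 : ℝ) :=
            Real.rpow_le_rpow_of_exponent_le hm1 (by linarith)
        _ ≤ 4 ^ (4 : ℝ) := Real.rpow_le_rpow (by linarith) hm4 (by norm_num)
        _ = 4 ^ 4 := by norm_num
    have hd : dprofile χ q p ^ 2 ≤ M ^ 2 * q ^ 2 * ‖p.2‖ ^ (-4 : ℝ) := by
      have hr0 : 0 < ‖p.2‖ := by linarith
      have e4 : ‖p.2‖ ^ (-4 : ℝ) = (‖p.2‖ ^ 2)⁻¹ ^ 2 := by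
        have h4 : ‖p.2‖ ^ (4 : ℝ) = ‖p.2‖ ^ 4 := by exact_mod_cast Real.rpow_natCast ‖p.2‖ 4
        rw [Real.rpow_neg hr0.le, inv_pow, ← pow_mul, h4]
      have hD : deriv χ (‖p.2‖ - p.1 - 2) ^ 2 ≤ M ^ 2 :=
        pow_le_pow_left₀ (hχ.deriv_nonneg _) (hM _) 2
      have hpi : ((4 * Real.pi)⁻¹) ^ 2 ≤ 1 := by
        refine pow_le_one₀ (by positivity) (inv_le_one_of_one_le₀ ?_)
        linarith [Real.pi_gt_three]
      have : dprofile χ q p ^ 2 = ((4 * Real.pi)⁻¹) ^ 2 *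
          (deriv χ (‖p.2‖ - p.1 - 2) ^ 2 * q ^ 2 * (‖p.2‖ ^ 2)⁻¹ ^ 2) := by
        rw [dprofile, div_eq_mul_inv, mul_inv]
        ring
      rw [this, e4]
      refine (mul_le_of_le_one_left (by positivity) hpi).trans ?_
      gcongr
    have hw0 := weightEps_nonneg hχ γ ε p
    calc _ ≤ 1 * 4 ^ 4 * (4 * (M ^ 2 * q ^ 2 * ‖p.2‖ ^ (-4 : ℝ))) * 4 ^ (2 * γ) := by
          have : (2 * dprofile χ q p) ^ 2 ≤ 4 * (M ^ 2 * q ^ 2 * ‖p.2‖ ^ (-4 : ℝ)) := by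
            rw [mul_pow]
            linarith
          have := tauMinus_pos p
          gcongr
      _ = _ := by ring

/-- The bound is uniform in `T`: for fixed `x` the layer has unit length in `t`, and `r^{-4}` is
integrable outside the unit ball. -/
theorem lintegral_chargeCurrent_le (hχ : IsSmoothStep χ) {M : ℝ} (hM : ∀ y, deriv χ y ≤ M)
    (hγ : 0 < γ) (hε : 0 < ε) (hs1 : s ≤ 1) (hεs : ε ≤ s - 1 / 2) (q T : ℝ) :
    ∫⁻ p in slab T, ENNReal.ofReal (currentDensity χ s γ ε (chargeCurrent χ q) p) ≤
      ENNReal.ofReal (4 ^ 5 * 4 ^ (2 * γ) * M ^ 2 * sphereArea) * ENNReal.ofReal (|q| ^ 2) := by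
  set f : Space → ℝ≥0∞ := {x : Space | 1 < ‖x‖}.indicator fun x => ENNReal.ofReal (‖x‖ ^ (-4 : ℝ))
    with hf
  set g : ℝ → ℝ≥0∞ := (Icc (-3) (-2)).indicator 1 with hg
  have hS : MeasurableSet {x : Space | 1 < ‖x‖} := measurableSet_lt measurable_const measurable_norm
  have hfm : Measurable f := Measurable.indicator (by fun_prop) hS
  have hgm : Measurable g := measurable_one.indicator measurableSet_Icc
  have hm : Measurable fun p : Spacetime => g (p.1 - ‖p.2‖) * f p.2 :=
    (hgm.comp (by fun_prop)).mul (hfm.comp measurable_snd)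
  have hA := sphereArea_nonneg
  have hI : ∫⁻ x, f x = ENNReal.ofReal sphereArea := by
    rw [hf, lintegral_indicator hS, lintegral_compl_closedBall_rpow (by norm_num) one_pos]
    norm_num
  have hT : ∀ x : Space, ∫⁻ t in Icc 0 T, g (t - ‖x‖) * f x ≤ f x := by
    intro x
    have hgx : Measurable fun t : ℝ => g (t - ‖x‖) := hgm.comp (by fun_prop)
    rw [lintegral_mul_const _ hgx]
    refine mul_le_of_le_one_left' ((setLIntegral_le_lintegral _ _).trans ?_)
    rw [lintegral_sub_right_eq_self g ‖x‖, hg, lintegral_indicator_one measurableSet_Icc,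
      Real.volume_Icc]
    norm_num
  calc _ ≤ ∫⁻ p in slab T, ENNReal.ofReal (4 ^ 5 * 4 ^ (2 * γ) * M ^ 2 * q ^ 2) *
        (g (p.1 - ‖p.2‖) * f p.2) := by
        refine lintegral_mono_ae ?_
        filter_upwards [ae_snd_ne_zero T] with p hp
        exact currentDensity_chargeCurrent_le hχ hM hγ hε hs1 hεs q hp
    _ = ENNReal.ofReal (4 ^ 5 * 4 ^ (2 * γ) * M ^ 2 * q ^ 2) *
        ∫⁻ x : Space, ∫⁻ t in Icc 0 T, g (t - ‖x‖) * f x := by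
        rw [lintegral_const_mul _ hm, volume_restrict_slab, lintegral_prod_symm _ hm.aemeasurable]
    _ ≤ ENNReal.ofReal (4 ^ 5 * 4 ^ (2 * γ) * M ^ 2 * q ^ 2) * ENNReal.ofReal sphereArea := by
        rw [← hI]
        exact mul_le_mul_right (lintegral_mono hT) _
    _ = _ := by
        rw [← ENNReal.ofReal_mul (by positivity), ← ENNReal.ofReal_mul (by positivity), sq_abs]
        congr 1
        ring

theorem currentNormSq_eq (hχ : IsSmoothStep χ) (hF : ∀ p ∈ slab T, ContDiffAt ℝ 1 F p)
    (h : MaxwellOn F J (slab T)) : currentNormSq χ s γ ε T J =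
      ∫⁻ p in slab T, ENNReal.ofReal (currentDensity χ s γ ε J p) := by
  have hm : AEMeasurable (fun p => ENNReal.ofReal (currentDensity χ s γ ε J p))
      (((volume : Measure ℝ).restrict (Icc 0 T)).prod (volume : Measure Space)) := by
    rw [← volume_restrict_slab]
    exact (aemeasurable_slab (continuousOn_currentDensity hχ (fun a =>
      (continuousOn_current hF h a).mono fun _ hp => hp.1) s γ ε)).ennreal_ofReal
  rw [volume_restrict_slab, lintegral_prod _ hm]
  rfl

/-- The modified current is controlled by the current and the charge. -/
theorem exists_modifiedCurrent_bound (hχ : IsSmoothStep χ) (hγ : 0 < γ) (hε : 0 < ε) :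
    ∃ C : ℝ, 0 ≤ C ∧ ∀ s : ℝ, s ≤ 1 → ε ≤ s - 1 / 2 → ∀ (T : ℝ) (F : Spacetime → TwoForm)
      (J : Spacetime → OneForm), (∀ p ∈ slab T, ContDiffAt ℝ 1 F p) → MaxwellOn F J (slab T) →
      ∫⁻ p in slab T, ENNReal.ofReal
        (currentDensity χ s γ ε (fun p => J p - chargeCurrent χ (charge J) p) p) ≤
      2 * currentNormSq χ s γ ε T J + ENNReal.ofReal C * ENNReal.ofReal (|charge J| ^ 2) := by
  obtain ⟨M, -, hM⟩ := hχ.exists_deriv_le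
  have hA := sphereArea_nonneg
  refine ⟨2 * (4 ^ 5 * 4 ^ (2 * γ) * M ^ 2 * sphereArea), by positivity,
    fun s hs1 hεs T F J hF h => ?_⟩
  have hJ : AEMeasurable (fun p => ENNReal.ofReal (currentDensity χ s γ ε J p))
      (volume.restrict (slab T)) :=
    (aemeasurable_slab (continuousOn_currentDensity hχ (fun a =>
      (continuousOn_current hF h a).mono fun _ hp => hp.1) s γ ε)).ennreal_ofReal
  calc _ ≤ ∫⁻ p in slab T, (2 * ENNReal.ofReal (currentDensity χ s γ ε J p)
        + 2 * ENNReal.ofReal (currentDensity χ s γ ε (chargeCurrent χ (charge J)) p)) := by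
        refine lintegral_mono fun p => ?_
        have h1 := currentDensity_nonneg hχ s γ ε J p
        have h2 := currentDensity_nonneg hχ s γ ε (chargeCurrent χ (charge J)) p
        refine (ENNReal.ofReal_le_ofReal (currentDensity_sub_le hχ s γ ε J _ p)).trans ?_
        rw [ENNReal.ofReal_add (by positivity) (by positivity), ENNReal.ofReal_mul two_pos.le,
          ENNReal.ofReal_mul two_pos.le, ENNReal.ofReal_ofNat]
    _ = 2 * currentNormSq χ s γ ε T J + 2 * ∫⁻ p in slab T,
          ENNReal.ofReal (currentDensity χ s γ ε (chargeCurrent χ (charge J)) p) := by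
        rw [lintegral_add_left' (hJ.const_mul _), lintegral_const_mul' _ _ (by simp),
          lintegral_const_mul' _ _ (by simp), currentNormSq_eq hχ hF h]
    _ ≤ _ := by
        refine add_le_add le_rfl ?_
        rw [ENNReal.ofReal_mul two_pos.le, ENNReal.ofReal_ofNat, mul_assoc]
        exact mul_le_mul_right (lintegral_chargeCurrent_le hχ hM hγ hε hs1 hεs _ T) _

end Current

end

end MorawetzEM

/-! ### Assembly of the estimate -/

theorem mainTheorem3 (χ : ℝ → ℝ) (hχ : MorawetzEM.IsSmoothStep χ)
    (γ ε δ : ℝ) (hγ : 0 < γ) (hε : 0 < ε) (hδ : 0 < δ) :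
    ∃ C : ℝ, 0 < C ∧
      ∀ s : ℝ, 1 / 2 < s → s ≤ 1 → s + γ ≤ 3 / 2 - δ → ε ≤ s - 1 / 2 →
      ∀ t₀ : ℝ, 0 ≤ t₀ →
      ∀ (F : MorawetzEM.Spacetime → MorawetzEM.TwoForm)
        (J : MorawetzEM.Spacetime → MorawetzEM.OneForm),
        (∀ p ∈ MorawetzEM.slab t₀, ContDiffAt ℝ 1 F p) →
        MorawetzEM.MaxwellOn F J (MorawetzEM.slab t₀) →
        MorawetzEM.morawetzEnergy χ s γ ε t₀ F J ≤
          ENNReal.ofReal C *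
            (MorawetzEM.currentNormSq χ s γ ε t₀ J + MorawetzEM.dataNormSq s γ F J
              + MorawetzEM.chargeDensityNorm s γ J ^ 2) := by
  obtain ⟨K, hK0, hK⟩ := MorawetzEM.exists_weight_bounds hχ hγ hε
  -- The minimum with `γ` gives `s + γ ≥ 1/2 + δ'` because `s > 1/2`; the bound by `1` is required
  -- by the kernel estimates. Thus the constant depends on `γ`, `ε`, `δ` and `χ` only.
  set δ' := min δ (min γ 1) with hδ'
  have hδ0 : 0 < δ' := lt_min hδ (lt_min hγ one_pos)
  have hδδ : δ' ≤ δ := min_le_left _ _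
  have hδγ : δ' ≤ γ := (min_le_right _ _).trans (min_le_left _ _)
  have hδ1 : δ' ≤ 1 := (min_le_right _ _).trans (min_le_right _ _)
  obtain ⟨C₁, hC₁, hcharge⟩ := MorawetzEM.exists_charge_bound hδ0
  obtain ⟨C₂, hC₂, hinit⟩ := MorawetzEM.exists_initial_bound hχ hδ0 hδ1
  obtain ⟨C₃, hC₃, hcurr⟩ := MorawetzEM.exists_modifiedCurrent_bound hχ hγ hε
  set A := 2 + Real.sqrt 2 + 2 * K with hA
  have hA0 : 0 < A := by positivity
  refine ⟨C₁ + A * (K * C₂ + 2 * K ^ 2 * (2 + C₃ * C₁)), by positivity,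
    fun s hs hs1 hsγ hεs T hT F J hF h => ?_⟩
  have hcont : Continuous (MorawetzEM.chargeDensity J) := by
    have h0 := MorawetzEM.continuousOn_current hF h 0
    exact h0.comp_continuous (f := fun y : MorawetzEM.Space => ((0 : ℝ), y)) (by fun_prop)
      fun y => ⟨le_rfl, hT⟩
  obtain ⟨hint, hq⟩ := hcharge s γ (by linarith) J hcont
  set N₁ := MorawetzEM.currentNormSq χ s γ ε T J
  set N₂ := MorawetzEM.dataNormSq s γ F J
  set N₃ := MorawetzEM.chargeDensityNorm s γ J ^ 2
  have hN₁ : N₁ ≤ N₁ + N₂ + N₃ := le_add_right le_self_add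
  have hN₂₃ : N₂ + N₃ ≤ N₁ + N₂ + N₃ := by rw [add_assoc]; exact le_add_self
  have hN₃ : N₃ ≤ N₁ + N₂ + N₃ := le_add_self
  set N := N₁ + N₂ + N₃
  -- If the charge density norm is infinite, so is the right-hand side. Otherwise `J₀` is integrable
  -- at `t = 0`, and the potential and the charge have their intended meaning.
  rcases eq_or_ne N₃ ⊤ with htop | hfin
  · have : N = ⊤ := top_le_iff.mp (htop ▸ hN₃)
    rw [this, ENNReal.mul_top (ENNReal.ofReal_pos.mpr (by positivity)).ne']
    exact le_top
  have hI := (hinit s γ hγ.le (by linarith) (by linarith) F J hcont (hint hfin)).trans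
    (mul_le_mul_right hN₂₃ _)
  have hQ := hq.trans (mul_le_mul_right hN₃ _)
  have hJ : ∫⁻ p in MorawetzEM.slab T, ENNReal.ofReal (MorawetzEM.currentDensity χ s γ ε
      (fun p => J p - MorawetzEM.chargeCurrent χ (MorawetzEM.charge J) p) p) ≤
      ENNReal.ofReal (2 + C₃ * C₁) * N := by
    refine (hcurr s hs1 hεs T F J hF h).trans ?_
    rw [ENNReal.ofReal_add two_pos.le (by positivity), ENNReal.ofReal_ofNat, add_mul,
      ENNReal.ofReal_mul hC₃, mul_assoc (ENNReal.ofReal C₃)]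
    gcongr
  have hE : MorawetzEM.energyBound χ s γ ε K T F J ≤
      ENNReal.ofReal (K * C₂ + 2 * K ^ 2 * (2 + C₃ * C₁)) * N := by
    simp only [MorawetzEM.energyBound, ENNReal.ofReal_mul hK0.le,
      ENNReal.ofReal_mul (show (0 : ℝ) ≤ 2 * K ^ 2 by positivity)]
    rw [lintegral_const_mul' _ _ ENNReal.ofReal_ne_top,
      lintegral_const_mul' _ _ ENNReal.ofReal_ne_top, ENNReal.ofReal_add (by positivity)
      (by positivity), add_mul, ENNReal.ofReal_mul hK0.le,
      ENNReal.ofReal_mul (show (0 : ℝ) ≤ 2 * K ^ 2 by positivity), mul_assoc, mul_assoc]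
    gcongr
  calc _ ≤ _ := MorawetzEM.morawetzEnergy_le hχ hγ hε hεs hs1 hK0 hK hT hF h
    _ ≤ ENNReal.ofReal C₁ * N + ENNReal.ofReal A *
        (ENNReal.ofReal (K * C₂ + 2 * K ^ 2 * (2 + C₃ * C₁)) * N) := by gcongr
    _ = _ := by
        rw [← mul_assoc, ← ENNReal.ofReal_mul hA0.le, ← add_mul,
          ← ENNReal.ofReal_add hC₁ (by positivity)]
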